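/- Write $\mathbb N=\{0,1,2,\dots\}$. Let $m\ge 1$, $I_m=\{(j,\alpha)\in\mathbb N^2 : j+\alpha\le m,\ j<m\}$, $N=\# I_m$, and consider $$(t\partial_t)^m u=F\bigl(t,x,\{(t\partial_t)^j\partial_x^\alpha u\}_{(j,\alpha)\in I_m}\bigr),\qquad(*)$$ where A1) $F(t,x,\boldsymbol z)$, $\boldsymbol z=\{z_{j,\alpha}\}_{(j,\alpha)\in I_m}$, is holomorphic in a polydisk $\Delta$ centred at the origin of $\mathbb C_t\times\mathbb C_x\times\mathbb C^N_{\boldsymbol z}$; A2) $F(0,x,\boldsymbol 0)\equiv 0$ on $\Delta\cap\{t=0,\boldsymbol z=\boldsymbol 0\}$. Write $$F=a(x)t+\sum_{(j,\alpha)\in I_m}b_{j,\alpha}(x)z_{j,\alpha}+R_2(t,x,\boldsymbol z),\qquad R_2=\sum_{i+|\boldsymbol\nu|\ge 2}a_{i,\boldsymbol\nu}(x)t^i\boldsymbol z^{\boldsymbol\nu},$$ and assume A3) $b_{j,\alpha}(x)=O(x^\alpha)$ as $x\to 0$ for all $(j,\alpha)\in I_m$ with $\alpha>0$; put $b_{j,\alpha}(x)=x^\alpha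 c_{j,\alpha}(x)$ for $(j,\alpha)\in I_m$. For a power series $f$ in $x$ write $f\gg 0$ if all its coefficients are real and $\ge 0$. Assume further c1) $(\partial_x^\mu a)(0)>0$ for $0\le\mu\le m$, and $a(x)\gg 0$; c2) $c_{j,\alpha}(0)\le 0$ for all $(j,\alpha)\in I_m$; c3) $c_{j,\alpha}(x)-c_{j,\alpha}(0)\gg 0$ for all $(j,\alpha)\in I_m$; c4) $a_{i,\boldsymbol\nu}(x)\gg 0$ for all $(i,\boldsymbol\nu)$ with $i+|\boldsymbol\nu|\ge 2$. Definitions. Let $\Lambda_0=\{(m,0)\}\cup\{(j,\alpha)\in I_m: c_{j,\alpha}(0)\ne 0\}$, let $\mathcal N_0\subset\mathbb R^2$ be the convex hull of $\bigcup_{(j,\alpha)\in\Lambda_0}\{(X,Y): X\le j,\ Y\le\alpha\}$, and let $\Lambda_1=\{(j,\alpha)\in I_m: c_{j,\alpha}(0)=0,\ c_{j,\alpha}\not\equiv 0\}$. For $(j,\alpha)\in\Lambda_1$ let $p_{j,\alpha}\ge 1$ be the order of the zero of $c_{j,\alpha}$ at $x=0$ and $d_{j,\alpha}=\min\{y\in\mathbb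 R: (j,\alpha-y)\in\mathcal N_0\}$. Put $$\sigma_0=\max\Bigl[1,\max_{(j,\alpha)\in\Lambda_1}\frac{p_{j,\alpha}+d_{j,\alpha}}{p_{j,\alpha}}\Bigr],\qquad s_0=1+\max\Bigl[0,\max_{0\le\mu<m}\max_{(j,\alpha)\in I_m}\frac{j+\mu+\sigma_0(\alpha-\mu)-m}{L_{\mu,j,\alpha}}\Bigr],$$ where $L_{\mu,j,\alpha}\in\mathbb N\cup\{\infty\}$ is the least total degree in $(t,\boldsymbol z)$ of a monomial occurring in $(\partial_{z_{j,\alpha}}\partial_x^\mu R_2)(t,0,\boldsymbol z)$ ($\infty$ if this function vanishes identically, and then the quotient is $0$). For $s,\sigma\ge 1$, a series $\sum_{k,l}u_{k,l}t^kx^l\in\mathbb C[[t,x]]$ belongs to $G\{t,x\}_{(s,\sigma)}$ if $\sum_{k,l}\frac{u_{k,l}}{k!^{s-1}\,l!^{\sigma-1}}t^kx^l$ converges in a neighbourhood of $(0,0)$. Theorem. Under A1)–A3) and c1)–c4): (i) (N) holds, that is, $$L(k,l):=k^m-\sum_{(j,\alpha)\in I_m}c_{j,\alpha}(0)\,k^j\,l(l-1)\cdots(l-\alpha+1)\ne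 0$$ for all integers $k\ge 1$, $l\ge 0$; and $(*)$ has a unique formal solution $u\in\mathbb C[[t,x]]$ with $u(0,x)\equiv 0$. (ii) For $s,\sigma\ge 1$: if $s\ge s_0$ and $\sigma\ge\sigma_0$, then $u\in G\{t,x\}_{(s,\sigma)}$. (iii) If moreover $R_2$ depends on $\boldsymbol z$, that is, $\partial_{z_{j,\alpha}}R_2\not\equiv 0$ for some $(j,\alpha)\in I_m$, then for all $s,\sigma\ge 1$: $u\in G\{t,x\}_{(s,\sigma)}$ if and only if $s\ge s_0$ and $\sigma\ge\sigma_0$. -/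

import Mathlib

open scoped ComplexOrder Nat PowerSeries Topology

noncomputable section

namespace TotChar

/-- The index set `I_m = {(j, α) ∈ ℕ × ℕ ; j + α ≤ m, j < m}`. -/
def Idx (m : ℕ) : Finset (ℕ × ℕ) :=
  (Finset.range m ×ˢ Finset.range (m + 1)).filter fun q => q.1 + q.2 ≤ m

/-- The variables of `F(t, x, z)`: `t`, `x` and `z_{j,α}` for `(j, α) ∈ I_m`. -/
abbrev Var (m : ℕ) : Type := Fin 2 ⊕ Idx m

abbrev Var.t {m : ℕ} : Var m := Sum.inl 0
abbrev Var.x {m : ℕ} : Var m := Sum.inl 1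
abbrev Var.z {m : ℕ} (q : Idx m) : Var m := Sum.inr q

/-- The open polydisk with polyradius `r` centred at the origin. -/
def polydisk {m : ℕ} (r : Var m → ℝ) : Set (Var m → ℂ) := {p | ∀ v, ‖p v‖ < r v}

/-- The Taylor series of `F` at the origin: the coefficient of the monomial with exponent `d` is
`(1 / d!) ∂^d F (0)`. The order in which the partial derivatives are listed is irrelevant for
functions that are analytic at the origin. -/
def taylor {m : ℕ} (F : (Var m → ℂ) → ℂ) : MvPowerSeries (Var m) ℂ := fun d =>
  let l : List (Var m) := (Finsupp.toMultiset d).toList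
  (∏ v, ((d v)! : ℂ))⁻¹ *
    iteratedFDeriv ℂ l.length F 0 (fun k => Pi.single (l.get k) (1 : ℂ))

/-- The exponent of the monomial `t^i x^l z^ν`. -/
def expo {m : ℕ} (i l : ℕ) (ν : Idx m →₀ ℕ) : Var m →₀ ℕ :=
  Finsupp.single Var.t i + Finsupp.single Var.x l + ν.mapDomain Var.z

/-- The Taylor expansion at `x = 0` of the coefficient `a_{i,ν}(x)` of `t^i z^ν` in the expansion
of `F(t, x, z)` with respect to `(t, z)`. -/
def tzCoeff {m : ℕ} (F : (Var m → ℂ) → ℂ) (i : ℕ) (ν : Idx m →₀ ℕ) : ℂ⟦X⟧ :=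
  PowerSeries.mk fun l => MvPowerSeries.coeff (expo i l ν) (taylor F)

/-- `a(x)`, the coefficient of `t`. -/
def aCoeff {m : ℕ} (F : (Var m → ℂ) → ℂ) : ℂ⟦X⟧ := tzCoeff F 1 0

/-- `b_{j,α}(x)`, the coefficient of `z_{j,α}`. -/
def bCoeff {m : ℕ} (F : (Var m → ℂ) → ℂ) (q : Idx m) : ℂ⟦X⟧ := tzCoeff F 0 (Finsupp.single q 1)

/-- `c_{j,α}(x)`, defined by `b_{j,α}(x) = x^α c_{j,α}(x)` when `b_{j,α}(x) = O(x^α)`. -/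
def cCoeff {m : ℕ} (F : (Var m → ℂ) → ℂ) (q : Idx m) : ℂ⟦X⟧ :=
  PowerSeries.mk fun l => PowerSeries.coeff (l + q.1.2) (bCoeff F q)

/-- `f ≫ 0`: all coefficients are real and nonnegative. -/
def MajZero (f : ℂ⟦X⟧) : Prop := ∀ l, 0 ≤ PowerSeries.coeff l f

/-- The total degree in `(t, z)` of a monomial in `(t, x, z)`. -/
def tzDegree {m : ℕ} (d : Var m →₀ ℕ) : ℕ := d Var.t + ∑ q : Idx m, d (Var.z q)

/-- The Taylor series of `R₂(t, x, z)`: the part of `F` of degree at least two in `(t, z)`. -/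
def R2 {m : ℕ} (F : (Var m → ℂ) → ℂ) : MvPowerSeries (Var m) ℂ := fun d =>
  if 2 ≤ tzDegree d then MvPowerSeries.coeff d (taylor F) else 0

/-- `L(λ, ρ) = λ^m - ∑ c_{j,α}(0) λ^j ρ (ρ - 1) ⋯ (ρ - α + 1)`. -/
def charPoly {m : ℕ} (F : (Var m → ℂ) → ℂ) (lam ρ : ℂ) : ℂ :=
  lam ^ m - ∑ q : Idx m, PowerSeries.constantCoeff (cCoeff F q) * lam ^ q.1.1 *
    ∏ n ∈ Finset.range q.1.2, (ρ - n)

/-- The non-resonance condition (N). -/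
def NonResonant {m : ℕ} (F : (Var m → ℂ) → ℂ) : Prop :=
  ∀ k l : ℕ, 1 ≤ k → charPoly F k l ≠ 0

/-- `Λ₀ = {(m, 0)} ∪ {(j, α) ∈ I_m ; c_{j,α}(0) ≠ 0}`. -/
def Lam0 {m : ℕ} (F : (Var m → ℂ) → ℂ) : Set (ℕ × ℕ) :=
  {(m, 0)} ∪ {p | ∃ q : Idx m, PowerSeries.constantCoeff (cCoeff F q) ≠ 0 ∧ p = q.1}

/-- `Λ₁ = {(j, α) ∈ I_m ; c_{j,α}(0) = 0, c_{j,α} ≢ 0}`. -/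
def Lam1 {m : ℕ} (F : (Var m → ℂ) → ℂ) : Set (Idx m) :=
  {q | PowerSeries.constantCoeff (cCoeff F q) = 0 ∧ cCoeff F q ≠ 0}

/-- The Newton polygon at `x = 0`: the convex hull of the union of the quadrants
`{(X, Y) ; X ≤ j, Y ≤ α}` for `(j, α) ∈ Λ₀`. -/
def newtonPolygon {m : ℕ} (F : (Var m → ℂ) → ℂ) : Set (ℝ × ℝ) :=
  convexHull ℝ (⋃ p ∈ Lam0 F, {w : ℝ × ℝ | w.1 ≤ (p.1 : ℝ) ∧ w.2 ≤ (p.2 : ℝ)})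

/-- `p_{j,α}`, the order of the zero of `c_{j,α}` at `x = 0` (used for `(j, α) ∈ Λ₁` only, where
it is finite and positive). -/
def zeroOrder {m : ℕ} (F : (Var m → ℂ) → ℂ) (q : Idx m) : ℕ := (cCoeff F q).order.toNat

/-- `d_{j,α} = min {y ∈ ℝ ; (j, α - y) ∈ 𝓝₀}` (the set is closed, nonempty and bounded below). -/
def vertDist {m : ℕ} (F : (Var m → ℂ) → ℂ) (q : Idx m) : ℝ :=
  sInf {y : ℝ | ((q.1.1 : ℝ), (q.1.2 : ℝ) - y) ∈ newtonPolygon F}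

/-- The irregularity `σ₀` at `x = 0`, the maximum of a finite set. -/
def irregularity {m : ℕ} (F : (Var m → ℂ) → ℂ) : ℝ :=
  sSup (insert 1 {r : ℝ | ∃ q ∈ Lam1 F, r = (zeroOrder F q + vertDist F q) / zeroOrder F q})

/-- For a series `f(t, x, z)`, the valuation of `f(t, 0, z)` with respect to `(t, z)`
(`∞` if `f(t, 0, z) ≡ 0`). -/
def valAtXZero {m : ℕ} (f : MvPowerSeries (Var m) ℂ) : ℕ∞ :=
  sInf {n : ℕ∞ | ∃ d : Var m →₀ ℕ,
    d Var.x = 0 ∧ MvPowerSeries.coeff d f ≠ 0 ∧ n = (tzDegree d : ℕ∞)}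

/-- `L_{μ,j,α} = val ((∂_{z_{j,α}} ∂_x^μ R₂)(t, 0, z))`. -/
def Lval {m : ℕ} (F : (Var m → ℂ) → ℂ) (μ : ℕ) (q : Idx m) : ℕ∞ :=
  valAtXZero (MvPowerSeries.pderiv ℂ (Var.z q)
    ((fun f => MvPowerSeries.pderiv ℂ (Var.x : Var m) f)^[μ] (R2 F)))

/-- The quotient of a real number by an element of `ℕ ∪ {∞}`, with `r / ∞ = 0`. -/
def divENat (r : ℝ) (n : ℕ∞) : ℝ := if n = ⊤ then 0 else r / (n.toNat : ℝ)

/-- The index `s₀`; the supremum is the maximum of a finite set. -/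
def gevreyIndex {m : ℕ} (F : (Var m → ℂ) → ℂ) : ℝ :=
  1 + sSup (insert 0 {r : ℝ | ∃ μ < m, ∃ q : Idx m,
    r = divENat ((q.1.1 : ℝ) + μ + irregularity F * ((q.1.2 : ℝ) - μ) - m) (Lval F μ q)})

/-- `t ∂_t` on `ℂ[[t, x]]`, where `t` and `x` are the variables with index `0` and `1`. -/
def tdt (u : MvPowerSeries (Fin 2) ℂ) : MvPowerSeries (Fin 2) ℂ :=
  MvPowerSeries.X 0 * MvPowerSeries.pderiv ℂ 0 u

/-- `∂_x` on `ℂ[[t, x]]`. -/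
def dx (u : MvPowerSeries (Fin 2) ℂ) : MvPowerSeries (Fin 2) ℂ := MvPowerSeries.pderiv ℂ 1 u

/-- The coefficient of `t^k x^l`. -/
def coeffTX (u : MvPowerSeries (Fin 2) ℂ) (k l : ℕ) : ℂ :=
  MvPowerSeries.coeff (Finsupp.single 0 k + Finsupp.single 1 l) u

/-- The series substituted for the variables of `F`: `t`, `x` and
`z_{j,α} = (t ∂_t)^j ∂_x^α u`. -/
def jet {m : ℕ} (u : MvPowerSeries (Fin 2) ℂ) : Var m → MvPowerSeries (Fin 2) ℂ :=
  Sum.elim (fun i => MvPowerSeries.X i) (fun q => tdt^[q.1.1] (dx^[q.1.2] u))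

/-- `u ∈ ℂ[[t, x]]` satisfies `u(0, x) ≡ 0` and
`(t ∂_t)^m u = F(t, x, {(t ∂_t)^j ∂_x^α u}_{(j,α) ∈ I_m})`. The first condition makes all the
substituted series free of constant terms, so that the formal substitution makes sense. -/
def IsFormalSolution {m : ℕ} (F : (Var m → ℂ) → ℂ) (u : MvPowerSeries (Fin 2) ℂ) : Prop :=
  (∀ l, coeffTX u 0 l = 0) ∧ tdt^[m] u = MvPowerSeries.subst (jet u) (taylor F)

/-- The formal Gevrey class `G{t,x}_{(s,σ)}` (for `s, σ ≥ 1`): the series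
`∑ u_{k,l} / (k!^{s-1} l!^{σ-1}) t^k x^l` converges in a neighbourhood of the origin. -/
def InGevrey (s σ : ℝ) (u : MvPowerSeries (Fin 2) ℂ) : Prop :=
  ∀ᶠ w : ℂ × ℂ in 𝓝 0, Summable fun n : ℕ × ℕ =>
    coeffTX u n.1 n.2 / (((n.1 ! : ℝ) ^ (s - 1) * (n.2 ! : ℝ) ^ (σ - 1) : ℝ) : ℂ) *
      w.1 ^ n.1 * w.2 ^ n.2

end TotChar

end

noncomputable section

/-! ### Coefficients of monomials in the jet of a series -/

namespace TotChar

/-- The exponent of the monomial `t^k x^l`. -/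
def txExp (k l : ℕ) : Fin 2 →₀ ℕ := Finsupp.single 0 k + Finsupp.single 1 l

@[simp] lemma txExp_zero (k l : ℕ) : txExp k l 0 = k := by simp [txExp]
@[simp] lemma txExp_one (k l : ℕ) : txExp k l 1 = l := by simp [txExp]

lemma txExp_eta (e : Fin 2 →₀ ℕ) : txExp (e 0) (e 1) = e := by
  ext i; fin_cases i <;> simp

lemma eq_txExp_iff {e : Fin 2 →₀ ℕ} {k l : ℕ} : e = txExp k l ↔ e 0 = k ∧ e 1 = l := by
  constructor
  · rintro rfl; simp
  · rintro ⟨rfl, rfl⟩; exact (txExp_eta e).symm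

lemma txExp_le_iff {a b k l : ℕ} : txExp a b ≤ txExp k l ↔ a ≤ k ∧ b ≤ l := by
  rw [Finsupp.le_def]
  constructor
  · intro h; exact ⟨by simpa using h 0, by simpa using h 1⟩
  · rintro ⟨h0, h1⟩ i; fin_cases i <;> simpa

lemma txExp_sub (a b k l : ℕ) : txExp k l - txExp a b = txExp (k - a) (l - b) := by
  ext i; fin_cases i <;> simp

section Series

variable {R : Type*} [CommSemiring R]

/-- The series `∑ U k l t^k x^l`. -/
def ser (U : ℕ → ℕ → R) : MvPowerSeries (Fin 2) R := fun e => U (e 0) (e 1)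

lemma coeff_ser (U : ℕ → ℕ → R) (e : Fin 2 →₀ ℕ) :
    MvPowerSeries.coeff e (ser U) = U (e 0) (e 1) := rfl

variable {m : ℕ}

/-- The series `t^i x^β ∏_q Z_q^{ν_q}`, where `d` is the exponent of `t^i x^β z^ν`. -/
def jetMonomial (Z : Idx m → ℕ → ℕ → R) (d : Var m →₀ ℕ) : MvPowerSeries (Fin 2) R :=
  MvPowerSeries.X 0 ^ d Var.t * MvPowerSeries.X 1 ^ d Var.x * ∏ q, ser (Z q) ^ d (Var.z q)

/-- The coefficient of `t^k x^l` in `jetMonomial Z d`. -/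
def monCoeff (Z : Idx m → ℕ → ℕ → R) (d : Var m →₀ ℕ) (k l : ℕ) : R :=
  MvPowerSeries.coeff (txExp k l) (jetMonomial Z d)

/-- The factors of `z^ν`, listed with multiplicity. -/
abbrev Factor (d : Var m →₀ ℕ) : Type := Σ q : Idx m, Fin (d (Var.z q))

/-- The ways to distribute the exponents of `t^k x^l` over the factors of a monomial. -/
def splits (d : Var m →₀ ℕ) (k l : ℕ) : Finset (Factor d →₀ (Fin 2 →₀ ℕ)) :=
  if d Var.t ≤ k ∧ d Var.x ≤ l then
    Finset.finsuppAntidiag Finset.univ (txExp (k - d Var.t) (l - d Var.x)) else ∅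

lemma mem_splits {d : Var m →₀ ℕ} {k l : ℕ} {f : Factor d →₀ (Fin 2 →₀ ℕ)} :
    f ∈ splits d k l ↔ d Var.t + ∑ r, f r 0 = k ∧ d Var.x + ∑ r, f r 1 = l := by
  unfold splits
  split_ifs with h
  · simp only [Finset.mem_finsuppAntidiag, Finset.subset_univ, and_true, eq_txExp_iff,
      Finsupp.finsetSum_apply]
    omega
  · simp only [Finset.notMem_empty, false_iff]
    omega

lemma coeff_X_pow_mul_X_pow_mul (a b k l : ℕ) (f : MvPowerSeries (Fin 2) R) :
    MvPowerSeries.coeff (txExp k l) (MvPowerSeries.X 0 ^ a * MvPowerSeries.X 1 ^ b * f) =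
      if a ≤ k ∧ b ≤ l then MvPowerSeries.coeff (txExp (k - a) (l - b)) f else 0 := by
  rw [MvPowerSeries.X_pow_eq, MvPowerSeries.X_pow_eq, MvPowerSeries.monomial_mul_monomial,
    MvPowerSeries.coeff_monomial_mul]
  change (if txExp a b ≤ txExp k l then 1 * 1 * MvPowerSeries.coeff (txExp k l - txExp a b) f
    else 0) = _
  simp only [txExp_le_iff, txExp_sub, one_mul]

lemma monCoeff_eq_sum (Z : Idx m → ℕ → ℕ → R) (d : Var m →₀ ℕ) (k l : ℕ) :
    monCoeff Z d k l = ∑ f ∈ splits d k l, ∏ r, Z r.1 (f r 0) (f r 1) := by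
  have h : ∏ q, ser (Z q) ^ d (Var.z q) = ∏ r : Factor d, ser (Z r.1) := by
    rw [Fintype.prod_sigma]; simp
  unfold monCoeff jetMonomial splits
  rw [coeff_X_pow_mul_X_pow_mul]
  split_ifs with hc
  · rw [h, MvPowerSeries.coeff_prod]; rfl
  · simp

lemma map_monCoeff {S : Type*} [CommSemiring S] (g : R →+* S) (Z : Idx m → ℕ → ℕ → R)
    (d : Var m →₀ ℕ) (k l : ℕ) :
    g (monCoeff Z d k l) = monCoeff (fun q k l => g (Z q k l)) d k l := by
  simp [monCoeff_eq_sum]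

/-- `(t ∂_t)^j ∂_x^α` on the level of coefficients. -/
def zCoeff (U : ℕ → ℕ → R) (q : Idx m) (k l : ℕ) : R :=
  (k : R) ^ q.1.1 * ((l + q.1.2).descFactorial q.1.2 : R) * U k (l + q.1.2)

/-- All exponents that are at most `n`. -/
def box (m n : ℕ) : Finset (Var m →₀ ℕ) := Finset.Iic (Finsupp.equivFunOnFinite.symm fun _ => n)

lemma mem_box {n : ℕ} {d : Var m →₀ ℕ} : d ∈ box m n ↔ ∀ v, d v ≤ n := by
  simp [box, Finsupp.le_def]

/-- The total order in `t` of the factors gives a lower bound for the order of the product. -/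
lemma monCoeff_eq_zero {Z : Idx m → ℕ → ℕ → R} (hZ : ∀ q l, Z q 0 l = 0) {d : Var m →₀ ℕ}
    {k l : ℕ} (h : k < tzDegree d) : monCoeff Z d k l = 0 := by
  rw [monCoeff_eq_sum]
  refine Finset.sum_eq_zero fun f hf => ?_
  rw [mem_splits] at hf
  obtain ⟨r, hr⟩ : ∃ r, f r 0 = 0 := by
    by_contra! hne
    have : ∑ r : Factor d, 1 ≤ ∑ r, f r 0 :=
      Finset.sum_le_sum fun r _ => Nat.one_le_iff_ne_zero.2 (hne r)
    simp only [Finset.sum_const, Finset.card_univ, Fintype.card_sigma, Fintype.card_fin,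
      smul_eq_mul, mul_one] at this
    unfold tzDegree at h
    omega
  exact Finset.prod_eq_zero (Finset.mem_univ r) (by rw [hr, hZ])

/-- The exponents of t and z are bounded by the degree in (t, z), which cannot exceed the order in t
when all factors have positive order; the exponent of x is bounded by l directly. Substitution
thereby becomes a finite sum. -/
lemma monCoeff_eq_zero_of_notMem_box {Z : Idx m → ℕ → ℕ → R} (hZ : ∀ q l, Z q 0 l = 0)
    {d : Var m →₀ ℕ} {k l : ℕ} (h : d ∉ box m (k + l)) : monCoeff Z d k l = 0 := by
  rw [mem_box] at h
  push Not at h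
  obtain ⟨v, hv⟩ := h
  by_cases hd : k < tzDegree d
  · exact monCoeff_eq_zero hZ hd
  · rw [monCoeff_eq_sum]
    suffices splits d k l = ∅ by simp [this]
    refine Finset.eq_empty_of_forall_notMem fun f hf => ?_
    rw [mem_splits] at hf
    have hle : v = Var.x ∨ d v ≤ tzDegree d := by
      unfold tzDegree
      rcases v with v | q
      · fin_cases v
        · right; simp
        · left; rfl
      · right
        exact (Finset.single_le_sum (f := fun q : Idx m => d (Var.z q)) (fun _ _ => Nat.zero_le _)
          (Finset.mem_univ q)).trans (Nat.le_add_left _ _)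
    rcases hle with rfl | hle <;> omega

/-- In a monomial of degree at least two each factor is of lower order than the product. -/
lemma lt_of_mem_splits {d : Var m →₀ ℕ} (hd : 2 ≤ tzDegree d) {k l : ℕ}
    {f : Factor d →₀ (Fin 2 →₀ ℕ)} (hf : f ∈ splits d k l) (hpos : ∀ r, f r 0 ≠ 0) (r : Factor d) :
    f r 0 < k := by
  rw [mem_splits] at hf
  have h1 := Finset.add_sum_erase Finset.univ (fun r => f r 0) (Finset.mem_univ r)
  have h2 : ∑ r ∈ Finset.univ.erase r, 1 ≤ ∑ r ∈ Finset.univ.erase r, f r 0 :=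
    Finset.sum_le_sum fun r _ => Nat.one_le_iff_ne_zero.2 (hpos r)
  simp only [Finset.sum_const, Finset.card_erase_of_mem (Finset.mem_univ r), Finset.card_univ,
    Fintype.card_sigma, Fintype.card_fin, smul_eq_mul, mul_one] at h2
  unfold tzDegree at hd
  omega

/-- This makes the recursion triangular in k: since no factor has a term of order zero in t, a
product of degree at least two leaves to each factor an order below k. -/
lemma monCoeff_congr {Z Z' : Idx m → ℕ → ℕ → R} (hZ : ∀ q l, Z q 0 l = 0)
    (hZ' : ∀ q l, Z' q 0 l = 0) {d : Var m →₀ ℕ} (hd : 2 ≤ tzDegree d) {k l : ℕ}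
    (h : ∀ q, ∀ k' < k, ∀ l, Z q k' l = Z' q k' l) : monCoeff Z d k l = monCoeff Z' d k l := by
  rw [monCoeff_eq_sum, monCoeff_eq_sum]
  refine Finset.sum_congr rfl fun f hf => ?_
  by_cases hpos : ∀ r, f r 0 ≠ 0
  · exact Finset.prod_congr rfl fun r _ => h _ _ (lt_of_mem_splits hd hf hpos r) _
  · push Not at hpos
    obtain ⟨r, hr⟩ := hpos
    rw [Finset.prod_eq_zero (Finset.mem_univ r) (by rw [hr, hZ]),
      Finset.prod_eq_zero (Finset.mem_univ r) (by rw [hr, hZ'])]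

@[simp] lemma expo_t (i l : ℕ) (ν : Idx m →₀ ℕ) : expo i l ν Var.t = i := by
  simp [expo, Finsupp.mapDomain_of_notMem_range]

@[simp] lemma expo_x (i l : ℕ) (ν : Idx m →₀ ℕ) : expo i l ν Var.x = l := by
  simp [expo, Finsupp.mapDomain_of_notMem_range]

@[simp] lemma expo_z (i l : ℕ) (ν : Idx m →₀ ℕ) (q : Idx m) : expo i l ν (Var.z q) = ν q := by
  simp [expo, Finsupp.mapDomain_apply Sum.inr_injective]

lemma expo_eta (d : Var m →₀ ℕ) :
    expo (d Var.t) (d Var.x) (Finsupp.equivFunOnFinite.symm fun q => d (Var.z q)) = d := by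
  ext v
  rcases v with v | q
  · fin_cases v
    · exact expo_t _ _ _
    · exact expo_x _ _ _
  · exact (expo_z _ _ _ q).trans (by simp)

lemma eq_expo_iff {d : Var m →₀ ℕ} {i l : ℕ} {ν : Idx m →₀ ℕ} :
    d = expo i l ν ↔ d Var.t = i ∧ d Var.x = l ∧ ∀ q, d (Var.z q) = ν q := by
  constructor
  · rintro rfl; simp
  · rintro ⟨h1, h2, h3⟩
    rw [← expo_eta d]
    congr 1
    ext q; simp [h3]

lemma tzDegree_expo (i l : ℕ) (ν : Idx m →₀ ℕ) : tzDegree (expo i l ν) = i + ∑ q, ν q := by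
  simp [tzDegree]

lemma tzDegree_eq_zero {d : Var m →₀ ℕ} (h : tzDegree d = 0) : d = expo 0 (d Var.x) 0 := by
  unfold tzDegree at h
  rw [eq_expo_iff]
  refine ⟨by omega, rfl, fun q => ?_⟩
  have := Finset.sum_eq_zero_iff.1 (show ∑ q : Idx m, d (Var.z q) = 0 by omega) q
    (Finset.mem_univ q)
  simpa using this

lemma tzDegree_eq_one {d : Var m →₀ ℕ} (h : tzDegree d = 1) :
    d = expo 1 (d Var.x) 0 ∨ ∃ q, d = expo 0 (d Var.x) (Finsupp.single q 1) := by
  unfold tzDegree at h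
  by_cases ht : d Var.t = 0
  · right
    have hs : ∑ q : Idx m, d (Var.z q) = 1 := by omega
    obtain ⟨q, hq⟩ : ∃ q, d (Var.z q) ≠ 0 := by
      by_contra! hne
      simp [hne] at hs
    refine ⟨q, eq_expo_iff.2 ⟨ht, rfl, fun q' => ?_⟩⟩
    have h1 := Finset.add_sum_erase Finset.univ (fun q : Idx m => d (Var.z q)) (Finset.mem_univ q)
    by_cases hqq : q = q'
    · subst hqq; rw [Finsupp.single_eq_same]; omega
    · rw [Finsupp.single_eq_of_ne (Ne.symm hqq)]
      have h2 : ∑ q ∈ Finset.univ.erase q, d (Var.z q) = 0 := by omega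
      exact Finset.sum_eq_zero_iff.1 h2 q' (by simp [Ne.symm hqq])
  · left
    refine eq_expo_iff.2 ⟨by omega, rfl, fun q => ?_⟩
    have := Finset.sum_eq_zero_iff.1 (show ∑ q : Idx m, d (Var.z q) = 0 by omega) q
      (Finset.mem_univ q)
    simpa using this

lemma monCoeff_expo_one_zero (Z : Idx m → ℕ → ℕ → R) (h k l : ℕ) :
    monCoeff Z (expo 1 h 0) k l = if k = 1 ∧ h = l then 1 else 0 := by
  unfold monCoeff jetMonomial
  rw [coeff_X_pow_mul_X_pow_mul]
  simp only [expo_t, expo_x, expo_z, Finsupp.coe_zero, Pi.zero_apply, pow_zero, Finset.prod_const_one,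
    MvPowerSeries.coeff_one]
  have : (txExp (k - 1) (l - h) = 0) ↔ k - 1 = 0 ∧ l - h = 0 := by
    rw [show (0 : Fin 2 →₀ ℕ) = txExp 0 0 by simp [txExp], eq_txExp_iff]; simp
  simp only [this]
  split_ifs <;> first | rfl | omega

lemma monCoeff_expo_zero_single (Z : Idx m → ℕ → ℕ → R) (q : Idx m) (h k l : ℕ) :
    monCoeff Z (expo 0 h (Finsupp.single q 1)) k l = if h ≤ l then Z q k (l - h) else 0 := by
  unfold monCoeff jetMonomial
  rw [coeff_X_pow_mul_X_pow_mul]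
  have : ∏ q' : Idx m, ser (Z q') ^ (expo 0 h (Finsupp.single q 1)) (Var.z q') = ser (Z q) := by
    rw [Finset.prod_eq_single q]
    · simp
    · intro q' _ hne; simp [Finsupp.single_eq_of_ne hne]
    · simp
  rw [this]
  simp [coeff_ser]

/-- The contribution of the monomials of degree at least two in `(t, z)`. -/
def nonlin (G : (Var m →₀ ℕ) → R) (Z : Idx m → ℕ → ℕ → R) (k l : ℕ) : R :=
  ∑ d ∈ (box m (k + l)).filter fun d => 2 ≤ tzDegree d, G d * monCoeff Z d k l

/-- The coefficient of `x^h` in `c_q`. -/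
def cFun (G : (Var m →₀ ℕ) → R) (q : Idx m) (h : ℕ) : R := G (expo 0 (h + q.1.2) (Finsupp.single q 1))

/-- The coefficient of `x^l` in `a`. -/
def aFun (G : (Var m →₀ ℕ) → R) (l : ℕ) : R := G (expo 1 l 0)

/-- The coefficient of `t^k x^l` in `c_q(x) x^α (t ∂_t)^j ∂_x^α u`. -/
lemma sum_zCoeff_eq (G : (Var m →₀ ℕ) → R) (U : ℕ → ℕ → R) (q : Idx m)
    (hb : ∀ h < q.1.2, G (expo 0 h (Finsupp.single q 1)) = 0) (k l : ℕ) :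
    ∑ h ∈ Finset.range (l + 1), G (expo 0 h (Finsupp.single q 1)) * zCoeff U q k (l - h) =
      ∑ h ∈ Finset.range (l + 1),
        cFun G q h * ((k : R) ^ q.1.1 * ((l - h).descFactorial q.1.2 : R) * U k (l - h)) := by
  set α := q.1.2 with hα
  by_cases hl : α ≤ l
  · obtain ⟨n, rfl⟩ := Nat.exists_eq_add_of_le hl
    rw [show α + n + 1 = α + (n + 1) by ring, Finset.sum_range_add _ α (n + 1),
      Finset.sum_eq_zero (fun h hh => by rw [hb h (Finset.mem_range.1 hh), zero_mul]), zero_add,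
      show α + (n + 1) = (n + 1) + α by ring, Finset.sum_range_add _ (n + 1) α,
      Finset.sum_eq_zero (s := Finset.range α), add_zero]
    · refine Finset.sum_congr rfl fun h hh => ?_
      rw [Finset.mem_range] at hh
      unfold cFun zCoeff
      rw [← hα, show α + n - (α + h) + α = α + n - h by omega, show α + h = h + α by ring]
    -- x^α ∂_x^α annihilates the powers of x below α, so the last α summands vanish.
    · intro h hh
      rw [Finset.mem_range] at hh
      rw [(Nat.descFactorial_eq_zero_iff_lt).2 (by omega)]
      simp
  · rw [Finset.sum_eq_zero, Finset.sum_eq_zero]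
    · intro h hh
      rw [(Nat.descFactorial_eq_zero_iff_lt).2 (by omega)]
      simp
    · intro h hh
      rw [Finset.mem_range] at hh
      rw [hb h (by omega), zero_mul]

/-- The monomials are sorted by their degree in (t, z): degree zero drops out by A2, degree one
produces a and the linear terms, and the rest is the nonlinear part. -/
lemma sum_box_eq (G : (Var m →₀ ℕ) → R) (U : ℕ → ℕ → R)
    (hG : ∀ h, G (expo 0 h 0) = 0)
    (hb : ∀ q : Idx m, ∀ h < q.1.2, G (expo 0 h (Finsupp.single q 1)) = 0) {k : ℕ}
    (hk : 1 ≤ k) (l : ℕ) :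
    ∑ d ∈ box m (k + l), G d * monCoeff (zCoeff U) d k l =
      (if k = 1 then aFun G l else 0) +
      ∑ q, ∑ h ∈ Finset.range (l + 1),
        cFun G q h * ((k : R) ^ q.1.1 * ((l - h).descFactorial q.1.2 : R) * U k (l - h)) +
      nonlin G (zCoeff U) k l := by
  classical
  rw [← Finset.sum_filter_add_sum_filter_not (box m (k + l)) (fun d => 2 ≤ tzDegree d), add_comm]
  congr 1
  rw [← Finset.sum_filter_add_sum_filter_not _ (fun d => d Var.t = 1)]
  congr 1
  · have : (if k = 1 then aFun G l else 0) =
        G (expo 1 l 0) * monCoeff (m := m) (zCoeff U) (expo 1 l 0) k l := by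
      rw [monCoeff_expo_one_zero]; simp [aFun]
    rw [this]
    apply Finset.sum_eq_single
    · intro d hd hne
      simp only [Finset.mem_filter, not_le] at hd
      have hd1 : tzDegree d = 1 := by
        have : d Var.t ≤ tzDegree d := Nat.le_add_right _ _
        omega
      rcases tzDegree_eq_one hd1 with h | ⟨q, h⟩
      · rw [h, monCoeff_expo_one_zero, if_neg, mul_zero]
        rintro ⟨-, h2⟩
        rw [h2] at h
        exact hne h
      · rw [h] at hd; simp at hd
    · intro hd
      rw [monCoeff_expo_one_zero]
      split_ifs with h
      · exfalso
        apply hd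
        simp only [Finset.mem_filter, mem_box, tzDegree_expo, expo_t]
        refine ⟨⟨?_, by simp⟩, trivial⟩
        rintro (v | q)
        · fin_cases v
          · exact (expo_t 1 l 0).le.trans (by omega)
          · exact (expo_x 1 l 0).le.trans (by omega)
        · rw [show (Sum.inr q : Var m) = Var.z q from rfl, expo_z]; simp
      · simp
  · have h1 : ∀ q : Idx m, ∑ h ∈ Finset.range (l + 1),
        cFun G q h * ((k : R) ^ q.1.1 * ((l - h).descFactorial q.1.2 : R) * U k (l - h)) =
        ∑ h ∈ Finset.range (l + 1), G (expo 0 h (Finsupp.single q 1)) *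
          monCoeff (zCoeff U) (expo 0 h (Finsupp.single q 1)) k l := by
      intro q
      rw [← sum_zCoeff_eq G U q (hb q)]
      refine Finset.sum_congr rfl fun h hh => ?_
      rw [monCoeff_expo_zero_single, if_pos (by simpa [Nat.lt_succ_iff] using hh)]
    rw [Finset.sum_congr rfl fun q _ => h1 q, ← Finset.sum_product']
    symm
    apply Finset.sum_of_injOn (fun p : Idx m × ℕ => expo 0 p.2 (Finsupp.single p.1 1))
    · rintro ⟨q, h⟩ - ⟨q', h'⟩ - heq
      simp only at heq
      have e1 : h = h' := by
        have := DFunLike.congr_fun heq Var.x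
        simpa using this
      have e2 := DFunLike.congr_fun heq (Var.z q)
      simp only [expo_z, Finsupp.single_eq_same] at e2
      have : q = q' := by
        by_contra hne
        rw [Finsupp.single_eq_of_ne hne] at e2
        simp at e2
      rw [this, e1]
    · rintro ⟨q, h⟩ hh
      simp only [Finset.coe_product, Finset.coe_univ, Set.mem_prod, Finset.coe_range,
        Set.mem_Iio] at hh
      simp only [Finset.coe_filter, Set.mem_ofPred_eq, mem_box, tzDegree_expo, expo_t,
        Finset.mem_filter]
      refine ⟨⟨?_, ?_⟩, by simp⟩
      · rintro (v | q')
        · fin_cases v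
          · exact (expo_t 0 h _).le.trans (by omega)
          · exact (expo_x 0 h _).le.trans (by omega)
        · rw [show (Sum.inr q' : Var m) = Var.z q' from rfl, expo_z]
          rw [Finsupp.single_apply]; split_ifs <;> omega
      · rw [Finset.sum_eq_single q]
        · simp
        · intro b _ hne; rw [Finsupp.single_eq_of_ne hne]
        · simp
    · intro d hd hnot
      simp only [Finset.mem_filter, not_le] at hd
      have hd1 : tzDegree d = 0 ∨ tzDegree d = 1 := by omega
      rcases hd1 with h | h
      · rw [tzDegree_eq_zero h, hG, zero_mul]
      · rcases tzDegree_eq_one h with h | ⟨q, h⟩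
        · exfalso; apply hd.2; rw [h]; simp
        · rw [h, monCoeff_expo_zero_single]
          split_ifs with hle
          · exfalso
            apply hnot
            exact ⟨(q, d Var.x), by simpa [Nat.lt_succ_iff] using hle, h.symm⟩
          · rw [mul_zero]
    · rintro ⟨q, h⟩ -
      rfl

end Series

end TotChar

end

noncomputable section

namespace TotChar

/-! ### Substitution of the jet into a power series -/

section Jets

variable {m : ℕ}

lemma coeffTX_eq (u : MvPowerSeries (Fin 2) ℂ) (k l : ℕ) :
    coeffTX u k l = MvPowerSeries.coeff (txExp k l) u := rfl

lemma ser_coeffTX (u : MvPowerSeries (Fin 2) ℂ) : ser (coeffTX u) = u := by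
  ext e
  rw [coeff_ser, coeffTX_eq, txExp_eta]

lemma coeffTX_ser (U : ℕ → ℕ → ℂ) : coeffTX (ser U) = U := by
  funext k l
  rw [coeffTX_eq, coeff_ser, txExp_zero, txExp_one]

lemma coeffTX_tdt (u : MvPowerSeries (Fin 2) ℂ) (k l : ℕ) :
    coeffTX (tdt u) k l = k * coeffTX u k l := by
  have h := coeff_X_pow_mul_X_pow_mul 1 0 k l (MvPowerSeries.pderiv ℂ 0 u)
  rw [pow_one, pow_zero, mul_one] at h
  rw [coeffTX_eq, tdt, h]
  rcases k with _ | k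
  · simp
  · rw [if_pos (by omega), MvPowerSeries.coeff_pderiv, coeffTX_eq, mul_comm,
      show txExp (k + 1 - 1) (l - 0) + Finsupp.single 0 1 = txExp (k + 1) l from ?_]
    · simp
    · rw [eq_txExp_iff]; simp

lemma coeffTX_dx (u : MvPowerSeries (Fin 2) ℂ) (k l : ℕ) :
    coeffTX (dx u) k l = (l + 1) * coeffTX u k (l + 1) := by
  rw [coeffTX_eq, dx, MvPowerSeries.coeff_pderiv, coeffTX_eq, mul_comm,
    show txExp k l + Finsupp.single 1 1 = txExp k (l + 1) from ?_]
  · simp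
  · rw [eq_txExp_iff]; simp

lemma coeffTX_tdt_iterate (u : MvPowerSeries (Fin 2) ℂ) (j k l : ℕ) :
    coeffTX (tdt^[j] u) k l = (k : ℂ) ^ j * coeffTX u k l := by
  induction j with
  | zero => simp
  | succ j ih => rw [Function.iterate_succ_apply', coeffTX_tdt, ih]; ring

lemma coeffTX_dx_iterate (u : MvPowerSeries (Fin 2) ℂ) (α k l : ℕ) :
    coeffTX (dx^[α] u) k l = ((l + α).descFactorial α : ℂ) * coeffTX u k (l + α) := by
  induction α generalizing l with
  | zero => simp
  | succ α ih =>
    rw [Function.iterate_succ_apply', coeffTX_dx, ih, show l + 1 + α = l + (α + 1) by ring,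
      Nat.descFactorial_succ, show l + (α + 1) - α = l + 1 by omega]
    push_cast; ring

lemma jet_inr (u : MvPowerSeries (Fin 2) ℂ) (q : Idx m) :
    jet u (Var.z q) = ser (zCoeff (coeffTX u) q) := by
  rw [← ser_coeffTX (jet u (Var.z q))]
  congr 1
  funext k l
  simp only [jet, Sum.elim_inr, coeffTX_tdt_iterate, coeffTX_dx_iterate, zCoeff]
  ring

lemma prod_jet (u : MvPowerSeries (Fin 2) ℂ) (d : Var m →₀ ℕ) :
    (d.prod fun v n => jet u v ^ n) = jetMonomial (zCoeff (coeffTX u)) d := by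
  rw [Finsupp.prod_fintype _ _ (by simp), Fintype.prod_sum_type, Fin.prod_univ_two, jetMonomial]
  congr 1
  exact Finset.prod_congr rfl fun q _ => by rw [← jet_inr]

lemma hasSubst_jet {u : MvPowerSeries (Fin 2) ℂ} (hu : ∀ l, coeffTX u 0 l = 0) :
    MvPowerSeries.HasSubst (jet (m := m) u) := by
  refine MvPowerSeries.hasSubst_of_constantCoeff_zero fun v => ?_
  rcases v with v | q
  · simp [jet]
  · rw [show (Sum.inr q : Var m) = Var.z q from rfl, jet_inr,
      ← MvPowerSeries.coeff_zero_eq_constantCoeff_apply, coeff_ser]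
    simp [zCoeff, hu]

lemma zCoeff_zero {R : Type*} [CommSemiring R] {U : ℕ → ℕ → R} (hU : ∀ l, U 0 l = 0) (q : Idx m)
    (l : ℕ) : zCoeff U q 0 l = 0 := by
  simp [zCoeff, hU]

lemma coeff_subst_jet {u : MvPowerSeries (Fin 2) ℂ} (hu : ∀ l, coeffTX u 0 l = 0)
    (f : MvPowerSeries (Var m) ℂ) (k l : ℕ) :
    coeffTX (MvPowerSeries.subst (jet u) f) k l =
      ∑ d ∈ box m (k + l), MvPowerSeries.coeff d f * monCoeff (zCoeff (coeffTX u)) d k l := by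
  rw [coeffTX_eq, MvPowerSeries.coeff_subst (hasSubst_jet hu), finsum_eq_sum_of_support_subset]
  · exact Finset.sum_congr rfl fun d _ => by rw [smul_eq_mul, prod_jet, monCoeff]
  · intro d hd
    by_contra hd'
    apply hd
    simp only [prod_jet]
    change _ • monCoeff (zCoeff (coeffTX u)) d k l = 0
    rw [monCoeff_eq_zero_of_notMem_box (zCoeff_zero hu) hd', smul_zero]

end Jets

/-! ### The equation as a recursion for the coefficients -/

section Recursion

variable {m : ℕ} {R : Type*} [CommRing R]

/-- The values `L(k, l)`. -/
def charFun (G : (Var m →₀ ℕ) → R) (k l : ℕ) : R :=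
  (k : R) ^ m - ∑ q : Idx m, cFun G q 0 * (k : R) ^ q.1.1 * (l.descFactorial q.1.2 : R)

/-- The part of the equation that couples `U k l` with the `U k l'`, `l' < l`. -/
def linPart (G : (Var m →₀ ℕ) → R) (U : ℕ → ℕ → R) (k l : ℕ) : R :=
  ∑ q : Idx m, ∑ h ∈ Finset.range l, cFun G q (h + 1) *
    ((k : R) ^ q.1.1 * ((l - (h + 1)).descFactorial q.1.2 : R) * U k (l - (h + 1)))

/-- The recursion formula for the coefficients of a formal solution. -/
def IsRecSol (G : (Var m →₀ ℕ) → R) (U : ℕ → ℕ → R) : Prop :=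
  (∀ l, U 0 l = 0) ∧ ∀ k, 1 ≤ k → ∀ l, charFun G k l * U k l =
    (if k = 1 then aFun G l else 0) + linPart G U k l + nonlin G (zCoeff U) k l

/-- The summands with h = 0 of the linear terms carry `U k l` itself; moving them to the left
produces L(k, l). -/
lemma charFun_mul_eq_iff (G : (Var m →₀ ℕ) → R) (U : ℕ → ℕ → R)
    (hG : ∀ h, G (expo 0 h 0) = 0)
    (hb : ∀ q : Idx m, ∀ h < q.1.2, G (expo 0 h (Finsupp.single q 1)) = 0) {k : ℕ}
    (hk : 1 ≤ k) (l : ℕ) :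
    (k : R) ^ m * U k l = ∑ d ∈ box m (k + l), G d * monCoeff (zCoeff U) d k l ↔
    charFun G k l * U k l =
      (if k = 1 then aFun G l else 0) + linPart G U k l + nonlin G (zCoeff U) k l := by
  have h : ∑ q : Idx m, ∑ h ∈ Finset.range (l + 1),
        cFun G q h * ((k : R) ^ q.1.1 * ((l - h).descFactorial q.1.2 : R) * U k (l - h)) =
      linPart G U k l +
        (∑ q : Idx m, cFun G q 0 * (k : R) ^ q.1.1 * (l.descFactorial q.1.2 : R)) * U k l := by
    unfold linPart
    rw [Finset.sum_mul, ← Finset.sum_add_distrib]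
    refine Finset.sum_congr rfl fun q _ => ?_
    rw [Finset.sum_range_succ']
    simp only [Nat.sub_zero]
    ring
  rw [sum_box_eq G U hG hb hk, h, charFun, sub_mul, sub_eq_iff_eq_add]
  ring_nf

/-- At k = 0 both sides of the equation vanish on their own, so only k ≥ 1 carries information. -/
lemma isFormalSolution_iff {F : (Var m → ℂ) → ℂ}
    (hG : ∀ h, MvPowerSeries.coeff (expo 0 h 0) (taylor F) = 0)
    (hb : ∀ q : Idx m, ∀ h < q.1.2,
      MvPowerSeries.coeff (expo 0 h (Finsupp.single q 1)) (taylor F) = 0)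
    (u : MvPowerSeries (Fin 2) ℂ) :
    IsFormalSolution F u ↔
      IsRecSol (fun d => MvPowerSeries.coeff d (taylor F)) (coeffTX u) := by
  unfold IsFormalSolution IsRecSol
  refine and_congr_right fun hu => ?_
  have h1 : tdt^[m] u = MvPowerSeries.subst (jet u) (taylor F) ↔ ∀ k l : ℕ,
      (k : ℂ) ^ m * coeffTX u k l = ∑ d ∈ box m (k + l),
        MvPowerSeries.coeff d (taylor F) * monCoeff (zCoeff (coeffTX u)) d k l := by
    constructor
    · intro h k l
      rw [← coeff_subst_jet hu, ← h, coeffTX_tdt_iterate]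
    · intro h
      rw [← ser_coeffTX (tdt^[m] u), ← ser_coeffTX (MvPowerSeries.subst (jet u) (taylor F))]
      congr 1
      funext k l
      rw [coeff_subst_jet hu, ← h, coeffTX_tdt_iterate]
  rw [h1]
  constructor
  · intro h k hk l
    exact (charFun_mul_eq_iff (fun d => MvPowerSeries.coeff d (taylor F)) (coeffTX u) hG hb hk l).1
      (h k l)
  · intro h k l
    rcases Nat.eq_zero_or_pos k with rfl | hk
    · rw [hu, mul_zero, eq_comm]
      refine Finset.sum_eq_zero fun d _ => ?_
      by_cases hd : 0 < tzDegree d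
      · rw [monCoeff_eq_zero (zCoeff_zero hu) hd, mul_zero]
      · rw [tzDegree_eq_zero (d := d) (by omega), hG, zero_mul]
    · exact (charFun_mul_eq_iff (fun d => MvPowerSeries.coeff d (taylor F)) (coeffTX u) hG hb hk l).2
        (h k hk l)

end Recursion

/-! ### Unique solvability of the recursion -/

section Existence

/-- Recursive definitions along a well-founded relation have exactly one solution. -/
lemma existsUnique_of_wellFounded {ι X : Type*} [Nonempty X] {r : ι → ι → Prop}
    (hr : WellFounded r) (Φ : (ι → X) → ι → X)
    (h : ∀ i f g, (∀ j, r j i → f j = g j) → Φ f i = Φ g i) : ∃! f : ι → X, ∀ i, f i = Φ f i := by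
  classical
  inhabit X
  refine ⟨hr.fix fun i rec => Φ (fun j => if hj : r j i then rec j hj else default) i,
    fun i => ?_, fun f hf => ?_⟩
  · rw [hr.fix_eq]
    exact h _ _ _ fun j hj => by simp [hj]
  · funext i
    induction i using hr.induction with
    | h i ih =>
      rw [hf, hr.fix_eq]
      exact h _ _ _ fun j hj => by simp [hj, ih j hj]

variable {m : ℕ} {R : Type*} [Field R]

lemma linPart_congr {G : (Var m →₀ ℕ) → R} {U U' : ℕ → ℕ → R} {k l : ℕ}
    (h : ∀ l' < l, U k l' = U' k l') : linPart G U k l = linPart G U' k l := by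
  unfold linPart
  refine Finset.sum_congr rfl fun q _ => Finset.sum_congr rfl fun n hn => ?_
  rw [Finset.mem_range] at hn
  rw [h _ (by omega)]

lemma nonlin_congr {G : (Var m →₀ ℕ) → R} {Z Z' : Idx m → ℕ → ℕ → R} (hZ : ∀ q l, Z q 0 l = 0)
    (hZ' : ∀ q l, Z' q 0 l = 0) {k l : ℕ} (h : ∀ q, ∀ k' < k, ∀ l, Z q k' l = Z' q k' l) :
    nonlin G Z k l = nonlin G Z' k l := by
  unfold nonlin
  refine Finset.sum_congr rfl fun d hd => ?_
  rw [monCoeff_congr hZ hZ' (Finset.mem_filter.1 hd).2 h]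

/-- If `L(k, l)` does not vanish for `k ≥ 1`, the recursion formula has exactly one solution. -/
lemma existsUnique_isRecSol {G : (Var m →₀ ℕ) → R}
    (hN : ∀ k, 1 ≤ k → ∀ l, charFun G k l ≠ 0) : ∃! U : ℕ → ℕ → R, IsRecSol G U := by
  -- The value at k = 0 is forced to be 0: the nonlinear part depends on lower orders only for
  -- series without a term of order zero in t, and the fixed-point principle tests arbitrary `f`.
  let cut : (ℕ × ℕ → R) → ℕ → ℕ → R := fun f k l => if k = 0 then 0 else f (k, l)
  let Φ : (ℕ × ℕ → R) → ℕ × ℕ → R := fun f p => if p.1 = 0 then 0 else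
    ((if p.1 = 1 then aFun G p.2 else 0) + linPart G (cut f) p.1 p.2 +
      nonlin G (zCoeff (cut f)) p.1 p.2) / charFun G p.1 p.2
  have key : ∀ f : ℕ × ℕ → R, (∀ i, f i = Φ f i) ↔ IsRecSol G (fun k l => f (k, l)) := by
    intro f
    have hcut : (∀ l, f (0, l) = 0) → cut f = fun k l => f (k, l) := by
      intro h0
      funext k l
      simp only [cut]
      split_ifs with hk
      · rw [hk, h0]
      · rfl
    constructor
    · intro h
      have h0 : ∀ l, f (0, l) = 0 := fun l => by rw [h]; simp [Φ]
      refine ⟨h0, fun k hk l => ?_⟩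
      simp only
      rw [h (k, l), ← hcut h0]
      simp only [Φ]
      rw [if_neg (by omega), mul_div_cancel₀ _ (hN k hk l)]
    · rintro ⟨h0, h⟩ ⟨k, l⟩
      simp only [Φ]
      by_cases hk : k = 0
      · rw [if_pos hk, hk]; exact h0 l
      · rw [if_neg hk, eq_div_iff (hN k (by omega) l), mul_comm, hcut h0]
        exact h k (by omega) l
  obtain ⟨f, hf, huniq⟩ := existsUnique_of_wellFounded
    (WellFounded.prod_lex (α := ℕ) (β := ℕ) wellFounded_lt wellFounded_lt) Φ (by
      rintro ⟨k, l⟩ f g hfg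
      simp only [Φ]
      rcases Nat.eq_zero_or_pos k with rfl | hk
      · simp
      · have h0 : ∀ f : ℕ × ℕ → R, ∀ l, cut f 0 l = 0 := fun f l => by simp [cut]
        rw [linPart_congr (U := cut f) (U' := cut g), nonlin_congr (zCoeff_zero (h0 f))
          (zCoeff_zero (h0 g))]
        · intro q k' hk' l'
          simp only [zCoeff, cut]
          rw [hfg (k', _) (Prod.Lex.left _ _ hk')]
        · intro l' hl'
          simp only [cut]
          rw [hfg (k, l') (Prod.Lex.right _ hl')])
  refine ⟨fun k l => f (k, l), (key f).1 hf, fun U hU => ?_⟩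
  have := huniq (fun p => U p.1 p.2) ((key _).2 hU)
  funext k l
  exact congrFun this (k, l)

end Existence

end TotChar

end

noncomputable section

namespace TotChar

/-! ### Taylor coefficients: Cauchy estimates and vanishing on the x-axis -/

section Taylor

variable {m : ℕ}

/-- The multinomial coefficient is one summand in the expansion of (1 + ⋯ + 1)^n. -/
lemma factorial_sum_le {ι : Type*} [Fintype ι] [DecidableEq ι] (d : ι → ℕ) :
    (∑ v, d v)! ≤ (∏ v, (d v)!) * Fintype.card ι ^ ∑ v, d v := by
  rw [← Nat.multinomial_spec]
  gcongr
  have h := Finset.sum_pow_eq_sum_piAntidiag (R := ℕ) (Finset.univ : Finset ι) (fun _ => 1)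
    (∑ v, d v)
  simp only [Finset.sum_const, Finset.card_univ, smul_eq_mul, mul_one, one_pow,
    Finset.prod_const_one] at h
  rw [h]
  exact Finset.single_le_sum (f := fun k => (Nat.multinomial Finset.univ k : ℕ))
    (fun _ _ => Nat.zero_le _) (by simp)

lemma length_toList_toMultiset (d : Var m →₀ ℕ) :
    (Finsupp.toMultiset d).toList.length = ∑ v, d v := by
  rw [Multiset.length_toList, Finsupp.card_toMultiset, Finsupp.sum_fintype _ _ (by simp)]
  rfl

lemma coeff_taylor (F : (Var m → ℂ) → ℂ) (d : Var m →₀ ℕ) :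
    MvPowerSeries.coeff d (taylor F) = (∏ v, ((d v)! : ℂ))⁻¹ *
      iteratedFDeriv ℂ (Finsupp.toMultiset d).toList.length F 0
        (fun k => Pi.single ((Finsupp.toMultiset d).toList.get k) (1 : ℂ)) := rfl

/-- Cauchy estimates for the Taylor coefficients of a function that is analytic at the origin. -/
lemma exists_norm_coeff_taylor_le {F : (Var m → ℂ) → ℂ} (hF : AnalyticAt ℂ F 0) :
    ∃ C B : ℝ, 0 < C ∧ 1 ≤ B ∧
      ∀ d, ‖MvPowerSeries.coeff d (taylor F)‖ ≤ C * B ^ ∑ v, d v := by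
  obtain ⟨p, R, hp⟩ := hF
  obtain ⟨r, hr0, hr⟩ := ENNReal.lt_iff_exists_nnreal_btwn.1 (hp.r_pos.trans_le hp.r_le)
  rw [ENNReal.coe_pos] at hr0
  obtain ⟨C, hC, hpC⟩ := p.norm_le_div_pow_of_pos_of_lt_radius hr0 hr
  set N : ℝ := (Fintype.card (Var m) : ℝ) with hN
  refine ⟨C, max 1 (N / r), hC, le_max_left _ _, fun d => ?_⟩
  rw [coeff_taylor, hp.iteratedFDeriv_eq_sum_of_completeSpace]
  set L := (Finsupp.toMultiset d).toList with hL
  have hlen : L.length = ∑ v, d v := length_toList_toMultiset d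
  set n := ∑ v, d v with hn
  -- The derivative sums the multilinear coefficient over all n! orderings of its arguments; `hfac`
  -- below trades this n! for the product of the (d v)! and a geometric factor.
  have hsum : ‖∑ τ : Equiv.Perm (Fin L.length),
      p L.length (fun i => Pi.single (L.get (τ i)) (1 : ℂ))‖ ≤ (n ! : ℝ) * (C / r ^ n) := by
    refine (norm_sum_le_of_le _ (n := fun _ => C / (r : ℝ) ^ n) fun τ _ => ?_).trans ?_
    · refine ((p L.length).le_opNorm _).trans ?_
      rw [Finset.prod_eq_one (fun i _ => by rw [Pi.norm_single, norm_one]), mul_one, ← hlen]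
      exact hpC _
    · rw [Finset.sum_const, Finset.card_univ, Fintype.card_perm, Fintype.card_fin, hlen,
        nsmul_eq_mul]
  have hprod : (0 : ℝ) < ∏ v, ((d v)! : ℝ) := Finset.prod_pos fun v _ => by positivity
  have hfac : (n ! : ℝ) ≤ (∏ v, ((d v)! : ℝ)) * N ^ n := by
    have := factorial_sum_le (fun v => d v)
    rw [hN]
    exact_mod_cast this
  rw [norm_mul, norm_inv, norm_prod]
  simp only [Complex.norm_natCast]
  have hr0' : (0 : ℝ) < r := by exact_mod_cast hr0
  calc (∏ v, ((d v)! : ℝ))⁻¹ * _ ≤ (∏ v, ((d v)! : ℝ))⁻¹ * ((n ! : ℝ) * (C / r ^ n)) := by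
        gcongr
    _ ≤ (∏ v, ((d v)! : ℝ))⁻¹ * (((∏ v, ((d v)! : ℝ)) * N ^ n) * (C / r ^ n)) := by gcongr
    _ = C * (N / r) ^ n := by rw [div_pow]; field_simp
    _ ≤ C * max 1 (N / r) ^ n := by
        gcongr
        exact le_max_right _ _

/-- The Taylor coefficients along the `x`-axis of a function that vanishes there. -/
lemma coeff_taylor_expo_eq_zero {F : (Var m → ℂ) → ℂ} (hF : AnalyticAt ℂ F 0)
    (h0 : ∀ᶠ x : ℂ in 𝓝 0, F (x • Pi.single Var.x 1) = 0) (h : ℕ) :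
    MvPowerSeries.coeff (expo 0 h 0) (taylor F) = 0 := by
  obtain ⟨p, R, hp⟩ := hF
  rw [coeff_taylor, hp.iteratedFDeriv_eq_sum_of_completeSpace]
  have hx : ∀ v ∈ (Finsupp.toMultiset (expo (m := m) 0 h 0)).toList, v = Var.x := by
    intro v hv
    have : expo (m := m) 0 h 0 = Finsupp.single Var.x h := by
      simp [expo]
    rw [Multiset.mem_toList, this, Finsupp.toMultiset_single] at hv
    exact Multiset.mem_singleton.1 (Multiset.mem_of_mem_nsmul hv)
  -- Along the x-axis the function vanishes near 0, so the power series of its restriction is zero.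
  set g : ℂ →L[ℂ] (Var m → ℂ) := ContinuousLinearMap.toSpanSingleton ℂ (Pi.single Var.x 1) with hg
  have h1 : HasFPowerSeriesAt (F ∘ g) (p.compContinuousLinearMap g) 0 := by
    have : HasFPowerSeriesAt F p (g 0) := by rw [map_zero]; exact hp.hasFPowerSeriesAt
    exact this.compContinuousLinearMap
  have h2 : ∀ n, p n (fun _ => Pi.single Var.x 1) = 0 := by
    intro n
    have h3 : HasFPowerSeriesAt 0 (p.compContinuousLinearMap g) 0 := by
      refine h1.congr ?_
      filter_upwards [h0] with x hx
      simpa [hg] using hx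
    have := h3.apply_eq_zero n 1
    rw [FormalMultilinearSeries.compContinuousLinearMap_apply] at this
    simpa [hg, Function.comp_def] using this
  rw [Finset.sum_eq_zero, mul_zero]
  intro τ _
  rw [← h2]
  congr 1
  funext i
  rw [hx _ (List.get_mem _ _)]

end Taylor

/-! ### Signs of the Taylor coefficients -/

section RealData

variable {m : ℕ}

/-- Real Taylor coefficients with the positivity properties c1)-c4). -/
structure PosData (G : (Var m →₀ ℕ) → ℝ) : Prop where
  zero : ∀ h, G (expo 0 h 0) = 0
  bzero : ∀ q : Idx m, ∀ h < q.1.2, G (expo 0 h (Finsupp.single q 1)) = 0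
  a_nonneg : ∀ l, 0 ≤ aFun G l
  a_pos : ∀ l ≤ m, 0 < aFun G l
  c_nonpos : ∀ q, cFun G q 0 ≤ 0
  c_nonneg : ∀ q h, 0 ≤ cFun G q (h + 1)
  nonneg : ∀ d, 2 ≤ tzDegree d → 0 ≤ G d
  bound : ∃ C B : ℝ, 0 < C ∧ 1 ≤ B ∧ ∀ d, |G d| ≤ C * B ^ ∑ v, d v

/-- The real parts of the Taylor coefficients. -/
def reTaylor (F : (Var m → ℂ) → ℂ) (d : Var m →₀ ℕ) : ℝ := (MvPowerSeries.coeff d (taylor F)).re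

lemma coeff_cCoeff (F : (Var m → ℂ) → ℂ) (q : Idx m) (h : ℕ) : PowerSeries.coeff h (cCoeff F q) =
    MvPowerSeries.coeff (expo 0 (h + q.1.2) (Finsupp.single q 1)) (taylor F) := by
  simp [cCoeff, bCoeff, tzCoeff]

lemma eq_re_of_nonneg {z : ℂ} (hz : 0 ≤ z) : z = (z.re : ℂ) := by
  rw [Complex.le_def] at hz
  apply Complex.ext <;> simp [← hz.2]

variable {F : (Var m → ℂ) → ℂ} {r : Var m → ℝ}

/-- Every coefficient of F has a prescribed sign: zero by A2 and A3, nonpositive for c_q(0),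
nonnegative otherwise. In particular all are real, and the recursion can be studied over ℝ. -/
lemma posData_reTaylor (hr : ∀ v, 0 < r v)
    (hA1 : AnalyticOnNhd ℂ F (polydisk r))
    (hA2 : ∀ p ∈ polydisk r, p Var.t = 0 → (∀ q, p (Var.z q) = 0) → F p = 0)
    (hA3 : ∀ q : Idx m, 0 < q.1.2 → PowerSeries.X ^ q.1.2 ∣ bCoeff F q)
    (hc1 : (∀ μ ≤ m, 0 < (μ ! : ℂ) * PowerSeries.coeff μ (aCoeff F)) ∧ MajZero (aCoeff F))
    (hc2 : ∀ q : Idx m, PowerSeries.constantCoeff (cCoeff F q) ≤ 0)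
    (hc3 : ∀ q : Idx m, MajZero
      (cCoeff F q - PowerSeries.C (PowerSeries.constantCoeff (cCoeff F q))))
    (hc4 : ∀ (i : ℕ) (ν : Idx m →₀ ℕ), 2 ≤ i + ∑ q, ν q → MajZero (tzCoeff F i ν)) :
    PosData (reTaylor F) ∧ ∀ d, MvPowerSeries.coeff d (taylor F) = (reTaylor F d : ℂ) := by
  have hF : AnalyticAt ℂ F 0 := hA1 0 fun v => by simpa using hr v
  have hzero : ∀ h, MvPowerSeries.coeff (expo 0 h 0) (taylor F) = 0 := by
    refine coeff_taylor_expo_eq_zero hF ?_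
    filter_upwards [Metric.ball_mem_nhds (0 : ℂ) (hr Var.x)] with x hx
    rw [mem_ball_zero_iff] at hx
    refine hA2 _ (fun v => ?_) (by simp) (by simp)
    by_cases hv : v = Var.x
    · subst hv; simpa using hx
    · simpa [Pi.single_eq_of_ne hv] using hr v
  have hbzero : ∀ q : Idx m, ∀ h < q.1.2,
      MvPowerSeries.coeff (expo 0 h (Finsupp.single q 1)) (taylor F) = 0 := by
    intro q h hh
    have := PowerSeries.X_pow_dvd_iff.1 (hA3 q (by omega)) h hh
    simpa [bCoeff, tzCoeff] using this
  have ha : ∀ l, 0 ≤ MvPowerSeries.coeff (expo 1 l 0) (taylor F) := fun l => by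
    simpa [aCoeff, tzCoeff] using hc1.2 l
  have hc0 : ∀ q : Idx m,
      MvPowerSeries.coeff (expo 0 (0 + q.1.2) (Finsupp.single q 1)) (taylor F) ≤ 0 := fun q => by
    rw [← coeff_cCoeff]; simpa using hc2 q
  have hcp : ∀ (q : Idx m) (h : ℕ),
      0 ≤ MvPowerSeries.coeff (expo 0 (h + 1 + q.1.2) (Finsupp.single q 1)) (taylor F) :=
    fun q h => by
      rw [← coeff_cCoeff]; simpa [PowerSeries.coeff_C] using hc3 q (h + 1)
  have hnn : ∀ d : Var m →₀ ℕ, 2 ≤ tzDegree d → 0 ≤ MvPowerSeries.coeff d (taylor F) := by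
    intro d hd
    rw [← expo_eta d]
    have := hc4 (d Var.t) (Finsupp.equivFunOnFinite.symm fun q => d (Var.z q))
      (by simpa [tzDegree] using hd) (d Var.x)
    simpa [tzCoeff] using this
  refine ⟨?_, fun d => ?_⟩
  · refine ⟨fun h => by simp [reTaylor, hzero], fun q h hh => by simp [reTaylor, hbzero q h hh],
      fun l => (Complex.le_def.1 (ha l)).1, fun l hl => ?_, fun q => (Complex.le_def.1 (hc0 q)).1,
      fun q h => (Complex.le_def.1 (hcp q h)).1, fun d hd => (Complex.le_def.1 (hnn d hd)).1, ?_⟩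
    · have h1 := hc1.1 l hl
      have h2 : PowerSeries.coeff l (aCoeff F) = MvPowerSeries.coeff (expo 1 l 0) (taylor F) := by
        simp [aCoeff, tzCoeff]
      rw [h2] at h1
      have h3 : (0 : ℂ) < MvPowerSeries.coeff (expo 1 l 0) (taylor F) := by
        refine lt_of_le_of_ne (ha l) fun h => ?_
        rw [← h, mul_zero] at h1
        exact lt_irrefl _ h1
      exact (Complex.lt_def.1 h3).1
    · obtain ⟨C, B, hC, hB, h⟩ := exists_norm_coeff_taylor_le hF
      exact ⟨C, B, hC, hB, fun d => (Complex.abs_re_le_norm _).trans (h d)⟩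
  · unfold reTaylor
    rcases Nat.lt_or_ge (tzDegree d) 2 with hd | hd
    · have : tzDegree d = 0 ∨ tzDegree d = 1 := by omega
      rcases this with hd | hd
      · rw [tzDegree_eq_zero hd, hzero]; simp
      · rcases tzDegree_eq_one hd with h | ⟨q, h⟩
        · rw [h]; exact eq_re_of_nonneg (ha _)
        · rw [h]
          rcases Nat.lt_or_ge (d Var.x) q.1.2 with hx | hx
          · rw [hbzero q _ hx]; simp
          · obtain ⟨n, hn⟩ := Nat.exists_eq_add_of_le' hx
            rw [hn]
            rcases n with _ | n
            -- This coefficient is c_q(0), the nonpositive one, so the criterion is applied to its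
            -- negative.
            · have := eq_re_of_nonneg (neg_nonneg.2 (hc0 q))
              rw [Complex.neg_re, Complex.ofReal_neg, neg_inj] at this
              exact this
            · exact eq_re_of_nonneg (hcp q n)
    · exact eq_re_of_nonneg (hnn d hd)

end RealData

end TotChar

end

noncomputable section

namespace TotChar

variable {m : ℕ}

lemma idx_fst_lt (q : Idx m) : q.1.1 < m := by
  have := q.2
  simp only [Idx, Finset.mem_filter, Finset.mem_product, Finset.mem_range] at this
  omega

lemma idx_add_le (q : Idx m) : q.1.1 + q.1.2 ≤ m := by
  have := q.2
  simp only [Idx, Finset.mem_filter, Finset.mem_product, Finset.mem_range] at this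
  omega

lemma idx_snd_le (q : Idx m) : q.1.2 ≤ m := le_trans (Nat.le_add_left _ _) (idx_add_le q)

/-! ### Lower bounds for L(k, l) -/

section CharFun

variable {G : (Var m →₀ ℕ) → ℝ}

lemma charFun_eq (k l : ℕ) : charFun G k l =
    (k : ℝ) ^ m + ∑ q : Idx m, -cFun G q 0 * (k : ℝ) ^ q.1.1 * (l.descFactorial q.1.2 : ℝ) := by
  simp [charFun, sub_eq_add_neg]

lemma pow_le_charFun (hG : PosData G) (k l : ℕ) : (k : ℝ) ^ m ≤ charFun G k l := by
  rw [charFun_eq, le_add_iff_nonneg_right]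
  refine Finset.sum_nonneg fun q _ => ?_
  have := neg_nonneg.2 (hG.c_nonpos q)
  positivity

lemma charFun_pos (hG : PosData G) {k : ℕ} (hk : 1 ≤ k) (l : ℕ) : 0 < charFun G k l :=
  lt_of_lt_of_le (by positivity) (pow_le_charFun hG k l)

lemma term_le_charFun (hG : PosData G) (k l : ℕ) (q : Idx m) :
    -cFun G q 0 * (k : ℝ) ^ q.1.1 * (l.descFactorial q.1.2 : ℝ) ≤ charFun G k l := by
  rw [charFun_eq]
  have h : ∀ q : Idx m, 0 ≤ -cFun G q 0 * (k : ℝ) ^ q.1.1 * (l.descFactorial q.1.2 : ℝ) := by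
    intro q
    have := neg_nonneg.2 (hG.c_nonpos q)
    positivity
  have h2 := Finset.single_le_sum (fun q _ => h q) (Finset.mem_univ q)
  have : (0 : ℝ) ≤ (k : ℝ) ^ m := by positivity
  linarith

/-- For l ≥ m the smallest factor l + 1 - α of the falling factorial is still at least l / m. -/
lemma pow_le_mul_descFactorial {l α : ℕ} (hα : α ≤ m) (hl : m ≤ l) :
    (l : ℝ) ^ α ≤ (m : ℝ) ^ m * (l.descFactorial α : ℝ) := by
  rcases Nat.eq_zero_or_pos m with rfl | hm
  · obtain rfl : α = 0 := by omega
    simp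
  have h1 : (l : ℝ) ≤ m * ((l + 1 - α : ℕ) : ℝ) := by
    rw [Nat.cast_sub (by omega)]
    push_cast
    have h1 : (1 : ℝ) ≤ m := by exact_mod_cast hm
    have h2 : (m : ℝ) ≤ l := by exact_mod_cast hl
    have h3 : (α : ℝ) ≤ m := by exact_mod_cast hα
    nlinarith
  calc (l : ℝ) ^ α ≤ (m * ((l + 1 - α : ℕ) : ℝ)) ^ α := by gcongr
    _ = (m : ℝ) ^ α * ((l + 1 - α : ℕ) : ℝ) ^ α := mul_pow _ _ _
    _ ≤ (m : ℝ) ^ m * (l.descFactorial α : ℝ) := by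
      gcongr
      · exact_mod_cast hm
      · exact_mod_cast Nat.pow_sub_le_descFactorial l α

/-- All summands of L(k, l) are nonnegative, so each is at most L(k, l); the constant `S` accounts
for dividing by -c_q(0). Falling factorials may vanish for l < m, but there l^α ≤ m^m and k^m alone
suffices. -/
lemma exists_pow_le_charFun (hG : PosData G) : ∃ C : ℝ, 1 ≤ C ∧ ∀ k l : ℕ, 1 ≤ k →
    (k : ℝ) ^ m ≤ C * charFun G k l ∧ ∀ q : Idx m, cFun G q 0 ≠ 0 →
      (k : ℝ) ^ q.1.1 * (l : ℝ) ^ q.1.2 ≤ C * charFun G k l := by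
  obtain ⟨S, hS⟩ : ∃ S : ℝ, S = ∑ q : Idx m, (-cFun G q 0)⁻¹ := ⟨_, rfl⟩
  have hS0 : ∀ q : Idx m, 0 ≤ (-cFun G q 0)⁻¹ := fun q =>
    inv_nonneg.2 (neg_nonneg.2 (hG.c_nonpos q))
  have hSn : 0 ≤ S := hS ▸ Finset.sum_nonneg fun q _ => hS0 q
  have hM : (0 : ℝ) ≤ (m : ℝ) ^ m := by positivity
  refine ⟨1 + (m : ℝ) ^ m * (1 + S), by nlinarith, fun k l hk => ?_⟩
  have hL := pow_le_charFun hG k l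
  have hLp := charFun_pos hG hk l
  refine ⟨?_, fun q hq => ?_⟩
  · nlinarith [mul_nonneg (mul_nonneg hM (by linarith : (0 : ℝ) ≤ 1 + S)) hLp.le]
  · have hk1 : (1 : ℝ) ≤ k := by exact_mod_cast hk
    have hm' : (k : ℝ) ^ q.1.1 ≤ (k : ℝ) ^ m := pow_le_pow_right₀ hk1 (idx_fst_lt q).le
    have hcq : 0 < -cFun G q 0 := neg_pos.2 (lt_of_le_of_ne (hG.c_nonpos q) hq)
    have hmain : (k : ℝ) ^ q.1.1 * (l : ℝ) ^ q.1.2 ≤ (m : ℝ) ^ m * ((1 + S) * charFun G k l) := by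
      rcases Nat.lt_or_ge l m with hl | hl
      · have hl1 : (l : ℝ) ^ q.1.2 ≤ (m : ℝ) ^ m := by
          calc (l : ℝ) ^ q.1.2 ≤ (m : ℝ) ^ q.1.2 := by gcongr
            _ ≤ (m : ℝ) ^ m := pow_le_pow_right₀ (by exact_mod_cast (by omega)) (idx_snd_le q)
        calc _ ≤ charFun G k l * (m : ℝ) ^ m :=
              mul_le_mul (hm'.trans hL) hl1 (by positivity) hLp.le
          _ ≤ _ := by
            have := mul_nonneg hM (mul_nonneg hSn hLp.le)
            linarith
      · calc (k : ℝ) ^ q.1.1 * (l : ℝ) ^ q.1.2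
            ≤ (k : ℝ) ^ q.1.1 * ((m : ℝ) ^ m * (l.descFactorial q.1.2 : ℝ)) := by
              gcongr; exact pow_le_mul_descFactorial (idx_snd_le q) hl
          _ = (m : ℝ) ^ m * ((-cFun G q 0)⁻¹ *
              (-cFun G q 0 * (k : ℝ) ^ q.1.1 * (l.descFactorial q.1.2 : ℝ))) := by
              field_simp
          _ ≤ (m : ℝ) ^ m * ((1 + S) * charFun G k l) := by
              gcongr
              · have := Finset.single_le_sum (fun q _ => hS0 q) (Finset.mem_univ q)
                rw [← hS] at this
                linarith
              · exact term_le_charFun hG k l q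
    linarith

end CharFun

/-! ### Linear functionals on the Newton polygon -/

section Newton

variable {F : (Var m → ℂ) → ℂ}

/-- A functional with nonnegative coefficients is largest at the corner of each quadrant, and
half-planes are convex. -/
lemma newtonPolygon_le {a b c : ℝ} (ha : 0 ≤ a) (hb : 0 ≤ b)
    (h : ∀ p ∈ Lam0 F, a * p.1 + b * p.2 ≤ c) {w : ℝ × ℝ} (hw : w ∈ newtonPolygon F) :
    a * w.1 + b * w.2 ≤ c := by
  have hconv : Convex ℝ {w : ℝ × ℝ | a * w.1 + b * w.2 ≤ c} := by
    refine convex_halfSpace_le (f := fun w : ℝ × ℝ => a * w.1 + b * w.2) ?_ c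
    exact ⟨fun x y => by simp; ring, fun t x => by simp; ring⟩
  refine convexHull_min ?_ hconv hw
  refine Set.iUnion₂_subset fun p hp w hw => ?_
  have := h p hp
  have h1 := mul_le_mul_of_nonneg_left hw.1 ha
  have h2 := mul_le_mul_of_nonneg_left hw.2 hb
  simp only [Set.mem_ofPred_eq]
  linarith

lemma mem_newtonPolygon_of_le {p : ℕ × ℕ} (hp : p ∈ Lam0 F) {w : ℝ × ℝ} (h1 : w.1 ≤ p.1)
    (h2 : w.2 ≤ p.2) : w ∈ newtonPolygon F :=
  subset_convexHull ℝ _ (Set.mem_iUnion₂.2 ⟨p, hp, h1, h2⟩)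

lemma Lam0_snd_le {p : ℕ × ℕ} (hp : p ∈ Lam0 F) : p.2 ≤ m := by
  rcases hp with hp | ⟨q, -, hp⟩
  · rw [Set.mem_singleton_iff.1 hp]; exact Nat.zero_le _
  · rw [hp]; exact (idx_snd_le q)

lemma nonempty_vertDist (q : Idx m) :
    {y : ℝ | ((q.1.1 : ℝ), (q.1.2 : ℝ) - y) ∈ newtonPolygon F}.Nonempty := by
  refine ⟨q.1.2, mem_newtonPolygon_of_le (p := (m, 0)) (Or.inl rfl) ?_ (by simp)⟩
  exact Nat.cast_le.2 (idx_fst_lt q).le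

lemma bddBelow_vertDist (q : Idx m) :
    BddBelow {y : ℝ | ((q.1.1 : ℝ), (q.1.2 : ℝ) - y) ∈ newtonPolygon F} := by
  refine ⟨q.1.2 - m, fun y hy => ?_⟩
  have := newtonPolygon_le (a := 0) (b := 1) (c := m) le_rfl zero_le_one (fun p hp => by
    have : (p.2 : ℝ) ≤ m := by exact_mod_cast Lam0_snd_le hp
    linarith) hy
  simp only [zero_mul, one_mul, zero_add] at this
  linarith

/-- A linear functional that is bounded on `Λ₀` is bounded at the point `(j, α - d)`. -/
lemma add_mul_sub_vertDist_le {a b c : ℝ} (ha : 0 ≤ a) (hb : 0 < b)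
    (h : ∀ p ∈ Lam0 F, a * p.1 + b * p.2 ≤ c) (q : Idx m) :
    a * q.1.1 + b * (q.1.2 - vertDist F q) ≤ c := by
  have : (a * q.1.1 + b * q.1.2 - c) / b ≤ vertDist F q := by
    refine le_csInf (nonempty_vertDist q) fun y hy => ?_
    have := newtonPolygon_le ha hb.le h hy
    rw [div_le_iff₀ hb]
    simp only at this
    linarith
  rw [div_le_iff₀ hb] at this
  linarith

/-- Below `(j, α - y)` with `y < d` there is a supporting line of the Newton polygon. -/
lemma exists_slope {q : Idx m} {y : ℝ} (hy0 : 0 < y) (hy : y < vertDist F q) :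
    ∃ w : ℝ, 0 ≤ w ∧ w < 1 ∧ ∀ p ∈ Lam0 F, w * p.1 + p.2 ≤ w * q.1.1 + q.1.2 - y := by
  have hnot : ((q.1.1 : ℝ), (q.1.2 : ℝ) - y) ∉ newtonPolygon F := fun h =>
    notMem_of_lt_csInf hy (bddBelow_vertDist q) h
  -- Separating from the interior makes closedness of the hull unnecessary; the points of Λ₀ are
  -- recovered as limits of interior points in `hle`.
  obtain ⟨f, hf⟩ := geometric_hahn_banach_open_point
    ((convex_convexHull ℝ _).interior : Convex ℝ (interior (newtonPolygon F))) isOpen_interior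
    (fun h => hnot (interior_subset h))
  set f1 := f (1, 0) with hf1
  set f2 := f (0, 1) with hf2
  have hfw : ∀ X Y : ℝ, f (X, Y) = X * f1 + Y * f2 := by
    intro X Y
    have : ((X, Y) : ℝ × ℝ) = X • (1, 0) + Y • (0, 1) := by simp
    rw [this, map_add, map_smul, map_smul]; simp [hf1, hf2]
  set K := (q.1.1 : ℝ) * f1 + ((q.1.2 : ℝ) - y) * f2 with hK
  have hlt : ∀ p ∈ Lam0 F, ∀ T T' : ℝ, 0 < T → 0 < T' →
      ((p.1 : ℝ) - T) * f1 + ((p.2 : ℝ) - T') * f2 < K := by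
    intro p hp T T' hT hT'
    have hmem : (((p.1 : ℝ) - T), ((p.2 : ℝ) - T')) ∈ interior (newtonPolygon F) := by
      refine mem_interior.2 ⟨Set.Iio (p.1 : ℝ) ×ˢ Set.Iio (p.2 : ℝ), fun w hw => ?_,
        isOpen_Iio.prod isOpen_Iio, by simp [hT, hT']⟩
      exact mem_newtonPolygon_of_le hp (le_of_lt hw.1) (le_of_lt hw.2)
    have := hf _ hmem
    rwa [hfw, hfw] at this
  have hm0 : ((m, 0) : ℕ × ℕ) ∈ Lam0 F := Or.inl rfl
  -- The polygon is unbounded to the left and downwards, so a negative coefficient would make the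
  -- functional unbounded above on it.
  have h1 : 0 ≤ f1 := by
    by_contra! hneg
    have := hlt _ hm0 ((|K - ((m : ℝ) * f1 + (0 - 1) * f2)| + 1) / (-f1)) 1
      (div_pos (by positivity) (neg_pos.2 hneg)) one_pos
    have h2 : (|K - ((m : ℝ) * f1 + (0 - 1) * f2)| + 1) / (-f1) * f1 =
        -(|K - ((m : ℝ) * f1 + (0 - 1) * f2)| + 1) := by
      rw [div_neg, neg_mul, div_mul_cancel₀ _ hneg.ne]
    rw [sub_mul, h2] at this
    have h3 := le_abs_self (K - ((m : ℝ) * f1 + (0 - 1) * f2))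
    push_cast at this
    linarith
  have h2 : 0 ≤ f2 := by
    by_contra! hneg
    have := hlt _ hm0 1 ((|K - (((m : ℝ) - 1) * f1)| + 1) / (-f2)) one_pos
      (div_pos (by positivity) (neg_pos.2 hneg))
    have h2 : (|K - (((m : ℝ) - 1) * f1)| + 1) / (-f2) * f2 =
        -(|K - (((m : ℝ) - 1) * f1)| + 1) := by
      rw [div_neg, neg_mul, div_mul_cancel₀ _ hneg.ne]
    rw [sub_mul _ _ f2, h2] at this
    have h3 := le_abs_self (K - (((m : ℝ) - 1) * f1))
    push_cast at this
    linarith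
  have hle : ∀ p ∈ Lam0 F, (p.1 : ℝ) * f1 + (p.2 : ℝ) * f2 ≤ K := by
    intro p hp
    by_contra! hgt
    set g := (p.1 : ℝ) * f1 + (p.2 : ℝ) * f2 - K with hg
    have hg0 : 0 < g := by linarith
    have hpos : 0 < f1 + f2 + 1 := by linarith
    have := hlt p hp (g / (f1 + f2 + 1)) (g / (f1 + f2 + 1)) (by positivity) (by positivity)
    have h3 : g / (f1 + f2 + 1) * (f1 + f2 + 1) = g := div_mul_cancel₀ _ hpos.ne'
    have h4 : 0 < g / (f1 + f2 + 1) := by positivity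
    nlinarith
  have hjm : (q.1.1 : ℝ) < m := by exact_mod_cast idx_fst_lt q
  -- Since j < m, the point lies strictly to the left of the corner (m, 0), so the separating line
  -- is not vertical.
  have hf2pos : 0 < f2 := by
    refine lt_of_le_of_ne h2 fun h0 => ?_
    have hA := hlt _ hm0 (m - q.1.1) 1 (by linarith) one_pos
    have hB := hle _ hm0
    rw [← h0] at hA hB
    rw [hK, ← h0] at hA hB
    simp only [mul_zero, add_zero] at hA hB
    nlinarith
  have hmain : ∀ p ∈ Lam0 F, f1 / f2 * p.1 + p.2 ≤ f1 / f2 * q.1.1 + q.1.2 - y := by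
    intro p hp
    have := hle p hp
    rw [hK] at this
    have e1 : f1 / f2 * p.1 + p.2 = ((p.1 : ℝ) * f1 + (p.2 : ℝ) * f2) / f2 := by field_simp
    have e2 : f1 / f2 * q.1.1 + q.1.2 - y = ((q.1.1 : ℝ) * f1 + ((q.1.2 : ℝ) - y) * f2) / f2 := by
      field_simp; ring
    rw [e1, e2]
    gcongr
  refine ⟨f1 / f2, by positivity, ?_, hmain⟩
  -- At (m, 0) the bound reads w (m - j) ≤ α - y < α ≤ m - j, which forces w < 1.
  have := hmain _ hm0
  have hα : (q.1.1 : ℝ) + q.1.2 ≤ m := by exact_mod_cast (idx_add_le q)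
  push_cast at this
  by_contra! hge
  nlinarith

end Newton

end TotChar

end

noncomputable section

namespace TotChar

variable {m : ℕ} {F : (Var m → ℂ) → ℂ}

/-! ### What σ₀ says about a single linear term -/

section Irregularity

lemma finite_irregularity (F : (Var m → ℂ) → ℂ) :
    (insert 1 {r : ℝ | ∃ q ∈ Lam1 F, r = (zeroOrder F q + vertDist F q) / zeroOrder F q}).Finite := by
  refine Set.Finite.insert _ (Set.Finite.subset
    (Set.finite_range fun q => (zeroOrder F q + vertDist F q) / zeroOrder F q) ?_)
  rintro r ⟨q, -, rfl⟩
  exact ⟨q, rfl⟩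

lemma one_le_irregularity (F : (Var m → ℂ) → ℂ) : 1 ≤ irregularity F :=
  le_csSup (finite_irregularity F).bddAbove (Set.mem_insert _ _)

lemma coeff_zeroOrder_ne_zero {q : Idx m} (hq : q ∈ Lam1 F) :
    PowerSeries.coeff (zeroOrder F q) (cCoeff F q) ≠ 0 :=
  PowerSeries.coeff_order hq.2

lemma zeroOrder_pos {q : Idx m} (hq : q ∈ Lam1 F) : 1 ≤ zeroOrder F q := by
  by_contra! h
  have h1 := coeff_zeroOrder_ne_zero hq
  rw [Nat.lt_one_iff.1 h] at h1
  exact h1 (by simpa using hq.1)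

lemma zeroOrder_le {q : Idx m} {h : ℕ} (hh : PowerSeries.coeff h (cCoeff F q) ≠ 0) :
    zeroOrder F q ≤ h :=
  ENat.toNat_le_of_le_natCast (PowerSeries.order_le h hh)

/-- The definition of σ₀ read at one index: each of the p powers of x that are gained pays for
l^(σ₀-1), and together they cover the vertical distance d. -/
lemma vertDist_le {q : Idx m} (hq : q ∈ Lam1 F) :
    vertDist F q ≤ zeroOrder F q * (irregularity F - 1) := by
  have h : (zeroOrder F q + vertDist F q) / zeroOrder F q ≤ irregularity F :=
    le_csSup (finite_irregularity F).bddAbove (Set.mem_insert_of_mem _ ⟨q, hq, rfl⟩)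
  have hp : (0 : ℝ) < zeroOrder F q := by exact_mod_cast zeroOrder_pos hq
  rw [div_le_iff₀ hp] at h
  linarith

lemma exists_of_lt_irregularity {σ : ℝ} (hσ : 1 ≤ σ) (h : σ < irregularity F) :
    ∃ q ∈ Lam1 F, zeroOrder F q * (σ - 1) < vertDist F q := by
  obtain ⟨r, hr, hlt⟩ := exists_lt_of_lt_csSup (Set.insert_nonempty _ _) h
  rcases hr with rfl | ⟨q, hq, rfl⟩
  · linarith
  · refine ⟨q, hq, ?_⟩
    have hp : (0 : ℝ) < zeroOrder F q := by exact_mod_cast zeroOrder_pos hq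
    rw [lt_div_iff₀ hp] at hlt
    linarith

end Irregularity

/-! ### What s₀ says about a single monomial of R₂ -/

section GevreyIndex

lemma finite_gevreyIndex (F : (Var m → ℂ) → ℂ) :
    (insert 0 {r : ℝ | ∃ μ < m, ∃ q : Idx m,
      r = divENat ((q.1.1 : ℝ) + μ + irregularity F * ((q.1.2 : ℝ) - μ) - m) (Lval F μ q)}).Finite := by
  refine Set.Finite.insert _ (Set.Finite.subset
    (Set.finite_range fun p : Fin m × Idx m => divENat ((p.2.1.1 : ℝ) + (p.1 : ℕ) +
      irregularity F * ((p.2.1.2 : ℝ) - (p.1 : ℕ)) - m) (Lval F p.1 p.2)) ?_)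
  rintro r ⟨μ, hμ, q, rfl⟩
  exact ⟨(⟨μ, hμ⟩, q), rfl⟩

lemma one_le_gevreyIndex (F : (Var m → ℂ) → ℂ) : 1 ≤ gevreyIndex F := by
  have := le_csSup (finite_gevreyIndex F).bddAbove (Set.mem_insert _ _)
  unfold gevreyIndex
  linarith

lemma coeff_iterate_pderiv_x (f : MvPowerSeries (Var m) ℂ) (μ : ℕ) (d : Var m →₀ ℕ) :
    MvPowerSeries.coeff d ((fun f => MvPowerSeries.pderiv ℂ (Var.x : Var m) f)^[μ] f) =
      ((d Var.x + μ).descFactorial μ : ℂ) * MvPowerSeries.coeff (d + Finsupp.single Var.x μ) f := by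
  induction μ generalizing d with
  | zero => simp
  | succ μ ih =>
    rw [Function.iterate_succ_apply', MvPowerSeries.coeff_pderiv, ih]
    have h1 : d + Finsupp.single Var.x 1 + Finsupp.single Var.x μ =
        d + Finsupp.single Var.x (μ + 1) := by
      rw [add_assoc, ← Finsupp.single_add, add_comm 1 μ]
    have h2 : (d + Finsupp.single Var.x 1 : Var m →₀ ℕ) Var.x = d Var.x + 1 := by simp
    rw [h1, h2, show d Var.x + 1 + μ = d Var.x + (μ + 1) by ring, Nat.descFactorial_succ,
      show d Var.x + (μ + 1) - μ = d Var.x + 1 by omega]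
    push_cast
    ring

lemma coeff_R2 (d : Var m →₀ ℕ) : MvPowerSeries.coeff d (R2 F) =
    if 2 ≤ tzDegree d then MvPowerSeries.coeff d (taylor F) else 0 := rfl

lemma coeff_pderiv_R2_ne_zero_iff (μ : ℕ) (q : Idx m) (d : Var m →₀ ℕ) :
    MvPowerSeries.coeff d (MvPowerSeries.pderiv ℂ (Var.z q)
      ((fun f => MvPowerSeries.pderiv ℂ (Var.x : Var m) f)^[μ] (R2 F))) ≠ 0 ↔
    MvPowerSeries.coeff (d + Finsupp.single (Var.z q) 1 + Finsupp.single Var.x μ) (R2 F) ≠ 0 := by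
  rw [MvPowerSeries.coeff_pderiv, coeff_iterate_pderiv_x]
  have h1 : ((d (Var.z q) : ℂ) + 1) ≠ 0 := Nat.cast_add_one_ne_zero _
  have h2 : ((((d + Finsupp.single (Var.z q) 1 : Var m →₀ ℕ) Var.x + μ).descFactorial μ : ℕ) : ℂ) ≠
      0 := by
    rw [Nat.cast_ne_zero, Ne, Nat.descFactorial_eq_zero_iff_lt]
    omega
  simp only [ne_eq, mul_eq_zero, h1, h2, or_false, false_or]

lemma tzDegree_add (d e : Var m →₀ ℕ) : tzDegree (d + e) = tzDegree d + tzDegree e := by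
  simp only [tzDegree, Finsupp.coe_add, Pi.add_apply, Finset.sum_add_distrib]
  ring

lemma tzDegree_single_z (q : Idx m) : tzDegree (Finsupp.single (Var.z q) 1) = 1 := by
  simp [tzDegree, Finsupp.single_apply]

lemma tzDegree_single_x (μ : ℕ) : tzDegree (Finsupp.single (Var.x : Var m) μ) = 0 := by
  simp [tzDegree]

/-- ∂_{z_q} lowers the degree in (t, z) by one, and β derivatives in x followed by x = 0 select
exactly the monomials containing x^β. -/
lemma Lval_le {d : Var m →₀ ℕ} (hd : 2 ≤ tzDegree d)
    (hne : MvPowerSeries.coeff d (taylor F) ≠ 0) {q : Idx m} (hq : d (Var.z q) ≠ 0) :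
    Lval F (d Var.x) q ≤ ((tzDegree d - 1 : ℕ) : ℕ∞) := by
  set d' : Var m →₀ ℕ := d - Finsupp.single (Var.z q) 1 - Finsupp.single Var.x (d Var.x) with hd'
  have hdd : d' + Finsupp.single (Var.z q) 1 + Finsupp.single Var.x (d Var.x) = d := by
    ext v
    by_cases hvx : v = Var.x
    · subst hvx; simp [hd']
    · by_cases hvz : v = Var.z q
      · subst hvz; simp [hd']; omega
      · simp [hd', Finsupp.single_eq_of_ne hvx, Finsupp.single_eq_of_ne hvz]
  have hdeg := congrArg tzDegree hdd
  rw [tzDegree_add, tzDegree_add, tzDegree_single_z, tzDegree_single_x] at hdeg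
  refine sInf_le ⟨d', by simp [hd'], ?_, ?_⟩
  · rw [coeff_pderiv_R2_ne_zero_iff, hdd, coeff_R2, if_pos hd]
    exact hne
  · congr 1; omega

lemma exists_Lval_eq {μ : ℕ} {q : Idx m} (h : Lval F μ q ≠ ⊤) :
    ∃ d : Var m →₀ ℕ, 2 ≤ tzDegree d ∧ MvPowerSeries.coeff d (taylor F) ≠ 0 ∧ d (Var.z q) ≠ 0 ∧
      d Var.x = μ ∧ Lval F μ q = ((tzDegree d - 1 : ℕ) : ℕ∞) := by
  have hne : {n : ℕ∞ | ∃ d : Var m →₀ ℕ, d Var.x = 0 ∧ MvPowerSeries.coeff d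
      (MvPowerSeries.pderiv ℂ (Var.z q)
        ((fun f => MvPowerSeries.pderiv ℂ (Var.x : Var m) f)^[μ] (R2 F))) ≠ 0 ∧
      n = (tzDegree d : ℕ∞)}.Nonempty := by
    by_contra hempty
    rw [Set.not_nonempty_iff_eq_empty] at hempty
    apply h
    unfold Lval valAtXZero
    rw [hempty, sInf_empty]
  obtain ⟨d, hx, hd, hL⟩ := csInf_mem hne
  rw [coeff_pderiv_R2_ne_zero_iff, coeff_R2] at hd
  split_ifs at hd with h2
  · refine ⟨_, h2, hd, by simp, by simp [hx], ?_⟩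
    rw [tzDegree_add, tzDegree_add, tzDegree_single_z, tzDegree_single_x]
    exact hL
  · exact absurd rfl hd

/-- The form in which s₀ enters the upper bound: one inequality for each monomial and each z_q in
it. The definition uses the least degree, and a larger degree only helps because s₀ ≥ 1. For β ≥ m
the left side is not positive, since σ₀ ≥ 1 and j + α ≤ m. -/
lemma le_gevreyIndex {d : Var m →₀ ℕ} (hd : 2 ≤ tzDegree d)
    (hne : MvPowerSeries.coeff d (taylor F) ≠ 0) {q : Idx m} (hq : d (Var.z q) ≠ 0) :
    (q.1.1 : ℝ) + d Var.x + irregularity F * ((q.1.2 : ℝ) - d Var.x) - m ≤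
      (gevreyIndex F - 1) * ((tzDegree d : ℝ) - 1) := by
  have hs := one_le_gevreyIndex F
  have hd' : (2 : ℝ) ≤ tzDegree d := by exact_mod_cast hd
  rcases Nat.lt_or_ge (d Var.x) m with hx | hx
  · have hL := Lval_le hd hne hq
    have hLtop : Lval F (d Var.x) q ≠ ⊤ := fun h => by rw [h] at hL; simp at hL
    have hle := le_csSup (finite_gevreyIndex F).bddAbove
      (Set.mem_insert_of_mem _ ⟨d Var.x, hx, q, rfl⟩)
    unfold divENat at hle
    rw [if_neg hLtop] at hle
    obtain ⟨e, he2, -, -, -, heL⟩ := exists_Lval_eq hLtop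
    rw [heL, ENat.toNat_natCast] at hle
    have h1 : 1 ≤ tzDegree e - 1 := by omega
    have h2 : tzDegree e - 1 ≤ tzDegree d - 1 := by rw [heL] at hL; exact_mod_cast hL
    have h3 : ((tzDegree e - 1 : ℕ) : ℝ) ≤ (tzDegree d : ℝ) - 1 := by
      rw [← Nat.cast_pred (by omega)]; exact_mod_cast h2
    have h4 : (0 : ℝ) < ((tzDegree e - 1 : ℕ) : ℝ) := by exact_mod_cast h1
    rw [div_le_iff₀ h4] at hle
    have h5 : gevreyIndex F - 1 = sSup (insert 0 {r : ℝ | ∃ μ < m, ∃ q : Idx m,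
      r = divENat ((q.1.1 : ℝ) + μ + irregularity F * ((q.1.2 : ℝ) - μ) - m) (Lval F μ q)}) := by
      unfold gevreyIndex; ring
    refine hle.trans ?_
    unfold divENat at h5
    rw [← h5]
    exact mul_le_mul_of_nonneg_left h3 (by linarith)
  · have h1 : (m : ℝ) ≤ d Var.x := by exact_mod_cast hx
    have h2 : (q.1.1 : ℝ) + q.1.2 ≤ m := by exact_mod_cast idx_add_le q
    have h3 : (q.1.2 : ℝ) ≤ m := by exact_mod_cast idx_snd_le q
    have h4 := one_le_irregularity F
    have h5 : 0 ≤ (gevreyIndex F - 1) * ((tzDegree d : ℝ) - 1) :=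
      mul_nonneg (by linarith) (by linarith)
    nlinarith

/-- A quotient exceeding s - 1 ≥ 0 has a finite denominator, and a monomial of least degree realises
it. -/
lemma exists_of_lt_gevreyIndex {s : ℝ} (hs : 1 ≤ s) (h : s < gevreyIndex F) :
    ∃ (d : Var m →₀ ℕ) (q : Idx m), 2 ≤ tzDegree d ∧ MvPowerSeries.coeff d (taylor F) ≠ 0 ∧
      d (Var.z q) ≠ 0 ∧ (s - 1) * ((tzDegree d : ℝ) - 1) <
      (q.1.1 : ℝ) + d Var.x + irregularity F * ((q.1.2 : ℝ) - d Var.x) - m := by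
  have h' : s - 1 < sSup (insert 0 {r : ℝ | ∃ μ < m, ∃ q : Idx m,
      r = divENat ((q.1.1 : ℝ) + μ + irregularity F * ((q.1.2 : ℝ) - μ) - m) (Lval F μ q)}) := by
    unfold gevreyIndex at h; linarith
  obtain ⟨r, hr, hlt⟩ := exists_lt_of_lt_csSup (Set.insert_nonempty _ _) h'
  rcases hr with rfl | ⟨μ, hμ, q, rfl⟩
  · linarith
  · unfold divENat at hlt
    split_ifs at hlt with htop
    · linarith
    · obtain ⟨d, hd2, hne, hq, hx, hL⟩ := exists_Lval_eq htop
      refine ⟨d, q, hd2, hne, hq, ?_⟩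
      rw [hL, ENat.toNat_natCast, Nat.cast_pred (by omega), lt_div_iff₀] at hlt
      · rw [hx]; exact hlt
      · have : (2 : ℝ) ≤ tzDegree d := by exact_mod_cast hd2
        linarith

lemma exists_of_pderiv_ne_zero {q : Idx m} (h : MvPowerSeries.pderiv ℂ (Var.z q) (R2 F) ≠ 0) :
    ∃ d : Var m →₀ ℕ, 2 ≤ tzDegree d ∧ MvPowerSeries.coeff d (taylor F) ≠ 0 ∧
      d (Var.z q) ≠ 0 := by
  obtain ⟨d, hd⟩ : ∃ d, MvPowerSeries.coeff d (MvPowerSeries.pderiv ℂ (Var.z q) (R2 F)) ≠ 0 := by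
    by_contra! hall
    exact h (MvPowerSeries.ext fun d => by rw [hall d, map_zero])
  have := (coeff_pderiv_R2_ne_zero_iff 0 q d).1 hd
  rw [Finsupp.single_zero, add_zero, coeff_R2] at this
  split_ifs at this with h2
  · exact ⟨_, h2, this, by simp⟩
  · exact absurd rfl this

end GevreyIndex

/-! ### Linear terms against L(k, l) -/

section LinearBound

lemma mem_Lam0_iff {G : (Var m →₀ ℕ) → ℝ}
    (hF : ∀ d, MvPowerSeries.coeff d (taylor F) = (G d : ℂ)) (q : Idx m) :
    PowerSeries.constantCoeff (cCoeff F q) ≠ 0 ↔ cFun G q 0 ≠ 0 := by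
  rw [← PowerSeries.coeff_zero_eq_constantCoeff_apply, coeff_cCoeff, hF]
  exact_mod_cast Iff.rfl

/-- The terms that raise the power of `x` by `h` are controlled by `L(k, l)` and the Gevrey
weight. -/
lemma exists_mul_pow_le {G : (Var m →₀ ℕ) → ℝ} (hG : PosData G)
    (hF : ∀ d, MvPowerSeries.coeff d (taylor F) = (G d : ℂ)) :
    ∃ C : ℝ, 1 ≤ C ∧ ∀ (q : Idx m) (h : ℕ), cFun G q (h + 1) ≠ 0 → ∀ k l : ℕ, 1 ≤ k → 1 ≤ l →
      (k : ℝ) ^ q.1.1 * (l : ℝ) ^ q.1.2 ≤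
        C * (l : ℝ) ^ (((h + 1 : ℕ) : ℝ) * (irregularity F - 1)) * charFun G k l := by
  obtain ⟨C, hC, hmain⟩ := exists_pow_le_charFun hG
  refine ⟨C, hC, fun q h hc k l hk hl => ?_⟩
  have hσ := one_le_irregularity F
  have hl1 : (1 : ℝ) ≤ l := by exact_mod_cast hl
  have hk1 : (1 : ℝ) ≤ k := by exact_mod_cast hk
  have hL := charFun_pos hG hk l
  have hpow : (1 : ℝ) ≤ (l : ℝ) ^ (((h + 1 : ℕ) : ℝ) * (irregularity F - 1)) :=
    Real.one_le_rpow hl1 (mul_nonneg (Nat.cast_nonneg _) (by linarith))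
  obtain ⟨h1, h2⟩ := hmain k l hk
  by_cases hq0 : cFun G q 0 = 0
  · have hq : q ∈ Lam1 F := by
      refine ⟨by_contra fun hne => (mem_Lam0_iff hF q).1 hne hq0, fun h0 => hc ?_⟩
      have := coeff_cCoeff F q (h + 1)
      rw [h0, hF] at this
      simpa [cFun] using this.symm
    have hp : zeroOrder F q ≤ h + 1 := by
      apply zeroOrder_le
      rw [coeff_cCoeff, hF]
      exact_mod_cast hc
    have hd : vertDist F q ≤ ((h + 1 : ℕ) : ℝ) * (irregularity F - 1) := by
      refine (vertDist_le hq).trans ?_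
      have : (zeroOrder F q : ℝ) ≤ ((h + 1 : ℕ) : ℝ) := by exact_mod_cast hp
      exact mul_le_mul_of_nonneg_right this (by linarith)
    -- For l = 1 the functional used below degenerates because log l = 0, but k^j ≤ k^m is enough
    -- there.
    rcases Nat.eq_or_lt_of_le hl with rfl | hl2
    · have : (k : ℝ) ^ q.1.1 ≤ (k : ℝ) ^ m := pow_le_pow_right₀ hk1 (idx_fst_lt q).le
      simp only [Nat.cast_one, one_pow, mul_one, Real.one_rpow]
      linarith
    · have hl0 : (0 : ℝ) < l := by linarith
      have hlog : 0 < Real.log l := Real.log_pos (by exact_mod_cast hl2)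
      -- In logarithms the bounds of k^j l^α by C L(k, l) on Λ₀ are bounds for the linear functional
      -- with coefficients (log k, log l), so they extend to the boundary point (j, α - d).
      have key := add_mul_sub_vertDist_le (F := F) (a := Real.log k) (b := Real.log l)
        (c := Real.log (C * charFun G k l)) (Real.log_nonneg hk1) hlog (by
          have aux : ∀ j α : ℕ, (k : ℝ) ^ j * (l : ℝ) ^ α ≤ C * charFun G k l →
              Real.log k * j + Real.log l * α ≤ Real.log (C * charFun G k l) := by
            intro j α hle
            have := Real.log_le_log (by positivity) hle
            rw [Real.log_mul (by positivity) (by positivity), Real.log_pow, Real.log_pow] at this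
            linarith
          rintro p (hp | ⟨q', hq', rfl⟩)
          · rw [Set.mem_singleton_iff.1 hp]
            exact aux m 0 (by simpa using h1)
          · exact aux _ _ (h2 q' ((mem_Lam0_iff hF q').1 hq'))) q
      have hfin : Real.log ((k : ℝ) ^ q.1.1 * (l : ℝ) ^ q.1.2) ≤
          Real.log (C * (l : ℝ) ^ (((h + 1 : ℕ) : ℝ) * (irregularity F - 1)) * charFun G k l) := by
        rw [Real.log_mul (by positivity) (by positivity), Real.log_pow, Real.log_pow,
          mul_right_comm, Real.log_mul (by positivity) (by positivity), Real.log_rpow hl0]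
        have := mul_le_mul_of_nonneg_right hd hlog.le
        linarith
      exact (Real.log_le_log_iff (by positivity) (by positivity)).1 hfin
  · refine (h2 q hq0).trans ?_
    gcongr
    exact le_mul_of_one_le_right (by linarith) hpow

end LinearBound

end TotChar

end

noncomputable section

namespace TotChar

/-! ### Inequalities for binomial coefficients and factorials -/

section Combinatorics

/-- Raising a to a + 1 multiplies the binomial by (a + 1 + l) / (a + 1), which is at least (B + l) /
B as long as a + 1 ≤ B. -/
lemma choose_mul_add_pow_le (a l B Δ : ℕ) (h : a + Δ ≤ B) :
    (a + l).choose l * (B + l) ^ Δ ≤ (a + Δ + l).choose l * B ^ Δ := by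
  induction Δ with
  | zero => simp
  | succ Δ ih =>
    have ih := ih (by omega)
    have e := Nat.choose_mul_succ_eq (a + Δ + l) l
    rw [show a + Δ + l + 1 - l = a + Δ + 1 by omega,
      show a + Δ + l + 1 = a + (Δ + 1) + l by ring] at e
    have hcross : (B + l) * (a + Δ + 1) ≤ (a + (Δ + 1) + l) * B := by nlinarith
    refine Nat.le_of_mul_le_mul_right ?_ (show 0 < a + Δ + 1 by omega)
    calc (a + l).choose l * (B + l) ^ (Δ + 1) * (a + Δ + 1)
        = (a + l).choose l * (B + l) ^ Δ * ((B + l) * (a + Δ + 1)) := by ring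
      _ ≤ (a + Δ + l).choose l * B ^ Δ * ((a + (Δ + 1) + l) * B) := Nat.mul_le_mul ih hcross
      _ = ((a + Δ + l).choose l * (a + (Δ + 1) + l)) * B ^ (Δ + 1) := by ring
      _ = ((a + (Δ + 1) + l).choose l * (a + Δ + 1)) * B ^ (Δ + 1) := by rw [e]
      _ = _ := by ring

/-- The ratio (a + l + 1) / (l + 1) of consecutive binomials decreases in l, so the first ratio
bounds all later ones. -/
lemma choose_add_mul_pow_le (a l δ : ℕ) :
    (a + (l + δ)).choose (l + δ) * (l + 1) ^ δ ≤ (a + l).choose l * (a + l + 1) ^ δ := by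
  induction δ with
  | zero => simp
  | succ δ ih =>
    have e := Nat.add_one_mul_choose_eq (a + (l + δ)) (l + δ)
    have hcross : (a + (l + δ) + 1) * (l + 1) ≤ (a + l + 1) * (l + δ + 1) := by nlinarith
    refine Nat.le_of_mul_le_mul_right ?_ (show 0 < l + δ + 1 by omega)
    calc (a + (l + (δ + 1))).choose (l + (δ + 1)) * (l + 1) ^ (δ + 1) * (l + δ + 1)
        = ((a + (l + δ) + 1).choose (l + δ + 1) * (l + δ + 1)) * (l + 1) ^ (δ + 1) := by
          rw [show a + (l + (δ + 1)) = a + (l + δ) + 1 by ring,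
            show l + (δ + 1) = l + δ + 1 by ring]
          ring
      _ = ((a + (l + δ) + 1) * (a + (l + δ)).choose (l + δ)) * (l + 1) ^ (δ + 1) := by rw [e]
      _ = ((a + (l + δ)).choose (l + δ) * (l + 1) ^ δ) * ((a + (l + δ) + 1) * (l + 1)) := by ring
      _ ≤ ((a + l).choose l * (a + l + 1) ^ δ) * ((a + l + 1) * (l + δ + 1)) :=
          Nat.mul_le_mul ih hcross
      _ = _ := by ring

lemma choose_add_mono {a a' l l' : ℕ} (ha : a ≤ a') (hl : l ≤ l') :
    (a + l).choose l ≤ (a' + l').choose l' := by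
  calc (a + l).choose l ≤ (a' + l).choose l := Nat.choose_le_choose _ (by omega)
    _ = (a' + l).choose a' := (Nat.choose_symm_add).symm
    _ ≤ (a' + l').choose a' := Nat.choose_le_choose _ (by omega)
    _ = _ := Nat.choose_symm_add

/-- The left side is one summand of Vandermonde's identity. -/
lemma choose_mul_choose_le (a l b n : ℕ) :
    (a + l).choose l * (b + n).choose n ≤ (a + b + (l + n)).choose (l + n) := by
  rw [show a + b + (l + n) = (a + l) + (b + n) by ring, Nat.add_choose_eq (a + l)]
  exact Finset.single_le_sum (f := fun p : ℕ × ℕ => (a + l).choose p.1 * (b + n).choose p.2)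
    (fun _ _ => Nat.zero_le _) (by simp : (l, n) ∈ Finset.HasAntidiagonal.antidiagonal (l + n))

lemma prod_choose_le {ι : Type*} (s : Finset ι) (a l : ι → ℕ) :
    ∏ r ∈ s, (a r + l r).choose (l r) ≤
      (∑ r ∈ s, a r + ∑ r ∈ s, l r).choose (∑ r ∈ s, l r) := by
  classical
  induction s using Finset.induction_on with
  | empty => simp
  | insert r s hr ih =>
    rw [Finset.prod_insert hr, Finset.sum_insert hr, Finset.sum_insert hr]
    exact (Nat.mul_le_mul_left _ ih).trans (choose_mul_choose_le _ _ _ _)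

lemma factorial_mul_mul_factorial_le {x κ₀ κ : ℕ} (hx : κ₀ ≤ x) (hκ : 1 ≤ κ) :
    x ! * κ₀ * κ ! ≤ (x + κ)! := by
  induction κ, hκ using Nat.le_induction with
  | base => rw [Nat.factorial_succ x, Nat.factorial_one]; nlinarith [Nat.factorial_pos x]
  | succ κ hκ ih =>
    rw [← add_assoc, Nat.factorial_succ (x + κ), Nat.factorial_succ κ]
    calc x ! * κ₀ * ((κ + 1) * κ !) = (κ + 1) * (x ! * κ₀ * κ !) := by ring
      _ ≤ (x + κ + 1) * (x + κ)! := Nat.mul_le_mul (by omega) ih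

/-- Merging one more (κ r)! into the factorial of the total leaves room for one factor κ r₀, and so
does each unit of i. This makes degree - 1 spare factors, which is why the denominators of s₀ are
degrees lowered by one. -/
lemma prod_factorial_mul_pow_le {ι : Type*} [Fintype ι] [DecidableEq ι] (κ : ι → ℕ) (r₀ : ι)
    (hκ : ∀ r, 1 ≤ κ r) (i : ℕ) :
    (∏ r, (κ r)!) * κ r₀ ^ (i + Fintype.card ι - 1) ≤ (i + ∑ r, κ r)! := by
  have h1 : ∀ i : ℕ, (κ r₀)! * κ r₀ ^ i ≤ (κ r₀ + i)! := by
    intro i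
    exact (Nat.mul_le_mul_left _ (Nat.pow_le_pow_left (Nat.le_succ _) _)).trans
      (Nat.factorial_mul_pow_le_factorial)
  have h2 : ∀ s : Finset ι, r₀ ∉ s → (κ r₀)! * (∏ r ∈ s, (κ r)!) * κ r₀ ^ (i + s.card) ≤
      (κ r₀ + i + ∑ r ∈ s, κ r)! := by
    intro s
    induction s using Finset.induction_on with
    | empty => intro _; simpa using h1 i
    | insert r s hr ih =>
      intro hr0
      have ih := ih (fun h => hr0 (Finset.mem_insert_of_mem h))
      rw [Finset.prod_insert hr, Finset.sum_insert hr, Finset.card_insert_of_notMem hr]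
      calc (κ r₀)! * ((κ r)! * ∏ r ∈ s, (κ r)!) * κ r₀ ^ (i + (s.card + 1))
          = ((κ r₀)! * (∏ r ∈ s, (κ r)!) * κ r₀ ^ (i + s.card)) * κ r₀ * (κ r)! := by ring
        _ ≤ (κ r₀ + i + ∑ r ∈ s, κ r)! * κ r₀ * (κ r)! := by gcongr
        _ ≤ (κ r₀ + i + ∑ r ∈ s, κ r + κ r)! :=
            factorial_mul_mul_factorial_le (by omega) (hκ r)
        _ = _ := by congr 1; ring
  have h3 := h2 (Finset.univ.erase r₀) (Finset.notMem_erase _ _)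
  rw [Finset.mul_prod_erase _ (fun r => (κ r)!) (Finset.mem_univ r₀), Finset.card_erase_of_mem (Finset.mem_univ _),
    Finset.card_univ, add_right_comm, Finset.add_sum_erase _ _ (Finset.mem_univ r₀)] at h3
  have hc : 1 ≤ Fintype.card ι := Fintype.card_pos_iff.2 ⟨r₀⟩
  rw [show i + Fintype.card ι - 1 = i + (Fintype.card ι - 1) by omega, add_comm i (∑ r, κ r)]
  exact h3

lemma prod_factorial_le {ι : Type*} (s : Finset ι) (l : ι → ℕ) :
    ∏ r ∈ s, (l r)! ≤ (∑ r ∈ s, l r)! :=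
  Nat.le_of_dvd (Nat.factorial_pos _) (Nat.prod_factorial_dvd_factorial_sum s l)

end Combinatorics

/-! ### One derivative acting on the weight -/

section Weight

set_option maxHeartbeats 1000000 in
/-- The effect of `x^β (t ∂_t)^j ∂_x^α` on the Gevrey weights. -/
lemma exists_deriv_weight_le (m M Δ : ℕ) (σ : ℝ) (hσ : 1 ≤ σ) (hΔ : σ * m ≤ Δ) (hM : Δ ≤ M)
    (hM1 : 1 ≤ M) :
    ∃ C : ℝ, 1 ≤ C ∧ ∀ j α : ℕ, j + α ≤ m → ∀ β k l' : ℕ, 1 ≤ k →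
      (k : ℝ) ^ j * ((l' + α).descFactorial α : ℝ) * (((l' + α)! : ℝ) ^ (σ - 1) *
        ((M * (k - 1) + (l' + α)).choose (l' + α) : ℝ)) ≤
      C * (k : ℝ) ^ ((m : ℝ) + max 0 (j + β + σ * (α - β) - m)) * (((l' + β)! : ℝ) ^ (σ - 1) *
        ((M * (k - 1) + Δ + (l' + β)).choose (l' + β) : ℝ)) := by
  have hmr : (0 : ℝ) ≤ m := Nat.cast_nonneg m
  have hM1r : (1 : ℝ) ≤ M := by exact_mod_cast hM1
  have hmΔ : (m : ℝ) ≤ Δ := by nlinarith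
  set c : ℝ := ((m : ℝ) + 1) ^ (σ * m) with hc
  have hc1 : 1 ≤ c := Real.one_le_rpow (by linarith) (by positivity)
  have hMσ : 1 ≤ (M : ℝ) ^ (σ * m) := Real.one_le_rpow hM1r (by positivity)
  refine ⟨c * (M : ℝ) ^ (σ * m), one_le_mul_of_one_le_of_one_le hc1 hMσ,
    fun j α hjα β k l' hk => ?_⟩
  have hkr : (1 : ℝ) ≤ k := by exact_mod_cast hk
  have hjα' : (j : ℝ) + α ≤ m := by exact_mod_cast hjα
  have hα' : (α : ℝ) ≤ m := by linarith [(Nat.cast_nonneg j : (0 : ℝ) ≤ j)]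
  have hα0 : (0 : ℝ) ≤ α := Nat.cast_nonneg α
  have hβ0 : (0 : ℝ) ≤ β := Nat.cast_nonneg β
  set a := M * (k - 1) with ha
  set l := l' + β with hl
  -- a + Δ ≤ a + M = B, so `choose_mul_add_pow_le` applies: Δ extra units in the binomial allow (B +
  -- l)^e with e ≤ Δ to be replaced by (M k)^e, turning powers of l into powers of k.
  set B : ℕ := M * k with hB
  have haB : a + M = B := by
    rw [ha, hB]; obtain ⟨n, rfl⟩ : ∃ n, k = n + 1 := ⟨k - 1, by omega⟩; simp; ring
  have hB0 : (0 : ℝ) < B := by rw [hB]; push_cast; positivity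
  have hBl : (B : ℝ) ≤ B + l := by linarith [(Nat.cast_nonneg l : (0 : ℝ) ≤ l)]
  -- the gain from the additional `Δ`
  have hgain : ∀ e : ℝ, 0 ≤ e → e ≤ Δ → ((a + l).choose l : ℝ) * ((B + l : ℝ) ^ e) ≤
      ((a + Δ + l).choose l : ℝ) * (B : ℝ) ^ e := by
    intro e he0 he
    have h1 : ((a + l).choose l : ℝ) * (B + l : ℝ) ^ Δ ≤ ((a + Δ + l).choose l : ℝ) * (B : ℝ) ^ Δ := by
      exact_mod_cast choose_mul_add_pow_le a l B Δ (by omega)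
    have h2 : ((B + l : ℝ)) ^ e * (B : ℝ) ^ ((Δ : ℝ) - e) ≤ 
        ((B + l : ℝ)) ^ e * (B + l : ℝ) ^ ((Δ : ℝ) - e) := by
      gcongr
    rw [← Real.rpow_add (by linarith), add_sub_cancel, Real.rpow_natCast] at h2
    have h3 : (0 : ℝ) < (B : ℝ) ^ ((Δ : ℝ) - e) := Real.rpow_pos_of_pos hB0 _
    refine le_of_mul_le_mul_right ?_ h3
    rw [mul_assoc, mul_assoc, ← Real.rpow_add hB0, add_sub_cancel, Real.rpow_natCast]
    exact (mul_le_mul_of_nonneg_left h2 (Nat.cast_nonneg _)).trans h1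
  have hfl : (0 : ℝ) < (l ! : ℝ) ^ (σ - 1) := Real.rpow_pos_of_pos (by positivity) _
  have hchoose0 : (0 : ℝ) ≤ ((a + l).choose l : ℝ) := Nat.cast_nonneg _
  rcases Nat.lt_or_ge α β with hαβ | hαβ
  · -- the power of `x` increases
    have hE : (k : ℝ) ^ (m : ℝ) ≤ (k : ℝ) ^ ((m : ℝ) + max 0 (j + β + σ * (α - β) - m)) :=
      Real.rpow_le_rpow_of_exponent_le hkr (by linarith [le_max_left 0 (j + β + σ * (α - β) - m)])
    have h1 : ((l' + α).descFactorial α : ℝ) ≤ (l : ℝ) ^ α := by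
      calc ((l' + α).descFactorial α : ℝ) ≤ ((l' + α : ℕ) : ℝ) ^ α := by
            exact_mod_cast Nat.descFactorial_le_pow _ _
        _ ≤ (l : ℝ) ^ α := by gcongr; omega
    have h2 : (((l' + α)! : ℕ) : ℝ) ^ (σ - 1) ≤ (l ! : ℝ) ^ (σ - 1) := by
      refine Real.rpow_le_rpow (Nat.cast_nonneg _) ?_ (by linarith)
      exact_mod_cast Nat.factorial_le (by omega)
    have h3 : ((a + (l' + α)).choose (l' + α) : ℝ) ≤ ((a + l).choose l : ℝ) := by
      exact_mod_cast choose_add_mono le_rfl (by omega)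
    have h4 := hgain α hα0 (by linarith)
    have h5 : (k : ℝ) ^ j * (l : ℝ) ^ α * ((a + l).choose l : ℝ) ≤
        (M : ℝ) ^ (σ * m) * (k : ℝ) ^ (m : ℝ) * ((a + Δ + l).choose l : ℝ) := by
      have e1 : (l : ℝ) ^ α ≤ (B + l : ℝ) ^ (α : ℝ) := by
        rw [Real.rpow_natCast]; gcongr; linarith
      have e2 : (B : ℝ) ^ (α : ℝ) = (M : ℝ) ^ (α : ℝ) * (k : ℝ) ^ (α : ℝ) := by
        rw [hB]; push_cast; exact Real.mul_rpow (by linarith) (by linarith)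
      have e3 : (M : ℝ) ^ (α : ℝ) ≤ (M : ℝ) ^ (σ * m) :=
        Real.rpow_le_rpow_of_exponent_le hM1r (by nlinarith)
      have e4 : (k : ℝ) ^ j * (k : ℝ) ^ (α : ℝ) ≤ (k : ℝ) ^ (m : ℝ) := by
        rw [← Real.rpow_natCast, ← Real.rpow_add (by linarith)]
        exact Real.rpow_le_rpow_of_exponent_le hkr hjα'
      calc (k : ℝ) ^ j * (l : ℝ) ^ α * ((a + l).choose l : ℝ)
          ≤ (k : ℝ) ^ j * (B + l : ℝ) ^ (α : ℝ) * ((a + l).choose l : ℝ) := by gcongr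
        _ = (k : ℝ) ^ j * (((a + l).choose l : ℝ) * (B + l : ℝ) ^ (α : ℝ)) := by ring
        _ ≤ (k : ℝ) ^ j * (((a + Δ + l).choose l : ℝ) * (B : ℝ) ^ (α : ℝ)) := by gcongr
        _ = (M : ℝ) ^ (α : ℝ) * ((k : ℝ) ^ j * (k : ℝ) ^ (α : ℝ)) *
              ((a + Δ + l).choose l : ℝ) := by rw [e2]; ring
        _ ≤ _ := by gcongr
    calc _ ≤ (k : ℝ) ^ j * (l : ℝ) ^ α * ((l ! : ℝ) ^ (σ - 1) * ((a + l).choose l : ℝ)) := by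
          gcongr
      _ = (l ! : ℝ) ^ (σ - 1) * ((k : ℝ) ^ j * (l : ℝ) ^ α * ((a + l).choose l : ℝ)) := by ring
      _ ≤ (l ! : ℝ) ^ (σ - 1) * (1 * (M : ℝ) ^ (σ * m) * (k : ℝ) ^ (m : ℝ) *
            ((a + Δ + l).choose l : ℝ)) := by rw [one_mul]; gcongr
      _ ≤ (l ! : ℝ) ^ (σ - 1) * (c * (M : ℝ) ^ (σ * m) *
            (k : ℝ) ^ ((m : ℝ) + max 0 (j + β + σ * (α - β) - m)) *
            ((a + Δ + l).choose l : ℝ)) := by gcongr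
      _ = _ := by ring
  · -- the power of `x` decreases
    obtain ⟨δ, rfl⟩ := Nat.exists_eq_add_of_le hαβ
    have hl1 : l' + (β + δ) = l + δ := by omega
    rw [hl1]
    have hδ0 : (0 : ℝ) ≤ δ := Nat.cast_nonneg δ
    push_cast at hα' hjα' ⊢
    -- The total loss in powers of l: β + δ from the derivatives and δ (σ - 1) from the factorials.
    set e : ℝ := β + σ * δ with he
    have he0 : 0 ≤ e := by positivity
    have heΔ : e ≤ σ * m := by nlinarith
    have hτ : 0 ≤ σ - 1 := by linarith
    -- This dominates l + δ and is a constant multiple of l + 1, so that δ of its powers can be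
    -- spent on the ratio of binomials in `h3`.
    set y : ℝ := ((m : ℝ) + 1) * ((l : ℝ) + 1) with hy
    have hl0 : (0 : ℝ) ≤ l := Nat.cast_nonneg l
    have hly : (l : ℝ) + δ ≤ y := by nlinarith
    have hy0 : 0 < y := by positivity
    have h1 : ((l + δ).descFactorial (β + δ) : ℝ) ≤ y ^ ((β : ℝ) + δ) := by
      calc ((l + δ).descFactorial (β + δ) : ℝ) ≤ ((l + δ : ℕ) : ℝ) ^ (β + δ) := by
            exact_mod_cast Nat.descFactorial_le_pow _ _
        _ ≤ y ^ (β + δ) := by push_cast; gcongr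
        _ = _ := by rw [← Real.rpow_natCast]; push_cast; rfl
    have h2 : (((l + δ)! : ℕ) : ℝ) ^ (σ - 1) ≤ (l ! : ℝ) ^ (σ - 1) * y ^ ((δ : ℝ) * (σ - 1)) := by
      rw [Real.rpow_mul hy0.le, ← Real.mul_rpow (by positivity) (by positivity)]
      refine Real.rpow_le_rpow (by positivity) ?_ hτ
      calc (((l + δ)! : ℕ) : ℝ) ≤ (l ! : ℝ) * ((l + δ : ℕ) : ℝ) ^ δ := by
            have e := Nat.factorial_mul_descFactorial (show δ ≤ l + δ by omega)
            rw [Nat.add_sub_cancel] at e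
            rw [← e]
            exact_mod_cast Nat.mul_le_mul_left _ (Nat.descFactorial_le_pow _ _)
        _ ≤ (l ! : ℝ) * y ^ (δ : ℝ) := by rw [Real.rpow_natCast]; push_cast; gcongr
    have h3 : ((a + (l + δ)).choose (l + δ) : ℝ) * ((l : ℝ) + 1) ^ (δ : ℝ) ≤
        ((a + l).choose l : ℝ) * (B + l : ℝ) ^ (δ : ℝ) := by
      rw [Real.rpow_natCast, Real.rpow_natCast]
      calc ((a + (l + δ)).choose (l + δ) : ℝ) * ((l : ℝ) + 1) ^ δ ≤
          ((a + l).choose l : ℝ) * ((a : ℝ) + l + 1) ^ δ := by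
            exact_mod_cast choose_add_mul_pow_le a l δ
        _ ≤ _ := by
            have : (a : ℝ) + 1 ≤ B := by exact_mod_cast (by omega : a + 1 ≤ B)
            exact mul_le_mul_of_nonneg_left
              (pow_le_pow_left₀ (by positivity) (by linarith) _) hchoose0
    have h4 := hgain e he0 (heΔ.trans hΔ)
    have hyc : y ^ ((β : ℝ) + δ) * y ^ ((δ : ℝ) * (σ - 1)) =
        ((m : ℝ) + 1) ^ e * (((l : ℝ) + 1) ^ ((β : ℝ) + δ * (σ - 1)) * ((l : ℝ) + 1) ^ (δ : ℝ)) := by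
      rw [← Real.rpow_add hy0, ← Real.rpow_add (by positivity), hy,
        Real.mul_rpow (by positivity) (by positivity)]
      rw [show (β : ℝ) + δ + δ * (σ - 1) = e by rw [he]; ring,
        show (β : ℝ) + δ * (σ - 1) + δ = e by rw [he]; ring]
    have h5 : ((l : ℝ) + 1) ^ ((β : ℝ) + δ * (σ - 1)) ≤ (B + l : ℝ) ^ ((β : ℝ) + δ * (σ - 1)) := by
      refine Real.rpow_le_rpow (by positivity) ?_ (by positivity)
      have : (1 : ℝ) ≤ B := by exact_mod_cast (by omega : 1 ≤ B)
      linarith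
    have h6 : ((m : ℝ) + 1) ^ e ≤ c := Real.rpow_le_rpow_of_exponent_le (by linarith) heΔ
    have h7 : (k : ℝ) ^ j * (B : ℝ) ^ e ≤ (M : ℝ) ^ (σ * m) *
        (k : ℝ) ^ ((m : ℝ) + max 0 (j + β + σ * (β + δ - β) - m)) := by
      have e2 : (B : ℝ) ^ e = (M : ℝ) ^ e * (k : ℝ) ^ e := by
        rw [hB]; push_cast; exact Real.mul_rpow (by linarith) (by linarith)
      have e3 : (M : ℝ) ^ e ≤ (M : ℝ) ^ (σ * m) := Real.rpow_le_rpow_of_exponent_le hM1r heΔ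
      have e4 : (k : ℝ) ^ j * (k : ℝ) ^ e ≤
          (k : ℝ) ^ ((m : ℝ) + max 0 (j + β + σ * (β + δ - β) - m)) := by
        rw [← Real.rpow_natCast, ← Real.rpow_add (by linarith)]
        refine Real.rpow_le_rpow_of_exponent_le hkr ?_
        have := le_max_right 0 (j + β + σ * (β + δ - β) - m : ℝ)
        rw [he]
        linarith
      calc _ = (M : ℝ) ^ e * ((k : ℝ) ^ j * (k : ℝ) ^ e) := by rw [e2]; ring
        _ ≤ _ := by gcongr
    have hBle : (0 : ℝ) ≤ B + l := by linarith
    calc (k : ℝ) ^ j * ((l + δ).descFactorial (β + δ) : ℝ) * ((((l + δ)! : ℕ) : ℝ) ^ (σ - 1) *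
          ((a + (l + δ)).choose (l + δ) : ℝ))
        ≤ (k : ℝ) ^ j * y ^ ((β : ℝ) + δ) * ((l ! : ℝ) ^ (σ - 1) * y ^ ((δ : ℝ) * (σ - 1)) *
          ((a + (l + δ)).choose (l + δ) : ℝ)) := by gcongr
      _ = (k : ℝ) ^ j * (l ! : ℝ) ^ (σ - 1) * (y ^ ((β : ℝ) + δ) * y ^ ((δ : ℝ) * (σ - 1))) *
          ((a + (l + δ)).choose (l + δ) : ℝ) := by ring
      _ = (k : ℝ) ^ j * (l ! : ℝ) ^ (σ - 1) * (((m : ℝ) + 1) ^ e *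
          ((l : ℝ) + 1) ^ ((β : ℝ) + δ * (σ - 1))) *
          (((a + (l + δ)).choose (l + δ) : ℝ) * ((l : ℝ) + 1) ^ (δ : ℝ)) := by rw [hyc]; ring
      _ ≤ (k : ℝ) ^ j * (l ! : ℝ) ^ (σ - 1) * (c * (B + l : ℝ) ^ ((β : ℝ) + δ * (σ - 1))) *
          (((a + l).choose l : ℝ) * (B + l : ℝ) ^ (δ : ℝ)) := by gcongr
      _ = (k : ℝ) ^ j * (l ! : ℝ) ^ (σ - 1) * c * (((a + l).choose l : ℝ) * (B + l : ℝ) ^ e) := by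
          have : (B + l : ℝ) ^ e = (B + l : ℝ) ^ ((β : ℝ) + δ * (σ - 1)) * (B + l : ℝ) ^ (δ : ℝ) := by
            rw [← Real.rpow_add (by linarith)]; congr 1; rw [he]; ring
          rw [this]; ring
      _ ≤ (k : ℝ) ^ j * (l ! : ℝ) ^ (σ - 1) * c * (((a + Δ + l).choose l : ℝ) * (B : ℝ) ^ e) := by
          gcongr
      _ = c * (l ! : ℝ) ^ (σ - 1) * ((a + Δ + l).choose l : ℝ) * ((k : ℝ) ^ j * (B : ℝ) ^ e) := by
          ring
      _ ≤ c * (l ! : ℝ) ^ (σ - 1) * ((a + Δ + l).choose l : ℝ) * ((M : ℝ) ^ (σ * m) *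
          (k : ℝ) ^ ((m : ℝ) + max 0 (j + β + σ * (β + δ - β) - m))) := by gcongr
      _ = _ := by ring

end Weight

end TotChar

end

noncomputable section

namespace TotChar

/-! ### Products of differentiated weights -/

section ProductWeight

/-- The weights used to estimate the coefficients of the formal solution. -/
def weight (M N : ℕ) (s σ : ℝ) (k l : ℕ) : ℝ :=
  (k ! : ℝ) ^ (s - 1) / (k : ℝ) ^ N * ((l ! : ℝ) ^ (σ - 1) * ((M * (k - 1) + l).choose l : ℝ))

lemma weight_pos (M N : ℕ) (s σ : ℝ) {k : ℕ} (hk : 1 ≤ k) (l : ℕ) : 0 < weight M N s σ k l := by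
  unfold weight
  have : 0 < (M * (k - 1) + l).choose l := Nat.choose_pos (by omega)
  positivity

lemma exists_pow_le_pow (N : ℕ) : ∃ C : ℝ, 1 ≤ C ∧ ∀ n : ℕ, 1 ≤ n → (n : ℝ) ^ N ≤ C ^ n := by
  have hN : (1 : ℝ) ≤ N ! := by exact_mod_cast Nat.factorial_pos N
  refine ⟨N ! * Real.exp 1, one_le_mul_of_one_le_of_one_le hN (Real.one_le_exp (by norm_num)),
    fun n hn => ?_⟩
  have h := Real.pow_div_factorial_le_exp (n : ℝ) (Nat.cast_nonneg n) N
  rw [div_le_iff₀ (by positivity)] at h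
  calc (n : ℝ) ^ N ≤ Real.exp n * N ! := h
    _ ≤ Real.exp 1 ^ n * (N ! : ℝ) ^ n := by
        rw [← Real.exp_nat_mul, mul_one]
        gcongr
        exact le_self_pow₀ hN (by omega)
    _ = _ := by rw [mul_pow]; ring

/-- The growth of the weights dominates products of derivatives. -/
lemma exists_prod_weight_le (m : ℕ) (s σ : ℝ) (hs : 1 ≤ s) (hσ : 1 ≤ σ) :
    ∃ (M N : ℕ) (C : ℝ), 1 ≤ C ∧ ∀ (ι : Type) [Fintype ι] [DecidableEq ι] (j α κ lam : ι → ℕ)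
      (i β : ℕ), (∀ r, j r + α r ≤ m) → (∀ r, 1 ≤ κ r) → 2 ≤ i + Fintype.card ι →
      (∀ r, (j r : ℝ) + β + σ * (α r - β) - m ≤ (s - 1) * ((i + Fintype.card ι : ℕ) - 1)) →
      ∏ r, ((κ r : ℝ) ^ j r * ((lam r + α r).descFactorial (α r) : ℝ) *
        weight M N s σ (κ r) (lam r + α r)) ≤
      C ^ (i + Fintype.card ι) * ((i + ∑ r, κ r : ℕ) : ℝ) ^ m *
        weight M N s σ (i + ∑ r, κ r) (β + ∑ r, lam r) := by
  -- Δ bounds the powers of l to be converted. M exceeds 2Δ so that the increments Δ of all factors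
  -- fit into a single binomial, and N leaves k^(-Δ) after paying for k^m.
  set Δ : ℕ := ⌈σ * m⌉₊ with hΔ
  have hΔ' : σ * m ≤ Δ := Nat.le_ceil _
  set M : ℕ := 2 * Δ + 1 with hM
  set N : ℕ := m + Δ with hN
  obtain ⟨C₀, hC₀, hder⟩ := exists_deriv_weight_le m M Δ σ hσ hΔ' (by omega) (by omega)
  obtain ⟨C₁, hC₁, hpow⟩ := exists_pow_le_pow N
  refine ⟨M, N, C₀ * C₁, one_le_mul_of_one_le_of_one_le hC₀ hC₁, ?_⟩
  intro ι _ _ j α κ lam i β hjα hκ hdeg hcond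
  set n := Fintype.card ι with hn
  set k := i + ∑ r, κ r with hk
  set l := β + ∑ r, lam r with hl
  have hs0 : 0 ≤ s - 1 := by linarith
  have hσ0 : 0 ≤ σ - 1 := by linarith
  have hin1 : 1 ≤ i + n := by omega
  have hkn : n ≤ ∑ r, κ r := by
    have : ∑ r : ι, 1 ≤ ∑ r, κ r := Finset.sum_le_sum fun r _ => hκ r
    simpa [hn] using this
  have hk1 : 1 ≤ k := by omega
  have hkr : (1 : ℝ) ≤ k := by exact_mod_cast hk1
  rcases isEmpty_or_nonempty ι with hempty | hne
  · -- a pure power of `t` and `x`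
    have hn0 : n = 0 := Fintype.card_eq_zero
    have hki : k = i := by rw [hk]; simp
    rw [Fintype.prod_empty, hn0, add_zero, weight, hki]
    have hi : 1 ≤ i := by omega
    have h1 : (1 : ℝ) ≤ (i ! : ℝ) ^ (s - 1) :=
      Real.one_le_rpow (by exact_mod_cast Nat.factorial_pos i) hs0
    have h2 : (1 : ℝ) ≤ (l ! : ℝ) ^ (σ - 1) :=
      Real.one_le_rpow (by exact_mod_cast Nat.factorial_pos l) hσ0
    have h3 : (1 : ℝ) ≤ ((M * (i - 1) + l).choose l : ℝ) := by
      exact_mod_cast Nat.choose_pos (by omega)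
    have hi1 : (1 : ℝ) ≤ i := by exact_mod_cast hi
    have hi0 : (0 : ℝ) < (i : ℝ) ^ N := by positivity
    have h4 : (1 : ℝ) ≤ (C₀ * C₁) ^ i * (i : ℝ) ^ m * (1 / (i : ℝ) ^ N * (1 * 1)) := by
      rw [mul_one, mul_one, mul_one_div, one_le_div hi0]
      calc (i : ℝ) ^ N ≤ C₁ ^ i := hpow i hi
        _ ≤ (C₀ * C₁) ^ i := by gcongr; nlinarith
        _ ≤ (C₀ * C₁) ^ i * (i : ℝ) ^ m :=
            le_mul_of_one_le_right (by positivity) (one_le_pow₀ hi1)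
    refine h4.trans ?_
    gcongr
  -- the factor of highest order in `t`
  obtain ⟨r₀, -, hr₀⟩ := Finset.exists_max_image Finset.univ κ Finset.univ_nonempty
  have hκ₀ : (1 : ℝ) ≤ κ r₀ := by exact_mod_cast hκ r₀
  set E : ℝ := max 0 ((j r₀ : ℝ) + β + σ * (α r₀ - β) - m) with hE
  have hEle : E ≤ (s - 1) * ((i + n : ℕ) - 1) := by
    refine max_le (mul_nonneg hs0 ?_) (hcond r₀)
    have : (1 : ℝ) ≤ ((i + n : ℕ) : ℝ) := by exact_mod_cast hin1
    linarith
  -- The whole power x^β is charged to the factor of highest order in t.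
  set lam' : ι → ℕ := fun r => lam r + if r = r₀ then β else 0 with hlam'
  set ρ : ℝ := (κ r₀ : ℝ) ^ ((m : ℝ) + E) / (κ r₀ : ℝ) ^ N with hρ
  have hsum_lam' : ∑ r, lam' r = l := by
    rw [hlam', Finset.sum_add_distrib, hl]
    simp [add_comm]
  have hfactor : ∀ r, (κ r : ℝ) ^ j r * ((lam r + α r).descFactorial (α r) : ℝ) *
      weight M N s σ (κ r) (lam r + α r) ≤
      C₀ * ((κ r)! : ℝ) ^ (s - 1) * (if r = r₀ then ρ else 1) * (((lam' r)! : ℝ) ^ (σ - 1) *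
        ((M * (κ r - 1) + Δ + lam' r).choose (lam' r) : ℝ)) := by
    intro r
    have hκr : (1 : ℝ) ≤ κ r := by exact_mod_cast hκ r
    have hκN : (0 : ℝ) < (κ r : ℝ) ^ N := by positivity
    have hgen : ∀ b : ℕ, (κ r : ℝ) ^ j r * ((lam r + α r).descFactorial (α r) : ℝ) *
        weight M N s σ (κ r) (lam r + α r) ≤ C₀ * ((κ r)! : ℝ) ^ (s - 1) *
        ((κ r : ℝ) ^ ((m : ℝ) + max 0 ((j r : ℝ) + b + σ * (α r - b) - m)) / (κ r : ℝ) ^ N) *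
        (((lam r + b)! : ℝ) ^ (σ - 1) *
          ((M * (κ r - 1) + Δ + (lam r + b)).choose (lam r + b) : ℝ)) := by
      intro b
      have h := hder (j r) (α r) (hjα r) b (κ r) (lam r) (hκ r)
      have hf : (0 : ℝ) ≤ ((κ r)! : ℝ) ^ (s - 1) / (κ r : ℝ) ^ N := by positivity
      have := mul_le_mul_of_nonneg_left h hf
      calc _ = ((κ r)! : ℝ) ^ (s - 1) / (κ r : ℝ) ^ N * ((κ r : ℝ) ^ j r *
            ((lam r + α r).descFactorial (α r) : ℝ) * (((lam r + α r)! : ℝ) ^ (σ - 1) *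
            ((M * (κ r - 1) + (lam r + α r)).choose (lam r + α r) : ℝ))) := by
            unfold weight; ring
        _ ≤ _ := this
        _ = _ := by ring
    by_cases hr : r = r₀
    · subst hr
      have := hgen β
      simpa [hlam', hρ, hE] using this
    -- The other factors receive no power of x; their exponent of k is at most m + Δ = N, so k^(-N)
    -- absorbs it.
    · have h0 := hgen 0
      have hE0 : (κ r : ℝ) ^ ((m : ℝ) + max 0 ((j r : ℝ) + (0 : ℕ) + σ * (α r - (0 : ℕ)) - m)) /
          (κ r : ℝ) ^ N ≤ 1 := by
        rw [div_le_one hκN, ← Real.rpow_natCast (κ r : ℝ) N]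
        refine Real.rpow_le_rpow_of_exponent_le hκr ?_
        have hja : (j r : ℝ) + α r ≤ m := by exact_mod_cast hjα r
        have hj0 : (0 : ℝ) ≤ j r := Nat.cast_nonneg _
        have : max 0 ((j r : ℝ) + (0 : ℕ) + σ * (α r - (0 : ℕ)) - m) ≤ Δ := by
          refine max_le (Nat.cast_nonneg _) (le_trans ?_ hΔ')
          push_cast
          nlinarith [(Nat.cast_nonneg (α r) : (0 : ℝ) ≤ α r)]
        rw [hN]; push_cast; push_cast at this; linarith
      have hl' : lam' r = lam r + 0 := by simp [hlam', hr]
      rw [if_neg hr, hl']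
      refine h0.trans ?_
      gcongr
  have hC₀' : 0 ≤ C₀ := by linarith
  have hρ0 : 0 ≤ ρ := by positivity
  have hprod : ∏ r, ((κ r : ℝ) ^ j r * ((lam r + α r).descFactorial (α r) : ℝ) *
      weight M N s σ (κ r) (lam r + α r)) ≤
      C₀ ^ n * ((∏ r, (κ r)! : ℕ) : ℝ) ^ (s - 1) * ρ * (((∏ r, (lam' r)! : ℕ) : ℝ) ^ (σ - 1) *
        ((∏ r, (M * (κ r - 1) + Δ + lam' r).choose (lam' r) : ℕ) : ℝ)) := by
    refine (Finset.prod_le_prod (fun r _ => ?_) (fun r _ => hfactor r)).trans (le_of_eq ?_)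
    · have := (weight_pos M N s σ (hκ r) (lam r + α r)).le
      positivity
    · rw [Finset.prod_mul_distrib, Finset.prod_mul_distrib, Finset.prod_mul_distrib,
        Finset.prod_mul_distrib, Finset.prod_const, Finset.card_univ, Finset.prod_ite_eq',
        if_pos (Finset.mem_univ r₀)]
      push_cast
      rw [Real.finsetProd_rpow _ _ (fun r _ => by positivity),
        Real.finsetProd_rpow _ _ (fun r _ => by positivity)]
  -- collecting the factorials and binomial coefficients
  have hchoose : ∏ r, (M * (κ r - 1) + Δ + lam' r).choose (lam' r) ≤
      (M * (k - 1) + l).choose l := by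
    refine (prod_choose_le Finset.univ (fun r => M * (κ r - 1) + Δ) lam').trans ?_
    rw [hsum_lam']
    refine choose_add_mono ?_ le_rfl
    rw [Finset.sum_add_distrib, ← Finset.mul_sum, Finset.sum_const, Finset.card_univ, smul_eq_mul,
      ← hn]
    have h1 : ∑ r, (κ r - 1) + n = ∑ r, κ r := by
      rw [hn, ← Finset.card_univ, Finset.card_eq_sum_ones, ← Finset.sum_add_distrib]
      exact Finset.sum_congr rfl fun r _ => Nat.sub_add_cancel (hκ r)
    have h2 : k - 1 = ∑ r, (κ r - 1) + (i + n - 1) := by omega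
    -- Degree at least two is used here, and it is the source of the 2 in M.
    have h3 : n ≤ 2 * (i + n - 1) := by omega
    rw [h2, mul_add]
    have h4 : n * Δ ≤ M * (i + n - 1) := by
      calc n * Δ ≤ (2 * (i + n - 1)) * Δ := Nat.mul_le_mul_right _ h3
        _ = (2 * Δ) * (i + n - 1) := by ring
        _ ≤ M * (i + n - 1) := Nat.mul_le_mul_right _ (by omega)
    omega
  have hfac_l : ∏ r, (lam' r)! ≤ l ! := hsum_lam' ▸ prod_factorial_le Finset.univ lam'
  have hk_le : (k : ℝ) ≤ ((i + n : ℕ) : ℝ) * κ r₀ := by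
    have h1 : ∑ r, κ r ≤ n * κ r₀ := by
      calc ∑ r, κ r ≤ ∑ _r : ι, κ r₀ := Finset.sum_le_sum fun r hr => hr₀ r hr
        _ = n * κ r₀ := by simp [hn]
    have h2 : i ≤ i * κ r₀ := Nat.le_mul_of_pos_right _ (hκ r₀)
    have : k ≤ (i + n) * κ r₀ := by rw [add_mul]; omega
    exact_mod_cast this
  -- By maximality of κ r₀, k ≤ (i + n) κ r₀. The k^(-Δ) required by the weight of the product is
  -- therefore recovered at the cost of (i + n)^Δ, which is geometric in the degree.
  have hκ_pow : (κ r₀ : ℝ) ^ m / (κ r₀ : ℝ) ^ N ≤ C₁ ^ (i + n) * ((k : ℝ) ^ m / (k : ℝ) ^ N) := by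
    have e1 : (κ r₀ : ℝ) ^ m / (κ r₀ : ℝ) ^ N = 1 / (κ r₀ : ℝ) ^ Δ := by
      rw [hN, pow_add]; field_simp
    have e2 : (k : ℝ) ^ m / (k : ℝ) ^ N = 1 / (k : ℝ) ^ Δ := by
      rw [hN, pow_add]; field_simp
    rw [e1, e2, mul_one_div, div_le_div_iff₀ (by positivity) (by positivity), one_mul]
    have hin : (1 : ℝ) ≤ ((i + n : ℕ) : ℝ) := by exact_mod_cast hin1
    calc (k : ℝ) ^ Δ ≤ (((i + n : ℕ) : ℝ) * κ r₀) ^ Δ := by gcongr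
      _ = ((i + n : ℕ) : ℝ) ^ Δ * (κ r₀ : ℝ) ^ Δ := mul_pow _ _ _
      _ ≤ ((i + n : ℕ) : ℝ) ^ N * (κ r₀ : ℝ) ^ Δ := by
          gcongr
          omega
      _ ≤ _ := by gcongr; exact hpow _ hin1
  have hκ_fac : ((∏ r, (κ r)! : ℕ) : ℝ) ^ (s - 1) * (κ r₀ : ℝ) ^ E ≤ (k ! : ℝ) ^ (s - 1) := by
    calc ((∏ r, (κ r)! : ℕ) : ℝ) ^ (s - 1) * (κ r₀ : ℝ) ^ E
        ≤ ((∏ r, (κ r)! : ℕ) : ℝ) ^ (s - 1) * ((κ r₀ : ℝ) ^ (i + n - 1)) ^ (s - 1) := by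
          gcongr
          rw [← Real.rpow_natCast, ← Real.rpow_mul (by positivity)]
          refine Real.rpow_le_rpow_of_exponent_le hκ₀ ?_
          rw [Nat.cast_pred (by omega), mul_comm]
          exact hEle
      _ = (((∏ r, (κ r)! : ℕ) : ℝ) * (κ r₀ : ℝ) ^ (i + n - 1)) ^ (s - 1) :=
          (Real.mul_rpow (by positivity) (by positivity)).symm
      _ ≤ (k ! : ℝ) ^ (s - 1) := by
          refine Real.rpow_le_rpow (by positivity) ?_ hs0
          exact_mod_cast prod_factorial_mul_pow_le κ r₀ hκ i
  refine hprod.trans ?_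
  have hρe : ρ = (κ r₀ : ℝ) ^ E * ((κ r₀ : ℝ) ^ m / (κ r₀ : ℝ) ^ N) := by
    rw [hρ, Real.rpow_add (by linarith), Real.rpow_natCast]; ring
  have hlast : ((∏ r, (lam' r)! : ℕ) : ℝ) ^ (σ - 1) *
        ((∏ r, (M * (κ r - 1) + Δ + lam' r).choose (lam' r) : ℕ) : ℝ) ≤
      (l ! : ℝ) ^ (σ - 1) * ((M * (k - 1) + l).choose l : ℝ) := by
    gcongr
  have hC₀n : C₀ ^ n ≤ C₀ ^ (i + n) := pow_le_pow_right₀ hC₀ (by omega)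
  calc C₀ ^ n * ((∏ r, (κ r)! : ℕ) : ℝ) ^ (s - 1) * ρ * (((∏ r, (lam' r)! : ℕ) : ℝ) ^ (σ - 1) *
        ((∏ r, (M * (κ r - 1) + Δ + lam' r).choose (lam' r) : ℕ) : ℝ))
      = C₀ ^ n * (((∏ r, (κ r)! : ℕ) : ℝ) ^ (s - 1) * (κ r₀ : ℝ) ^ E) *
        ((κ r₀ : ℝ) ^ m / (κ r₀ : ℝ) ^ N) * (((∏ r, (lam' r)! : ℕ) : ℝ) ^ (σ - 1) *
        ((∏ r, (M * (κ r - 1) + Δ + lam' r).choose (lam' r) : ℕ) : ℝ)) := by rw [hρe]; ring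
    _ ≤ C₀ ^ (i + n) * (k ! : ℝ) ^ (s - 1) * (C₁ ^ (i + n) * ((k : ℝ) ^ m / (k : ℝ) ^ N)) *
        ((l ! : ℝ) ^ (σ - 1) * ((M * (k - 1) + l).choose l : ℝ)) := by
        gcongr
    _ = _ := by unfold weight; rw [mul_pow]; ring

end ProductWeight

end TotChar

end

noncomputable section

namespace TotChar

open scoped ENNReal NNReal

/-! ### Evaluation of series with coefficients in [0, ∞] -/

section Evaluation

/-- The value at `(t, x)` of a power series with coefficients in `[0, ∞]`. -/
def evalTX (t x : ℝ≥0∞) : MvPowerSeries (Fin 2) ℝ≥0∞ →* ℝ≥0∞ where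
  toFun f := ∑' e : Fin 2 →₀ ℕ, MvPowerSeries.coeff e f * (t ^ e 0 * x ^ e 1)
  map_one' := by
    rw [tsum_eq_single 0]
    · simp
    · intro e he
      rw [MvPowerSeries.coeff_one, if_neg he, zero_mul]
  map_mul' f g := by
    rw [← ENNReal.tsum_mul_right]
    simp_rw [← ENNReal.tsum_mul_left]
    rw [← ENNReal.tsum_prod, ← Finset.HasAntidiagonal.sigmaAntidiagonalEquivProd.tsum_eq, ENNReal.tsum_sigma']
    refine tsum_congr fun e => ?_
    rw [MvPowerSeries.coeff_mul, Finset.sum_mul, ← Finset.tsum_subtype]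
    refine tsum_congr fun p => ?_
    have hp : p.1.1 + p.1.2 = e := Finset.HasAntidiagonal.mem_antidiagonal.1 p.2
    have h0 : e 0 = p.1.1 0 + p.1.2 0 := by rw [← Finsupp.add_apply, hp]
    have h1 : e 1 = p.1.1 1 + p.1.2 1 := by rw [← Finsupp.add_apply, hp]
    simp only [Finset.HasAntidiagonal.sigmaAntidiagonalEquivProd_apply]
    rw [h0, h1, pow_add, pow_add]
    ring

variable (t x : ℝ≥0∞)

lemma evalTX_apply (f : MvPowerSeries (Fin 2) ℝ≥0∞) :
    evalTX t x f = ∑' e : Fin 2 →₀ ℕ, MvPowerSeries.coeff e f * (t ^ e 0 * x ^ e 1) := rfl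

/-- Exponents of monomials in two variables. -/
def txEquiv : ℕ × ℕ ≃ (Fin 2 →₀ ℕ) where
  toFun p := txExp p.1 p.2
  invFun e := (e 0, e 1)
  left_inv p := by simp
  right_inv e := txExp_eta e

lemma evalTX_eq_tsum (f : MvPowerSeries (Fin 2) ℝ≥0∞) :
    evalTX t x f = ∑' k, ∑' l, MvPowerSeries.coeff (txExp k l) f * (t ^ k * x ^ l) := by
  rw [evalTX_apply, ← txEquiv.tsum_eq, ENNReal.tsum_prod']
  simp [txEquiv]

lemma evalTX_ser (U : ℕ → ℕ → ℝ≥0∞) :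
    evalTX t x (ser U) = ∑' k, ∑' l, U k l * (t ^ k * x ^ l) := by
  rw [evalTX_eq_tsum]
  simp [coeff_ser]

lemma evalTX_X_zero : evalTX t x (MvPowerSeries.X 0) = t := by
  rw [evalTX_apply, tsum_eq_single (Finsupp.single 0 1)]
  · simp [MvPowerSeries.coeff_X]
  · intro e he
    rw [MvPowerSeries.coeff_X, if_neg he, zero_mul]

lemma evalTX_X_one : evalTX t x (MvPowerSeries.X 1) = x := by
  rw [evalTX_apply, tsum_eq_single (Finsupp.single 1 1)]
  · simp [MvPowerSeries.coeff_X]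
  · intro e he
    rw [MvPowerSeries.coeff_X, if_neg he, zero_mul]

lemma evalTX_jetMonomial {m : ℕ} (Z : Idx m → ℕ → ℕ → ℝ≥0∞) (d : Var m →₀ ℕ) :
    evalTX t x (jetMonomial Z d) =
      t ^ d Var.t * x ^ d Var.x * ∏ q, evalTX t x (ser (Z q)) ^ d (Var.z q) := by
  simp only [jetMonomial, map_mul, map_pow, map_prod, evalTX_X_zero, evalTX_X_one]

end Evaluation

/-! ### Auxiliary sums -/

section Sums

/-- A finite set of exponents lies in a cube, over which the sum factorises. -/
lemma tsum_prod_pow_le {ι : Type*} [Fintype ι] {y : ℝ≥0∞} {c : ℝ≥0∞} (hy : ∑' n : ℕ, y ^ n ≤ c) :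
    ∑' d : ι →₀ ℕ, ∏ v, y ^ d v ≤ c ^ Fintype.card ι := by
  classical
  rw [← Finsupp.equivFunOnFinite.symm.tsum_eq, ENNReal.tsum_eq_iSup_sum]
  refine iSup_le fun s => ?_
  set n := s.sup fun d => ∑ v, d v with hn
  have hs : s ⊆ Fintype.piFinset fun _ : ι => Finset.range (n + 1) := by
    intro d hd
    rw [Fintype.mem_piFinset]
    intro v
    rw [Finset.mem_range, Nat.lt_succ_iff]
    exact (Finset.single_le_sum (f := d) (fun _ _ => Nat.zero_le _) (Finset.mem_univ v)).trans
      (Finset.le_sup (f := fun d : ι → ℕ => ∑ v, d v) hd)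
  calc ∑ d ∈ s, ∏ v, y ^ (Finsupp.equivFunOnFinite.symm d) v
      ≤ ∑ d ∈ Fintype.piFinset fun _ : ι => Finset.range (n + 1), ∏ v, y ^ d v := by
        simpa using Finset.sum_le_sum_of_subset hs
    _ = ∏ _v : ι, ∑ k ∈ Finset.range (n + 1), y ^ k := (Finset.prod_univ_sum _ _).symm
    _ ≤ ∏ _v : ι, c := Finset.prod_le_prod' fun v _ => (ENNReal.sum_le_tsum _).trans hy
    _ = _ := by simp

lemma tsum_pow_le_two {y : ℝ≥0∞} (hy : y ≤ 2⁻¹) : ∑' n : ℕ, y ^ n ≤ 2 := by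
  rw [ENNReal.tsum_geometric]
  calc (1 - y)⁻¹ ≤ (1 - 2⁻¹)⁻¹ := ENNReal.inv_le_inv.2 (tsub_le_tsub_left hy 1)
    _ = 2 := by rw [ENNReal.one_sub_inv_two, inv_inv]

lemma sum_sum_sub_le (f g : ℕ → ℝ≥0∞) (n : ℕ) :
    ∑ l ∈ Finset.range n, ∑ h ∈ Finset.range l, f h * g (l - (h + 1)) ≤
      (∑' h, f h) * ∑ l ∈ Finset.range n, g l := by
  calc ∑ l ∈ Finset.range n, ∑ h ∈ Finset.range l, f h * g (l - (h + 1))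
      = ∑ h ∈ Finset.range n, ∑ l ∈ Finset.Ico (h + 1) n, f h * g (l - (h + 1)) := by
        refine Finset.sum_comm' fun l h => ?_
        simp only [Finset.mem_range, Finset.mem_Ico]
        omega
    _ ≤ ∑ h ∈ Finset.range n, f h * ∑ l ∈ Finset.range n, g l := by
        refine Finset.sum_le_sum fun h _ => ?_
        rw [← Finset.mul_sum, Finset.sum_Ico_eq_sum_range]
        gcongr
        calc ∑ i ∈ Finset.range (n - (h + 1)), g (h + 1 + i - (h + 1))
            = ∑ i ∈ Finset.range (n - (h + 1)), g i :=
              Finset.sum_congr rfl fun i _ => by rw [Nat.add_sub_cancel_left]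
          _ ≤ _ := Finset.sum_le_sum_of_subset (Finset.range_mono (by omega))
    _ = (∑ h ∈ Finset.range n, f h) * ∑ l ∈ Finset.range n, g l := (Finset.sum_mul _ _ _).symm
    _ ≤ _ := by gcongr; exact ENNReal.sum_le_tsum _

/-- Absorption needs a finite left side, which is why it is applied to finite partial sums only. -/
lemma le_two_mul_of_le_half_add {a b : ℝ≥0∞} (ha : a ≠ ⊤) (h : a ≤ 2⁻¹ * a + b) : a ≤ 2 * b := by
  have h1 : 2⁻¹ * a + 2⁻¹ * a ≤ 2⁻¹ * a + b := by
    rwa [← add_mul, ENNReal.inv_two_add_inv_two, one_mul]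
  have h2 : 2⁻¹ * a ≤ b := (ENNReal.add_le_add_iff_left (ENNReal.mul_ne_top (by simp) ha)).1 h1
  calc a = 2 * (2⁻¹ * a) := by
        rw [← mul_assoc, ENNReal.mul_inv_cancel (by simp) (by simp), one_mul]
    _ ≤ 2 * b := by gcongr

end Sums

/-! ### The majorant inequality -/

section Majorant

variable {m : ℕ}

/-- The shifted sequences that replace the derivatives in the majorant equation. -/
def shiftCoeff {R : Type*} (v : ℕ → ℕ → R) (q : Idx m) (k l : ℕ) : R := v k (l + q.1.2)

/-- The sequence `v` with the terms of order greater than `n` in `t` removed. -/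
def cutoff (v : ℕ → ℕ → ℝ≥0∞) (n k l : ℕ) : ℝ≥0∞ := if k ≤ n then v k l else 0

/-- A shift costs a constant depending only on x and m, in contrast to a derivative; the polynomial
factors of the derivatives have been moved into the weights. -/
lemma evalTX_shiftCoeff_le (v : ℕ → ℕ → ℝ≥0∞) (q : Idx m) {t x : ℝ≥0∞} (hx0 : x ≠ 0)
    (hx1 : x ≤ 1) :
    evalTX t x (ser (shiftCoeff v q)) ≤ (x ^ m)⁻¹ * evalTX t x (ser v) := by
  have hxt : x ≠ ⊤ := ne_top_of_le_ne_top ENNReal.one_ne_top hx1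
  have hpow : (x ^ q.1.2)⁻¹ ≤ (x ^ m)⁻¹ :=
    ENNReal.inv_le_inv.2 (pow_le_pow_right_of_le_one' hx1 (idx_snd_le q))
  refine le_trans ?_ (mul_le_mul_left hpow _)
  rw [evalTX_ser, evalTX_ser, ← ENNReal.tsum_mul_left]
  refine ENNReal.tsum_le_tsum fun k => ?_
  rw [← ENNReal.tsum_mul_left]
  calc ∑' l, shiftCoeff v q k l * (t ^ k * x ^ l)
      = ∑' l, (x ^ q.1.2)⁻¹ * (v k (l + q.1.2) * (t ^ k * x ^ (l + q.1.2))) := by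
        refine tsum_congr fun l => ?_
        have : (x ^ q.1.2)⁻¹ * x ^ q.1.2 = 1 :=
          ENNReal.inv_mul_cancel (pow_ne_zero _ hx0) (ENNReal.pow_ne_top hxt)
        calc shiftCoeff v q k l * (t ^ k * x ^ l)
            = ((x ^ q.1.2)⁻¹ * x ^ q.1.2) * (v k (l + q.1.2) * (t ^ k * x ^ l)) := by
              rw [this, one_mul, shiftCoeff]
          _ = _ := by rw [pow_add]; ring
    _ ≤ _ := ENNReal.tsum_comp_le_tsum_of_injective (add_left_injective q.1.2)
        (fun l => (x ^ q.1.2)⁻¹ * (v k l * (t ^ k * x ^ l)))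

/-- The sum over all monomials of degree at least two is of second order. -/
lemma tsum_monomials_le {b ε x : ℝ≥0∞} (hx : b * x ≤ 2⁻¹) (hε : 2 * (b * ε) ≤ 1)
    {t : ℝ≥0∞} (ht : t ≤ ε) {y : Idx m → ℝ≥0∞} (hy : ∀ q, y q ≤ ε) :
    ∑' d : Var m →₀ ℕ, (if 2 ≤ tzDegree d then
      b ^ (∑ v, d v) * (t ^ d Var.t * x ^ d Var.x * ∏ q, y q ^ d (Var.z q)) else 0) ≤
      (2 * (b * ε)) ^ 2 * 2 ^ Fintype.card (Var m) := by
  refine le_trans ?_ (mul_le_mul_right (tsum_prod_pow_le (ι := Var m) (tsum_pow_le_two le_rfl)) _)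
  rw [← ENNReal.tsum_mul_left]
  refine ENNReal.tsum_le_tsum fun d => ?_
  split_ifs with hd
  · have hprod : ∀ f : Var m → ℝ≥0∞, ∏ v, f v ^ d v =
        f Var.t ^ d Var.t * f Var.x ^ d Var.x * ∏ q, f (Var.z q) ^ d (Var.z q) := by
      intro f
      rw [Fintype.prod_sum_type, Fin.prod_univ_two]
    have e1 : b ^ (∑ v, d v) * (t ^ d Var.t * x ^ d Var.x * ∏ q, y q ^ d (Var.z q)) =
        (b * t) ^ d Var.t * (b * x) ^ d Var.x * ∏ q, (b * y q) ^ d (Var.z q) := by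
      have := hprod fun _ => b
      rw [Finset.prod_pow_eq_pow_sum] at this
      rw [this]
      simp only [mul_pow, Finset.prod_mul_distrib]
      ring
    have e2 : (∏ v, (2⁻¹ : ℝ≥0∞) ^ d v) = 2⁻¹ ^ tzDegree d * 2⁻¹ ^ d Var.x := by
      rw [hprod fun _ => 2⁻¹, Finset.prod_pow_eq_pow_sum, tzDegree, pow_add]
      ring
    rw [e1, e2]
    calc (b * t) ^ d Var.t * (b * x) ^ d Var.x * ∏ q, (b * y q) ^ d (Var.z q)
        ≤ (b * ε) ^ d Var.t * 2⁻¹ ^ d Var.x * ∏ q : Idx m, (b * ε) ^ d (Var.z q) := by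
          gcongr with q
          exact hy q
      _ = (b * ε) ^ tzDegree d * 2⁻¹ ^ d Var.x := by
          rw [Finset.prod_pow_eq_pow_sum, tzDegree, pow_add]; ring
      _ = (2 * (b * ε)) ^ tzDegree d * 2⁻¹ ^ tzDegree d * 2⁻¹ ^ d Var.x := by
          rw [← mul_pow, mul_right_comm, ENNReal.mul_inv_cancel (by simp) (by simp), one_mul]
      -- As 2bε ≤ 1, degree at least two leaves its square; the powers of 1/2 split off before keep
      -- the sum over all monomials finite.
      _ ≤ (2 * (b * ε)) ^ 2 * 2⁻¹ ^ tzDegree d * 2⁻¹ ^ d Var.x := by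
          gcongr ?_ * _ * _
          exact pow_le_pow_right_of_le_one' hε hd
      _ = _ := by ring
  · exact zero_le

/-- The majorant equation: finite sums over `k` stay bounded. -/
lemma sum_le_of_majorant {a b : ℝ≥0} {v : ℕ → ℕ → ℝ≥0∞} (hv0 : ∀ l, v 0 l = 0)
    (hvt : ∀ k l, v k l ≠ ⊤)
    (hv : ∀ k, 1 ≤ k → ∀ l, v k l ≤ (if k = 1 then (a : ℝ≥0∞) * b ^ l else 0) +
      (∑ h ∈ Finset.range l, ((a : ℝ≥0∞) * b ^ (h + 1)) * v k (l - (h + 1)) +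
      nonlin (fun d : Var m →₀ ℕ => (a : ℝ≥0∞) * b ^ ∑ v, d v) (shiftCoeff v) k l))
    {t x η : ℝ≥0∞} (hx0 : x ≠ 0) (hx1 : x ≤ 1) (hbx : b * x ≤ 2⁻¹)
    (hlin : ∑' h : ℕ, ((a : ℝ≥0∞) * b ^ (h + 1)) * x ^ (h + 1) ≤ 2⁻¹) (ht : t ≤ (x ^ m)⁻¹ * η)
    (hsmall : 2 * (b * ((x ^ m)⁻¹ * η)) ≤ 1)
    (hη : 2 * (2 * a * t + a * ((2 * (b * ((x ^ m)⁻¹ * η))) ^ 2 * 2 ^ Fintype.card (Var m))) ≤ η)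
    (n : ℕ) : evalTX t x (ser (cutoff v n)) ≤ η := by
  have hxt : x ≠ ⊤ := ne_top_of_le_ne_top ENNReal.one_ne_top hx1
  set P : ℕ → ℝ≥0∞ := fun k => ∑' l, nonlin (fun d : Var m →₀ ℕ => (a : ℝ≥0∞) * b ^ ∑ v, d v)
    (shiftCoeff v) k l * x ^ l with hP
  -- each order in `t` separately
  have hlevel : ∀ k, 1 ≤ k → ∑' l, v k l * x ^ l ≤ 2 * ((if k = 1 then 2 * (a : ℝ≥0∞) else 0) + P k) := by
    intro k hk
    -- The linear terms couple l with smaller l at the same k. For finite partial sums in l they are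
    -- absorbed into the left side with factor 1/2.
    rw [ENNReal.tsum_eq_iSup_nat]
    refine iSup_le fun N => ?_
    refine le_two_mul_of_le_half_add ?_ ?_
    · exact ENNReal.sum_ne_top.2 fun l _ => ENNReal.mul_ne_top (hvt k l) (ENNReal.pow_ne_top hxt)
    · calc ∑ l ∈ Finset.range N, v k l * x ^ l
          ≤ ∑ l ∈ Finset.range N, ((if k = 1 then (a : ℝ≥0∞) * b ^ l else 0) * x ^ l +
            (∑ h ∈ Finset.range l, (((a : ℝ≥0∞) * b ^ (h + 1)) * x ^ (h + 1)) *
              (v k (l - (h + 1)) * x ^ (l - (h + 1))) +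
            nonlin (fun d : Var m →₀ ℕ => (a : ℝ≥0∞) * b ^ ∑ v, d v) (shiftCoeff v) k l *
              x ^ l)) := by
            refine Finset.sum_le_sum fun l _ => ?_
            refine (mul_le_mul_left (hv k hk l) _).trans (le_of_eq ?_)
            rw [add_mul, add_mul, Finset.sum_mul]
            congr 2
            refine Finset.sum_congr rfl fun h hh => ?_
            rw [Finset.mem_range] at hh
            have : x ^ l = x ^ (h + 1) * x ^ (l - (h + 1)) := by
              rw [← pow_add]; congr 1; omega
            rw [this]; ring
        _ = ∑ l ∈ Finset.range N, (if k = 1 then (a : ℝ≥0∞) * b ^ l else 0) * x ^ l +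
            (∑ l ∈ Finset.range N, ∑ h ∈ Finset.range l,
              (((a : ℝ≥0∞) * b ^ (h + 1)) * x ^ (h + 1)) *
              (v k (l - (h + 1)) * x ^ (l - (h + 1))) +
            ∑ l ∈ Finset.range N, nonlin (fun d : Var m →₀ ℕ => (a : ℝ≥0∞) * b ^ ∑ v, d v)
              (shiftCoeff v) k l * x ^ l) := by
            rw [Finset.sum_add_distrib, Finset.sum_add_distrib]
        _ ≤ (if k = 1 then 2 * (a : ℝ≥0∞) else 0) +
            (2⁻¹ * ∑ l ∈ Finset.range N, v k l * x ^ l + P k) := by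
            gcongr
            · split_ifs
              · calc ∑ l ∈ Finset.range N, (a : ℝ≥0∞) * b ^ l * x ^ l
                    = a * ∑ l ∈ Finset.range N, ((b : ℝ≥0∞) * x) ^ l := by
                      rw [Finset.mul_sum]
                      exact Finset.sum_congr rfl fun l _ => by rw [mul_pow]; ring
                  _ ≤ a * 2 := by
                      gcongr
                      exact (ENNReal.sum_le_tsum _).trans (tsum_pow_le_two hbx)
                  _ = _ := mul_comm _ _
              · simp
            · exact (sum_sum_sub_le (fun h => ((a : ℝ≥0∞) * b ^ (h + 1)) * x ^ (h + 1))
                (fun l => v k l * x ^ l) N).trans (mul_le_mul_left hlin _)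
            · exact ENNReal.sum_le_tsum _
        _ = _ := by ring
  have hev : ∀ n, evalTX t x (ser (cutoff v n)) =
      ∑ k ∈ Finset.range (n + 1), t ^ k * ∑' l, v k l * x ^ l := by
    intro n
    rw [evalTX_ser, tsum_eq_sum (s := Finset.range (n + 1))]
    · refine Finset.sum_congr rfl fun k hk => ?_
      rw [← ENNReal.tsum_mul_left]
      refine tsum_congr fun l => ?_
      rw [cutoff, if_pos (Nat.lt_succ_iff.1 (Finset.mem_range.1 hk))]
      ring
    · intro k hk
      rw [Finset.mem_range, not_lt] at hk
      simp [cutoff, show ¬ k ≤ n by omega]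
  -- Orders up to n + 1 in t see the nonlinear part only through orders up to n, so the bound η
  -- reproduces itself.
  induction n with
  | zero =>
    rw [hev]
    simp [hv0]
  | succ n ih =>
    have hcut0 : ∀ (q : Idx m) (l : ℕ), shiftCoeff (cutoff v n) q 0 l = 0 := fun q l => by
      simp [shiftCoeff, cutoff, hv0]
    have hsh0 : ∀ (q : Idx m) (l : ℕ), shiftCoeff v q 0 l = 0 := fun q l => by
      simp [shiftCoeff, hv0]
    have hPcut : ∑ k ∈ Finset.range (n + 2), t ^ k * P k ≤
        a * ((2 * (b * ((x ^ m)⁻¹ * η))) ^ 2 * 2 ^ Fintype.card (Var m)) := by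
      calc ∑ k ∈ Finset.range (n + 2), t ^ k * P k
          ≤ ∑ k ∈ Finset.range (n + 2), ∑' l, ∑' d : Var m →₀ ℕ,
            (if 2 ≤ tzDegree d then (a : ℝ≥0∞) * b ^ (∑ v, d v) *
              (monCoeff (shiftCoeff (cutoff v n)) d k l * (t ^ k * x ^ l)) else 0) := by
            refine Finset.sum_le_sum fun k hk => ?_
            rw [Finset.mem_range] at hk
            rw [hP, ← ENNReal.tsum_mul_left]
            refine ENNReal.tsum_le_tsum fun l => ?_
            unfold nonlin
            rw [Finset.sum_mul, Finset.mul_sum, Finset.sum_filter]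
            refine le_trans (Finset.sum_le_sum fun d _ => ?_) (ENNReal.sum_le_tsum _)
            split_ifs with hd
            · rw [monCoeff_congr hsh0 hcut0 hd (fun q k' hk' l' => by
                simp only [shiftCoeff, cutoff]
                rw [if_pos (by omega)])]
              exact le_of_eq (by ring)
            · exact le_rfl
        _ ≤ ∑' k, ∑' l, ∑' d : Var m →₀ ℕ,
            (if 2 ≤ tzDegree d then (a : ℝ≥0∞) * b ^ (∑ v, d v) *
              (monCoeff (shiftCoeff (cutoff v n)) d k l * (t ^ k * x ^ l)) else 0) :=
            ENNReal.sum_le_tsum _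
        _ = ∑' d : Var m →₀ ℕ, ∑' k, ∑' l,
            (if 2 ≤ tzDegree d then (a : ℝ≥0∞) * b ^ (∑ v, d v) *
              (monCoeff (shiftCoeff (cutoff v n)) d k l * (t ^ k * x ^ l)) else 0) := by
            rw [ENNReal.tsum_comm (α := Var m →₀ ℕ)]
            exact tsum_congr fun k => ENNReal.tsum_comm
        _ = ∑' d : Var m →₀ ℕ, (a : ℝ≥0∞) * (if 2 ≤ tzDegree d then b ^ (∑ v, d v) *
              (t ^ d Var.t * x ^ d Var.x *
                ∏ q, evalTX t x (ser (shiftCoeff (cutoff v n) q)) ^ d (Var.z q)) else 0) := by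
            refine tsum_congr fun d => ?_
            split_ifs with hd
            · simp_rw [ENNReal.tsum_mul_left]
              rw [← evalTX_jetMonomial, evalTX_eq_tsum]
              simp only [monCoeff]
              ring
            · simp
        _ ≤ _ := by
            rw [ENNReal.tsum_mul_left]
            gcongr
            refine tsum_monomials_le hbx hsmall ht fun q => ?_
            exact (evalTX_shiftCoeff_le _ q hx0 hx1).trans (by gcongr)
    rw [hev]
    calc ∑ k ∈ Finset.range (n + 1 + 1), t ^ k * ∑' l, v k l * x ^ l
        ≤ ∑ k ∈ Finset.range (n + 2), (2 * (t ^ k * (if k = 1 then 2 * (a : ℝ≥0∞) else 0)) +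
            2 * (t ^ k * P k)) := by
          refine Finset.sum_le_sum fun k _ => ?_
          rcases Nat.eq_zero_or_pos k with rfl | hk
          · simp [hv0]
          · refine (mul_le_mul_right (hlevel k hk) _).trans (le_of_eq ?_)
            ring
      _ = 2 * (t ^ 1 * (2 * (a : ℝ≥0∞))) + 2 * ∑ k ∈ Finset.range (n + 2), t ^ k * P k := by
          rw [Finset.sum_add_distrib, ← Finset.mul_sum, ← Finset.mul_sum]
          congr 2
          rw [Finset.sum_eq_single 1]
          · simp
          · intro k _ hk; simp [hk]
          · intro h; exact absurd (Finset.mem_range.2 (by omega)) h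
      _ ≤ 2 * (t ^ 1 * (2 * (a : ℝ≥0∞))) + 2 *
          (a * ((2 * (b * ((x ^ m)⁻¹ * η))) ^ 2 * 2 ^ Fintype.card (Var m))) := by gcongr
      _ = 2 * (2 * a * t + a * ((2 * (b * ((x ^ m)⁻¹ * η))) ^ 2 * 2 ^ Fintype.card (Var m))) := by
          ring
      _ ≤ η := hη

/-- Solutions of the majorant equation grow at most geometrically. -/
lemma exists_bound_of_majorant {a b : ℝ≥0} (ha : 1 ≤ a) (hb : 1 ≤ b) {v : ℕ → ℕ → ℝ≥0∞}
    (hv0 : ∀ l, v 0 l = 0) (hvt : ∀ k l, v k l ≠ ⊤)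
    (hv : ∀ k, 1 ≤ k → ∀ l, v k l ≤ (if k = 1 then (a : ℝ≥0∞) * b ^ l else 0) +
      (∑ h ∈ Finset.range l, ((a : ℝ≥0∞) * b ^ (h + 1)) * v k (l - (h + 1)) +
      nonlin (fun d : Var m →₀ ℕ => (a : ℝ≥0∞) * b ^ ∑ v, d v) (shiftCoeff v) k l)) :
    ∃ D : ℝ≥0, 1 ≤ D ∧ ∀ k l, v k l ≤ (D : ℝ≥0∞) ^ (k + l + 1) := by
  have ha0 : 0 < a := zero_lt_one.trans_le ha
  have hb0 : 0 < b := zero_lt_one.trans_le hb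
  -- x brings the linear coupling down to 1/2; then η is chosen so that the quadratic part
  -- contributes η / 2, and t so that the source contributes the other η / 2.
  set x : ℝ≥0 := (4 * a * b)⁻¹ with hx
  have hx0 : 0 < x := by positivity
  have hab : 1 ≤ a * b := one_le_mul_of_one_le_of_one_le ha hb
  have hx1 : x ≤ 1 := inv_le_one_of_one_le₀ (by nlinarith)
  set X : ℝ≥0 := (x ^ m)⁻¹ with hX
  have hX1 : 1 ≤ X := (one_le_inv₀ (by positivity)).2 (pow_le_one₀ hx0.le hx1)
  have hX0 : 0 < X := zero_lt_one.trans_le hX1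
  set K : ℝ≥0 := 2 ^ Fintype.card (Var m) with hK
  have hK1 : 1 ≤ K := one_le_pow₀ (by norm_num)
  have hK0 : 0 < K := zero_lt_one.trans_le hK1
  set η : ℝ≥0 := (16 * a * b ^ 2 * X ^ 2 * K)⁻¹ with hη
  have hη0 : 0 < η := by positivity
  set t : ℝ≥0 := η / (8 * a) with ht
  have ht0 : 0 < t := by positivity
  have hXc : ((x : ℝ≥0∞) ^ m)⁻¹ = X := by
    rw [hX, ENNReal.coe_inv (r := x ^ m) (by positivity), ENNReal.coe_pow]
  have hKc : (2 : ℝ≥0∞) ^ Fintype.card (Var m) = K := by rw [hK, ENNReal.coe_pow]; rfl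
  have hbx : b * x = (4 * a)⁻¹ := by rw [hx]; field_simp
  have hmain := sum_le_of_majorant (m := m) hv0 hvt hv (t := t) (x := x) (η := η)
    (by exact_mod_cast hx0.ne') (by exact_mod_cast hx1) (by
      rw [← ENNReal.coe_mul, hbx, show (2⁻¹ : ℝ≥0∞) = ((2⁻¹ : ℝ≥0) : ℝ≥0∞) by simp,
        ENNReal.coe_le_coe]
      exact inv_anti₀ (by norm_num) (by nlinarith)) (by
      calc ∑' h : ℕ, ((a : ℝ≥0∞) * b ^ (h + 1)) * x ^ (h + 1)
          = ∑' h : ℕ, ((a * (b * x) : ℝ≥0) : ℝ≥0∞) * ((b * x : ℝ≥0) : ℝ≥0∞) ^ h := by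
            refine tsum_congr fun h => ?_
            push_cast
            rw [mul_pow, pow_succ, pow_succ]; ring
        _ ≤ ((a * (b * x) : ℝ≥0) : ℝ≥0∞) * 2 := by
            rw [ENNReal.tsum_mul_left]
            gcongr
            refine tsum_pow_le_two ?_
            rw [hbx, show (2⁻¹ : ℝ≥0∞) = ((2⁻¹ : ℝ≥0) : ℝ≥0∞) by simp, ENNReal.coe_le_coe]
            exact inv_anti₀ (by norm_num) (by nlinarith)
        _ = ((2⁻¹ : ℝ≥0) : ℝ≥0∞) := by
            rw [show (2 : ℝ≥0∞) = ((2 : ℝ≥0) : ℝ≥0∞) by simp, ← ENNReal.coe_mul, hbx]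
            congr 1
            field_simp
            norm_num
        _ ≤ 2⁻¹ := by simp) (by
      rw [hXc]
      have : t ≤ X * η := by
        calc t ≤ η := by
              rw [ht]; exact div_le_self hη0.le (by nlinarith)
          _ ≤ X * η := le_mul_of_one_le_left hη0.le hX1
      exact_mod_cast this) (by
      rw [hXc]
      have : 2 * (b * (X * η)) ≤ 1 := by
        rw [hη]
        have : 2 * (b * (X * (16 * a * b ^ 2 * X ^ 2 * K)⁻¹)) = (8 * ((a * b) * (X * K)))⁻¹ := by
          field_simp; norm_num
        rw [this]
        refine inv_le_one_of_one_le₀ ?_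
        have h1 : 1 ≤ X * K := one_le_mul_of_one_le_of_one_le hX1 hK1
        have h2 : 1 ≤ (a * b) * (X * K) := one_le_mul_of_one_le_of_one_le hab h1
        nlinarith
      exact_mod_cast this) (by
      rw [hXc, hKc]
      have : 2 * (2 * a * t + a * ((2 * (b * (X * η))) ^ 2 * K)) ≤ η := by
        refine le_of_eq ?_
        have e1 : 2 * (2 * a * t) = η / 2 := by rw [ht]; field_simp; norm_num
        have e2 : 2 * (a * ((2 * (b * (X * η))) ^ 2 * K)) = η / 2 := by
          have : 2 * (a * ((2 * (b * (X * η))) ^ 2 * K)) =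
              η * ((16 * a * b ^ 2 * X ^ 2 * K) * η) / 2 := by field_simp; norm_num
          rw [this, hη, mul_inv_cancel₀ (by positivity), mul_one]
        rw [mul_add, e1, e2, add_halves]
      exact_mod_cast this)
  refine ⟨1 + η + t⁻¹ + x⁻¹, by rw [add_assoc, add_assoc]; exact le_self_add, fun k l => ?_⟩
  set D : ℝ≥0 := 1 + η + t⁻¹ + x⁻¹ with hD
  have h1 : v k l * ((t : ℝ≥0∞) ^ k * x ^ l) ≤ η := by
    refine le_trans ?_ (hmain k)
    rw [evalTX_ser]
    refine le_trans ?_ (ENNReal.le_tsum k)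
    refine le_trans ?_ (ENNReal.le_tsum l)
    rw [cutoff, if_pos le_rfl]
  lift v k l to ℝ≥0 using hvt k l with w hw
  have h2 : w * (t ^ k * x ^ l) ≤ η := by exact_mod_cast h1
  have hDt : t⁻¹ ≤ D := by rw [hD, add_assoc, add_comm]; exact le_trans le_self_add le_self_add
  have hDx : x⁻¹ ≤ D := by rw [hD]; exact le_add_self
  have hDη : η ≤ D := by
    rw [hD, add_assoc, add_right_comm, add_comm]; exact le_self_add
  have h3 : w ≤ η * ((t⁻¹) ^ k * (x⁻¹) ^ l) := by
    calc w = w * (t ^ k * x ^ l) * ((t⁻¹) ^ k * (x⁻¹) ^ l) := by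
          rw [mul_assoc, mul_mul_mul_comm, ← mul_pow, ← mul_pow, mul_inv_cancel₀ ht0.ne',
            mul_inv_cancel₀ hx0.ne', one_pow, one_pow, mul_one, mul_one]
      _ ≤ _ := by gcongr
  have h4 : w ≤ D ^ (k + l + 1) := by
    calc w ≤ η * ((t⁻¹) ^ k * (x⁻¹) ^ l) := h3
      _ ≤ D * (D ^ k * D ^ l) := by gcongr
      _ = D ^ (k + l + 1) := by ring
  exact_mod_cast h4

end Majorant

end TotChar

end

noncomputable section

namespace TotChar

open scoped ENNReal NNReal

variable {m : ℕ}

/-! ### Nonnegativity of the solution -/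

section Positivity

lemma monCoeff_nonneg {Z : Idx m → ℕ → ℕ → ℝ} {d : Var m →₀ ℕ} (hd : 2 ≤ tzDegree d) {k l : ℕ}
    (hZ0 : ∀ q l, Z q 0 l = 0) (hZ : ∀ q, ∀ k' < k, ∀ l, 0 ≤ Z q k' l) : 0 ≤ monCoeff Z d k l := by
  rw [monCoeff_eq_sum]
  refine Finset.sum_nonneg fun f hf => ?_
  by_cases hpos : ∀ r, f r 0 ≠ 0
  · exact Finset.prod_nonneg fun r _ => hZ _ _ (lt_of_mem_splits hd hf hpos r) _
  · push Not at hpos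
    obtain ⟨r, hr⟩ := hpos
    rw [Finset.prod_eq_zero (Finset.mem_univ r) (by rw [hr, hZ0])]

lemma zCoeff_nonneg {U : ℕ → ℕ → ℝ} {k : ℕ} (hU : ∀ l, 0 ≤ U k l) (q : Idx m) (l : ℕ) :
    0 ≤ zCoeff U q k l :=
  mul_nonneg (by positivity) (hU _)

variable {G : (Var m →₀ ℕ) → ℝ} {U : ℕ → ℕ → ℝ}

/-- The coefficients of the formal solution are nonnegative. -/
lemma IsRecSol.nonneg (hG : PosData G) (hU : IsRecSol G U) (k l : ℕ) : 0 ≤ U k l := by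
  induction k using Nat.strong_induction_on generalizing l with
  | _ k ihk =>
    induction l using Nat.strong_induction_on with
    | _ l ihl =>
      rcases Nat.eq_zero_or_pos k with rfl | hk
      · exact (hU.1 l).ge
      · have h := hU.2 k hk l
        have hL := charFun_pos hG hk l
        refine nonneg_of_mul_nonneg_right (b := U k l) ?_ hL
        rw [h]
        have h1 : 0 ≤ if k = 1 then aFun G l else 0 := by
          split_ifs
          · exact hG.a_nonneg l
          · exact le_rfl
        have h2 : 0 ≤ linPart G U k l := by
          refine Finset.sum_nonneg fun q _ => Finset.sum_nonneg fun h hh => ?_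
          rw [Finset.mem_range] at hh
          exact mul_nonneg (hG.c_nonneg q h) (mul_nonneg (by positivity) (ihl _ (by omega)))
        have h3 : 0 ≤ nonlin G (zCoeff U) k l := by
          refine Finset.sum_nonneg fun d hd => ?_
          have hd2 := (Finset.mem_filter.1 hd).2
          exact mul_nonneg (hG.nonneg d hd2) (monCoeff_nonneg hd2 (zCoeff_zero hU.1)
            fun q k' hk' l' => zCoeff_nonneg (fun l => ihk k' hk' l) q l')
        linarith

end Positivity

/-! ### Comparison of jets and weights -/

section Upper

/-- (n + h)^h and (n + h)! / n! agree up to a geometric factor; the inductive step is (1 + 1/(n +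
h))^h ≤ e. -/
lemma pow_mul_factorial_le (n h : ℕ) :
    ((n + h : ℕ) : ℝ) ^ h * n ! ≤ Real.exp 1 ^ h * (n + h)! := by
  induction h with
  | zero => simp
  | succ h ih =>
    have key : ((n + (h + 1) : ℕ) : ℝ) ^ h ≤ Real.exp 1 * ((n + h : ℕ) : ℝ) ^ h := by
      rcases Nat.eq_zero_or_pos h with rfl | hh
      · simp
      · have hx : (0 : ℝ) < ((n + h : ℕ) : ℝ) := by exact_mod_cast (by omega)
        have h1 : ((n + (h + 1) : ℕ) : ℝ) ≤ ((n + h : ℕ) : ℝ) * Real.exp (1 / ((n + h : ℕ) : ℝ)) := by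
          have := Real.add_one_le_exp (1 / ((n + h : ℕ) : ℝ))
          calc ((n + (h + 1) : ℕ) : ℝ) = ((n + h : ℕ) : ℝ) * (1 / ((n + h : ℕ) : ℝ) + 1) := by
                rw [mul_add, mul_one_div_cancel hx.ne']; push_cast; ring
            _ ≤ _ := by gcongr
        calc ((n + (h + 1) : ℕ) : ℝ) ^ h ≤ (((n + h : ℕ) : ℝ) * Real.exp (1 / ((n + h : ℕ) : ℝ))) ^ h := by
              gcongr
          _ = ((n + h : ℕ) : ℝ) ^ h * Real.exp (h * (1 / ((n + h : ℕ) : ℝ))) := by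
              rw [mul_pow, Real.exp_nat_mul]
          _ ≤ ((n + h : ℕ) : ℝ) ^ h * Real.exp 1 := by
              gcongr
              rw [mul_one_div, div_le_one hx]
              exact_mod_cast Nat.le_add_left h n
          _ = _ := mul_comm _ _
    rw [← add_assoc, Nat.factorial_succ]
    calc ((n + h + 1 : ℕ) : ℝ) ^ (h + 1) * n !
        = ((n + (h + 1) : ℕ) : ℝ) ^ h * (((n + h + 1 : ℕ) : ℝ) * n !) := by
          rw [pow_succ, add_assoc]; ring
      _ ≤ Real.exp 1 * ((n + h : ℕ) : ℝ) ^ h * (((n + h + 1 : ℕ) : ℝ) * n !) := by gcongr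
      _ = Real.exp 1 * ((n + h + 1 : ℕ) : ℝ) * (((n + h : ℕ) : ℝ) ^ h * n !) := by ring
      _ ≤ Real.exp 1 * ((n + h + 1 : ℕ) : ℝ) * (Real.exp 1 ^ h * (n + h)!) := by gcongr
      _ = _ := by push_cast; ring

/-- This pays for the factor l^(h(σ-1)) of `exists_mul_pow_le`: lowering l by h frees (l! / (l -
h)!)^(σ-1), which is comparable to it by `pow_mul_factorial_le`. -/
lemma rpow_mul_weight_le (M N : ℕ) (s : ℝ) {σ : ℝ} (hσ : 1 ≤ σ) {k l h : ℕ} (hk : 1 ≤ k)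
    (hh : h ≤ l) :
    (l : ℝ) ^ ((h : ℝ) * (σ - 1)) * weight M N s σ k (l - h) ≤
      Real.exp (σ - 1) ^ h * weight M N s σ k l := by
  obtain ⟨n, rfl⟩ := Nat.exists_eq_add_of_le' hh
  rw [Nat.add_sub_cancel]
  have hτ : 0 ≤ σ - 1 := by linarith
  have h1 : ((n + h : ℕ) : ℝ) ^ ((h : ℝ) * (σ - 1)) * (n ! : ℝ) ^ (σ - 1) ≤
      Real.exp (σ - 1) ^ h * ((n + h)! : ℝ) ^ (σ - 1) := by
    rw [Real.rpow_mul (by positivity), Real.rpow_natCast,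
      ← Real.mul_rpow (by positivity) (by positivity)]
    have e : Real.exp (σ - 1) ^ h = (Real.exp 1 ^ h) ^ (σ - 1) := by
      rw [← Real.exp_nat_mul, ← Real.exp_nat_mul, mul_one, ← Real.exp_mul]
    rw [e, ← Real.mul_rpow (by positivity) (by positivity)]
    exact Real.rpow_le_rpow (by positivity) (pow_mul_factorial_le n h) hτ
  have h2 : ((M * (k - 1) + n).choose n : ℝ) ≤ ((M * (k - 1) + (n + h)).choose (n + h) : ℝ) := by
    exact_mod_cast choose_add_mono le_rfl (by omega)
  unfold weight
  calc _ = (k ! : ℝ) ^ (s - 1) / (k : ℝ) ^ N * ((((n + h : ℕ) : ℝ) ^ ((h : ℝ) * (σ - 1)) *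
        (n ! : ℝ) ^ (σ - 1)) * ((M * (k - 1) + n).choose n : ℝ)) := by ring
    _ ≤ (k ! : ℝ) ^ (s - 1) / (k : ℝ) ^ N * ((Real.exp (σ - 1) ^ h * ((n + h)! : ℝ) ^ (σ - 1)) *
        ((M * (k - 1) + (n + h)).choose (n + h) : ℝ)) := by gcongr
    _ = _ := by ring

lemma one_le_weight_one (M N : ℕ) (s : ℝ) {σ : ℝ} (hσ : 1 ≤ σ) (l : ℕ) :
    1 ≤ weight M N s σ 1 l := by
  have : (1 : ℝ) ≤ (l ! : ℝ) ^ (σ - 1) :=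
    Real.one_le_rpow (by exact_mod_cast Nat.factorial_pos l) (by linarith)
  simpa [weight] using this

lemma sum_expo_zero_single (q : Idx m) (h : ℕ) :
    ∑ v, expo 0 h (Finsupp.single q 1) v = h + 1 := by
  rw [Fintype.sum_sum_type, Fin.sum_univ_two]
  have h1 : ∑ x : Idx m, expo 0 h (Finsupp.single q 1) (Sum.inr x) = 1 := by
    have : ∀ x : Idx m, expo 0 h (Finsupp.single q 1) (Sum.inr x) = Finsupp.single q 1 x :=
      fun x => expo_z _ _ _ _
    simp_rw [this]
    rw [Finset.sum_eq_single q]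
    · simp
    · intro b _ hne; rw [Finsupp.single_eq_of_ne hne]
    · simp
  rw [h1]
  have h2 := expo_t 0 h (Finsupp.single q 1)
  have h3 := expo_x 0 h (Finsupp.single q 1)
  simp only [Var.t, Var.x] at h2 h3
  omega

lemma sum_expo_one_zero (l : ℕ) : ∑ v, expo (m := m) 1 l 0 v = l + 1 := by
  rw [Fintype.sum_sum_type, Fin.sum_univ_two]
  have h1 : ∑ x : Idx m, expo (m := m) 1 l 0 (Sum.inr x) = 0 :=
    Finset.sum_eq_zero fun x _ => by
      rw [show (Sum.inr x : Var m) = Var.z x from rfl, expo_z]; simp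
  rw [h1]
  have h2 := expo_t (m := m) 1 l 0
  have h3 := expo_x (m := m) 1 l 0
  simp only [Var.t, Var.x] at h2 h3
  omega

lemma tzDegree_le_sum (d : Var m →₀ ℕ) : tzDegree d ≤ ∑ v, d v := by
  rw [Fintype.sum_sum_type, Fin.sum_univ_two, tzDegree]
  simp only [Var.t, Var.z]
  omega

variable {G : (Var m →₀ ℕ) → ℝ} {U : ℕ → ℕ → ℝ} {F : (Var m → ℂ) → ℂ}

/-- The argument is termwise in the splittings: each factor of the jet is a differentiated weight
times a shifted quotient, so one bound for all products of weights passes to the coefficient. -/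
lemma monCoeff_zCoeff_le {M N : ℕ} {s σ C : ℝ} (hU0 : ∀ l, U 0 l = 0) (hU : ∀ k l, 0 ≤ U k l)
    {d : Var m →₀ ℕ} {k l : ℕ}
    (hprod : ∀ f ∈ splits d k l, (∀ r, 1 ≤ f r 0) →
      ∏ r : Factor d, ((f r 0 : ℝ) ^ r.1.1.1 *
        ((f r 1 + r.1.1.2).descFactorial r.1.1.2 : ℝ) *
        weight M N s σ (f r 0) (f r 1 + r.1.1.2)) ≤ C) :
    monCoeff (zCoeff U) d k l ≤
      C * monCoeff (shiftCoeff fun k l => U k l / weight M N s σ k l) d k l := by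
  rw [monCoeff_eq_sum, monCoeff_eq_sum, Finset.mul_sum]
  refine Finset.sum_le_sum fun f hf => ?_
  by_cases hpos : ∀ r, 1 ≤ f r 0
  · have h1 : ∏ r, zCoeff U r.1 (f r 0) (f r 1) = (∏ r : Factor d, ((f r 0 : ℝ) ^ r.1.1.1 *
        ((f r 1 + r.1.1.2).descFactorial r.1.1.2 : ℝ) *
        weight M N s σ (f r 0) (f r 1 + r.1.1.2))) *
        ∏ r, shiftCoeff (fun k l => U k l / weight M N s σ k l) r.1 (f r 0) (f r 1) := by
      rw [← Finset.prod_mul_distrib]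
      refine Finset.prod_congr rfl fun r _ => ?_
      have := (weight_pos M N s σ (hpos r) (f r 1 + r.1.1.2)).ne'
      rw [zCoeff, shiftCoeff]
      field_simp
    rw [h1]
    refine mul_le_mul_of_nonneg_right (hprod f hf hpos) (Finset.prod_nonneg fun r _ => ?_)
    exact div_nonneg (hU _ _) (weight_pos M N s σ (hpos r) _).le
  · push Not at hpos
    obtain ⟨r, hr⟩ := hpos
    have hr : f r 0 = 0 := by omega
    rw [Finset.prod_eq_zero (Finset.mem_univ r) (by rw [hr, zCoeff_zero hU0]),
      Finset.prod_eq_zero (Finset.mem_univ r) (by rw [hr, shiftCoeff, hU0, zero_div]), mul_zero]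

lemma nonlin_map {R S : Type*} [CommSemiring R] [CommSemiring S] (g : R →+* S)
    (G : (Var m →₀ ℕ) → R) (Z : Idx m → ℕ → ℕ → R) (k l : ℕ) :
    g (nonlin G Z k l) = nonlin (fun d => g (G d)) (fun q k l => g (Z q k l)) k l := by
  simp [nonlin, map_monCoeff]

end Upper

end TotChar

end

noncomputable section

namespace TotChar

open scoped ENNReal NNReal

variable {m : ℕ} {G : (Var m →₀ ℕ) → ℝ} {U : ℕ → ℕ → ℝ} {F : (Var m → ℂ) → ℂ}

/-! ### The Gevrey upper bound -/

section UpperBound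

/-- After division by the weights the recursion formula becomes a majorant equation. -/
lemma exists_majorant (hG : PosData G)
    (hF : ∀ d, MvPowerSeries.coeff d (taylor F) = (G d : ℂ)) (hU : IsRecSol G U) :
    ∃ (M N : ℕ) (a b : ℝ), 1 ≤ a ∧ 1 ≤ b ∧ ∀ k, 1 ≤ k → ∀ l,
      U k l / weight M N (gevreyIndex F) (irregularity F) k l ≤
      (if k = 1 then a * b ^ l else 0) +
      (∑ h ∈ Finset.range l, (a * b ^ (h + 1)) *
        (U k (l - (h + 1)) / weight M N (gevreyIndex F) (irregularity F) k (l - (h + 1))) +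
      nonlin (fun d : Var m →₀ ℕ => a * b ^ ∑ v, d v)
        (shiftCoeff fun k l => U k l / weight M N (gevreyIndex F) (irregularity F) k l) k l) := by
  set s := gevreyIndex F with hs
  set σ := irregularity F with hσ
  have hs1 : 1 ≤ s := one_le_gevreyIndex F
  have hσ1 : 1 ≤ σ := one_le_irregularity F
  obtain ⟨M, N, C, hC, hprod⟩ := exists_prod_weight_le m s σ hs1 hσ1
  obtain ⟨C₁, hC₁, hlin⟩ := exists_mul_pow_le hG hF
  obtain ⟨A₀, B, hA₀, hB, hbound₀⟩ := hG.bound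
  obtain ⟨A, hA, hbound⟩ : ∃ A : ℝ, 1 ≤ A ∧ ∀ d, |G d| ≤ A * B ^ ∑ v, d v := by
    refine ⟨max 1 A₀, le_max_left _ _, fun d => (hbound₀ d).trans ?_⟩
    gcongr
    exact le_max_right _ _
  set ex := Real.exp (σ - 1) with hex
  have hex1 : 1 ≤ ex := Real.one_le_exp (by linarith)
  set c : ℝ := (Fintype.card (Idx m) : ℝ) + 1 with hc
  have hc1 : 1 ≤ c := by rw [hc]; linarith [(Nat.cast_nonneg (Fintype.card (Idx m)) : (0 : ℝ) ≤ _)]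
  -- `c` counts the indices q, and B^(m+1) covers the shift by α + 1 between the order in c_q and
  -- the total degree of the Taylor monomial. The base `b` gathers the growth of the Taylor
  -- coefficients, of C^degree and of e^((σ-1)h).
  set a : ℝ := A * B ^ (m + 1) * C₁ * c with ha
  set b : ℝ := B * C * ex with hb
  have hBm : 1 ≤ B ^ (m + 1) := one_le_pow₀ hB
  have hAB : 1 ≤ A * B ^ (m + 1) := one_le_mul_of_one_le_of_one_le hA hBm
  have hABC : 1 ≤ A * B ^ (m + 1) * C₁ := one_le_mul_of_one_le_of_one_le hAB hC₁
  have ha1 : 1 ≤ a := one_le_mul_of_one_le_of_one_le hABC hc1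
  have hBC : 1 ≤ B * C := one_le_mul_of_one_le_of_one_le hB hC
  have hb1 : 1 ≤ b := one_le_mul_of_one_le_of_one_le hBC hex1
  have hBb : B ≤ b := by
    rw [hb, mul_assoc]
    exact le_mul_of_one_le_right (by linarith) (one_le_mul_of_one_le_of_one_le hC hex1)
  have hBCb : B * C ≤ b := le_mul_of_one_le_right (by linarith) hex1
  have hBeb : B * ex ≤ b := by
    rw [hb, mul_right_comm]; exact le_mul_of_one_le_right (by positivity) hC
  have hAa : A ≤ a := by
    rw [ha, mul_assoc, mul_assoc]
    exact le_mul_of_one_le_right (by linarith)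
      (one_le_mul_of_one_le_of_one_le hBm (one_le_mul_of_one_le_of_one_le hC₁ hc1))
  have hABa : A * B ≤ a := by
    have : A * B ≤ A * B ^ (m + 1) := by gcongr; exact le_self_pow₀ hB (by omega)
    refine this.trans ?_
    rw [ha, mul_assoc]
    exact le_mul_of_one_le_right (by linarith) (one_le_mul_of_one_le_of_one_le hC₁ hc1)
  have hUnn := hU.nonneg hG
  refine ⟨M, N, a, b, ha1, hb1, fun k hk l => ?_⟩
  set W := weight M N s σ with hW
  set V : ℕ → ℕ → ℝ := fun k l => U k l / W k l with hV
  have hWpos : ∀ l, 0 < W k l := fun l => weight_pos M N s σ hk l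
  have hL := charFun_pos hG hk l
  have hVnn : ∀ k l, 0 ≤ V k l := by
    intro k l
    rcases Nat.eq_zero_or_pos k with rfl | hk
    · simp [hV, hU.1]
    · exact div_nonneg (hUnn k l) (weight_pos M N s σ hk l).le
  have hkL := pow_le_charFun hG k l
  have hk1 : (1 : ℝ) ≤ k := by exact_mod_cast hk
  have hL1 : 1 ≤ charFun G k l := le_trans (one_le_pow₀ hk1) hkL
  rw [div_le_iff₀ (hWpos l)]
  refine le_of_mul_le_mul_left ?_ hL
  rw [hU.2 k hk l]
  -- the inhomogeneous term
  have h1 : (if k = 1 then aFun G l else 0) ≤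
      charFun G k l * ((if k = 1 then a * b ^ l else 0) * W k l) := by
    split_ifs with hk1
    · have e1 : aFun G l ≤ a * b ^ l := by
        calc aFun G l ≤ |G (expo 1 l 0)| := le_abs_self _
          _ ≤ A * B ^ (l + 1) := by rw [← sum_expo_one_zero (m := m) l]; exact hbound _
          _ = A * B * B ^ l := by ring
          _ ≤ a * b ^ l := by gcongr
      have e2 : 1 ≤ W k l := by rw [hk1]; exact one_le_weight_one M N s hσ1 l
      have e3 : 0 ≤ a * b ^ l := by positivity
      calc aFun G l ≤ a * b ^ l := e1
        _ ≤ a * b ^ l * W k l := le_mul_of_one_le_right e3 e2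
        _ ≤ _ := le_mul_of_one_le_left (by positivity) hL1
    · simp
  -- the linear terms
  have h2 : linPart G U k l ≤
      charFun G k l * ((∑ h ∈ Finset.range l, (a * b ^ (h + 1)) * V k (l - (h + 1))) * W k l) := by
    unfold linPart
    rw [Finset.sum_comm, Finset.sum_mul, Finset.mul_sum]
    refine Finset.sum_le_sum fun h hh => ?_
    rw [Finset.mem_range] at hh
    have hl1 : 1 ≤ l := by omega
    have hq : ∀ q : Idx m, cFun G q (h + 1) * ((k : ℝ) ^ q.1.1 *
        ((l - (h + 1)).descFactorial q.1.2 : ℝ) * U k (l - (h + 1))) ≤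
        A * B ^ (m + 1) * C₁ * (b ^ (h + 1) * V k (l - (h + 1)) * W k l * charFun G k l) := by
      intro q
      by_cases hcq : cFun G q (h + 1) = 0
      · rw [hcq, zero_mul]
        have := hVnn k (l - (h + 1))
        have := (hWpos l).le
        positivity
      · have e1 := hlin q h hcq k l hk hl1
        have e2 : cFun G q (h + 1) ≤ A * B ^ (m + 1) * B ^ (h + 1) := by
          calc cFun G q (h + 1) ≤ |G (expo 0 (h + 1 + q.1.2) (Finsupp.single q 1))| := le_abs_self _
            _ ≤ A * B ^ (h + 1 + q.1.2 + 1) := by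
                rw [← sum_expo_zero_single q (h + 1 + q.1.2)]; exact hbound _
            _ ≤ A * B ^ (m + 1 + (h + 1)) := by
                exact mul_le_mul_of_nonneg_left (pow_le_pow_right₀ hB
                  (by have := idx_snd_le q; omega)) (by linarith)
            _ = _ := by rw [pow_add]; ring
        have e3 : ((l - (h + 1)).descFactorial q.1.2 : ℝ) ≤ (l : ℝ) ^ q.1.2 := by
          calc ((l - (h + 1)).descFactorial q.1.2 : ℝ) ≤ (((l - (h + 1)) ^ q.1.2 : ℕ) : ℝ) := by
                exact_mod_cast Nat.descFactorial_le_pow _ _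
            _ ≤ ((l ^ q.1.2 : ℕ) : ℝ) := by
                exact_mod_cast Nat.pow_le_pow_left (by omega) _
            _ = _ := by push_cast; rfl
        have e4 := rpow_mul_weight_le M N s hσ1 (k := k) (l := l) (h := h + 1) hk (by omega)
        have e5 : U k (l - (h + 1)) = V k (l - (h + 1)) * W k (l - (h + 1)) := by
          simp only [hV]; rw [div_mul_cancel₀ _ (hWpos _).ne']
        have e6 := hVnn k (l - (h + 1))
        have e7 := (hWpos (l - (h + 1))).le
        have e8 : (B * ex) ^ (h + 1) ≤ b ^ (h + 1) := pow_le_pow_left₀ (by positivity) hBeb _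
        have e9 : 0 ≤ cFun G q (h + 1) := hG.c_nonneg q h
        have e10 := (hWpos l).le
        rw [e5]
        calc cFun G q (h + 1) * ((k : ℝ) ^ q.1.1 * ((l - (h + 1)).descFactorial q.1.2 : ℝ) *
              (V k (l - (h + 1)) * W k (l - (h + 1))))
            ≤ cFun G q (h + 1) * ((k : ℝ) ^ q.1.1 * (l : ℝ) ^ q.1.2 *
              (V k (l - (h + 1)) * W k (l - (h + 1)))) := by gcongr
          _ ≤ cFun G q (h + 1) * ((C₁ * (l : ℝ) ^ (((h + 1 : ℕ) : ℝ) * (σ - 1)) * charFun G k l) *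
              (V k (l - (h + 1)) * W k (l - (h + 1)))) := by gcongr
          _ = cFun G q (h + 1) * (C₁ * charFun G k l * V k (l - (h + 1)) *
              ((l : ℝ) ^ (((h + 1 : ℕ) : ℝ) * (σ - 1)) * W k (l - (h + 1)))) := by ring
          _ ≤ (A * B ^ (m + 1) * B ^ (h + 1)) * (C₁ * charFun G k l * V k (l - (h + 1)) *
              (ex ^ (h + 1) * W k l)) := by gcongr
          _ = A * B ^ (m + 1) * C₁ * ((B * ex) ^ (h + 1) * V k (l - (h + 1)) * W k l *
              charFun G k l) := by rw [mul_pow]; ring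
          _ ≤ _ := by gcongr
    refine (Finset.sum_le_sum fun q _ => hq q).trans ?_
    rw [Finset.sum_const, Finset.card_univ, nsmul_eq_mul]
    have e1 := hVnn k (l - (h + 1))
    have e2 := (hWpos l).le
    have e3 : 0 ≤ A * B ^ (m + 1) * C₁ * (b ^ (h + 1) * V k (l - (h + 1)) * W k l *
        charFun G k l) := by positivity
    calc _ ≤ c * (A * B ^ (m + 1) * C₁ * (b ^ (h + 1) * V k (l - (h + 1)) * W k l *
          charFun G k l)) := by
          gcongr
          rw [hc]; linarith
      _ = _ := by rw [ha]; ring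
  -- the nonlinear terms
  have h3 : nonlin G (zCoeff U) k l ≤
      charFun G k l * (nonlin (fun d : Var m →₀ ℕ => a * b ^ ∑ v, d v) (shiftCoeff V) k l *
        W k l) := by
    unfold nonlin
    rw [Finset.sum_mul, Finset.mul_sum]
    refine Finset.sum_le_sum fun d hd => ?_
    have hd2 := (Finset.mem_filter.1 hd).2
    have hmon : 0 ≤ monCoeff (shiftCoeff V) d k l :=
      monCoeff_nonneg hd2 (fun q l => by simp [shiftCoeff, hV, hU.1])
        fun q k' _ l' => hVnn k' (l' + q.1.2)
    have hWl := (hWpos l).le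
    by_cases hGd : G d = 0
    · rw [hGd, zero_mul]; positivity
    · have hdeg : d Var.t + Fintype.card (Factor d) = tzDegree d := by
        simp [tzDegree, Fintype.card_sigma]
      have hkey := monCoeff_zCoeff_le (M := M) (N := N) (s := s) (σ := σ)
        (C := C ^ tzDegree d * (k : ℝ) ^ m * W k l) hU.1 hUnn (d := d) (k := k) (l := l) (by
          intro f hf hpos
          have hmem := mem_splits.1 hf
          -- The condition on the exponents is `le_gevreyIndex` at every factor; the remaining k^m
          -- is covered by L(k, l) ≥ k^m.
          have := hprod (Factor d) (fun r => r.1.1.1) (fun r => r.1.1.2) (fun r => f r 0)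
            (fun r => f r 1) (d Var.t) (d Var.x) (fun r => idx_add_le r.1) hpos
            (by rw [hdeg]; exact hd2) (fun r => by
              rw [hdeg]
              refine le_gevreyIndex hd2 ?_ ?_
              · rw [hF]; exact_mod_cast hGd
              · have := r.2.2; omega)
          rw [hdeg, hmem.1, hmem.2] at this
          exact this)
      have hGle : G d ≤ A * B ^ ∑ v, d v := (le_abs_self _).trans (hbound d)
      have hCle : C ^ tzDegree d ≤ C ^ ∑ v, d v := pow_le_pow_right₀ hC (tzDegree_le_sum d)
      have hbp : (B * C) ^ (∑ v, d v) ≤ b ^ ∑ v, d v := pow_le_pow_left₀ (by positivity) hBCb _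
      have hGnn := hG.nonneg d hd2
      calc G d * monCoeff (zCoeff U) d k l
          ≤ G d * (C ^ tzDegree d * (k : ℝ) ^ m * W k l * monCoeff (shiftCoeff V) d k l) := by
            gcongr
        _ ≤ (A * B ^ ∑ v, d v) * (C ^ (∑ v, d v) * charFun G k l * W k l *
              monCoeff (shiftCoeff V) d k l) := by gcongr
        _ = A * (B * C) ^ (∑ v, d v) * (charFun G k l * W k l * monCoeff (shiftCoeff V) d k l) := by
            rw [mul_pow]; ring
        _ ≤ a * b ^ (∑ v, d v) * (charFun G k l * W k l * monCoeff (shiftCoeff V) d k l) := by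
            gcongr
        _ = _ := by ring
  calc _ ≤ _ := add_le_add (add_le_add h1 h2) h3
    _ = _ := by ring

/-- Gevrey estimates for the coefficients of the formal solution. -/
lemma exists_gevrey_bound (hG : PosData G)
    (hF : ∀ d, MvPowerSeries.coeff d (taylor F) = (G d : ℂ)) (hU : IsRecSol G U) :
    ∃ D : ℝ, 1 ≤ D ∧ ∀ k l, U k l ≤ D ^ (k + l + 1) *
      ((k ! : ℝ) ^ (gevreyIndex F - 1) * (l ! : ℝ) ^ (irregularity F - 1)) := by
  obtain ⟨M, N, a, b, ha, hb, hmaj⟩ := exists_majorant hG hF hU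
  set W := weight M N (gevreyIndex F) (irregularity F) with hW
  have hUnn := hU.nonneg hG
  have hVnn : ∀ k l, 0 ≤ U k l / W k l := by
    intro k l
    rcases Nat.eq_zero_or_pos k with rfl | hk
    · simp [hU.1]
    · exact div_nonneg (hUnn k l) (weight_pos M N _ _ hk l).le
  lift a to ℝ≥0 using (by linarith)
  lift b to ℝ≥0 using (by linarith)
  set V : ℕ → ℕ → ℝ≥0 := fun k l => ⟨U k l / W k l, hVnn k l⟩ with hV
  have hVc : ∀ k l, U k l / W k l = (V k l : ℝ) := fun k l => rfl
  have hnl : ∀ k l, nonlin (fun d : Var m →₀ ℕ => (a : ℝ) * (b : ℝ) ^ ∑ v, d v)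
      (shiftCoeff fun k l => U k l / W k l) k l =
      ((nonlin (fun d : Var m →₀ ℕ => a * b ^ ∑ v, d v) (shiftCoeff V) k l : ℝ≥0) : ℝ) := by
    intro k l
    have := nonlin_map NNReal.toRealHom (fun d : Var m →₀ ℕ => a * b ^ ∑ v, d v)
      (shiftCoeff V) k l
    simp only [NNReal.coe_toRealHom, NNReal.coe_mul, NNReal.coe_pow] at this
    exact this.symm
  have hnlE : ∀ k l, nonlin (fun d : Var m →₀ ℕ => (a : ℝ≥0∞) * (b : ℝ≥0∞) ^ ∑ v, d v)
      (shiftCoeff fun k l => (V k l : ℝ≥0∞)) k l =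
      ((nonlin (fun d : Var m →₀ ℕ => a * b ^ ∑ v, d v) (shiftCoeff V) k l : ℝ≥0) : ℝ≥0∞) := by
    intro k l
    have := nonlin_map ENNReal.ofNNRealHom (fun d : Var m →₀ ℕ => a * b ^ ∑ v, d v)
      (shiftCoeff V) k l
    simp only [ENNReal.coe_ofNNRealHom] at this
    exact this.symm
  obtain ⟨D, hD, hbd⟩ := exists_bound_of_majorant (m := m) (a := a) (b := b)
    (by exact_mod_cast ha) (by exact_mod_cast hb) (v := fun k l => (V k l : ℝ≥0∞))
    (fun l => by
      have : V 0 l = 0 := by ext; rw [← hVc]; simp [hU.1]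
      simp [this]) (fun k l => ENNReal.coe_ne_top) (fun k hk l => by
      have h := hmaj k hk l
      rw [hnl] at h
      simp only [hVc] at h
      rw [hnlE]
      have h' : V k l ≤ (if k = 1 then a * b ^ l else 0) +
          (∑ h ∈ Finset.range l, (a * b ^ (h + 1)) * V k (l - (h + 1)) +
          nonlin (fun d : Var m →₀ ℕ => a * b ^ ∑ v, d v) (shiftCoeff V) k l) := by
        rw [← NNReal.coe_le_coe]
        push_cast [apply_ite (NNReal.toReal)]
        exact h
      have h'' := ENNReal.coe_le_coe.2 h'
      push_cast [apply_ite (ENNReal.ofNNReal)] at h''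
      exact h'')
  have hD' : (1 : ℝ) ≤ D := by exact_mod_cast hD
  -- The binomial in the weight is bounded by a power of 2 and k^(-N) ≤ 1, so the weight is at most
  -- the Gevrey weight times a geometric factor.
  refine ⟨2 ^ (M + 1) * D, one_le_mul_of_one_le_of_one_le (one_le_pow₀ (by norm_num)) hD',
    fun k l => ?_⟩
  rcases Nat.eq_zero_or_pos k with rfl | hk
  · rw [hU.1]; positivity
  · have h1 : U k l / W k l ≤ (D : ℝ) ^ (k + l + 1) := by
      have := hbd k l
      rw [hVc]
      exact_mod_cast this
    rw [div_le_iff₀ (weight_pos M N _ _ hk l)] at h1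
    refine h1.trans ?_
    have hk1 : (1 : ℝ) ≤ k := by exact_mod_cast hk
    have hch : ((M * (k - 1) + l).choose l : ℝ) ≤ (2 ^ (M + 1)) ^ (k + l + 1) := by
      calc ((M * (k - 1) + l).choose l : ℝ) ≤ (2 : ℝ) ^ (M * (k - 1) + l) := by
            exact_mod_cast Nat.choose_le_two_pow _ _
        _ ≤ 2 ^ ((M + 1) * (k + l + 1)) := by
            gcongr
            · norm_num
            · have : M * (k - 1) ≤ M * (k + l + 1) := Nat.mul_le_mul_left _ (by omega)
              rw [add_mul]; omega
        _ = _ := pow_mul _ _ _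
    have hdiv : (k ! : ℝ) ^ (gevreyIndex F - 1) / (k : ℝ) ^ N ≤
        (k ! : ℝ) ^ (gevreyIndex F - 1) := div_le_self (by positivity) (one_le_pow₀ hk1)
    calc (D : ℝ) ^ (k + l + 1) * weight M N (gevreyIndex F) (irregularity F) k l
        ≤ (D : ℝ) ^ (k + l + 1) * ((k ! : ℝ) ^ (gevreyIndex F - 1) *
          ((l ! : ℝ) ^ (irregularity F - 1) * (2 ^ (M + 1)) ^ (k + l + 1))) := by
          unfold weight
          gcongr
      _ = _ := by rw [mul_pow]; ring

end UpperBound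

end TotChar

end

noncomputable section
namespace TotChar

variable {m : ℕ} {G : (Var m →₀ ℕ) → ℝ} {U : ℕ → ℕ → ℝ}

/-! ### Lower bounds propagated by single terms -/

section Steps

lemma linPart_nonneg (hG : PosData G) (hU : IsRecSol G U) (k l : ℕ) : 0 ≤ linPart G U k l :=
  Finset.sum_nonneg fun q _ => Finset.sum_nonneg fun h _ =>
    mul_nonneg (hG.c_nonneg q h) (mul_nonneg (by positivity) (hU.nonneg hG _ _))

lemma monCoeff_zCoeff_nonneg (hG : PosData G) (hU : IsRecSol G U) {d : Var m →₀ ℕ}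
    (hd : 2 ≤ tzDegree d) (k l : ℕ) : 0 ≤ monCoeff (zCoeff U) d k l :=
  monCoeff_nonneg hd (zCoeff_zero hU.1) fun q k' _ l => zCoeff_nonneg (hU.nonneg hG k') q l

lemma nonlin_nonneg (hG : PosData G) (hU : IsRecSol G U) (k l : ℕ) :
    0 ≤ nonlin G (zCoeff U) k l := by
  refine Finset.sum_nonneg fun d hd => ?_
  have hd' := (Finset.mem_filter.1 hd).2
  exact mul_nonneg (hG.nonneg d hd') (monCoeff_zCoeff_nonneg hG hU hd' k l)

lemma source_nonneg (hG : PosData G) (k l : ℕ) : 0 ≤ if k = 1 then aFun G l else 0 := by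
  split_ifs
  · exact hG.a_nonneg l
  · exact le_rfl

/-- Strict positivity in c1 enters here; it makes every jet variable positive at t^1 x^0, since only
α ≤ m occur. -/
lemma pos_one (hG : PosData G) (hU : IsRecSol G U) {l : ℕ} (hl : l ≤ m) : 0 < U 1 l := by
  have h := hU.2 1 le_rfl l
  rw [if_pos rfl] at h
  have h1 := linPart_nonneg hG hU 1 l
  have h2 := nonlin_nonneg hG hU 1 l
  have h3 := hG.a_pos l hl
  exact pos_of_mul_pos_right (by rw [h]; linarith) (charFun_pos hG le_rfl l).le

/-- The other contributions to the recursion are nonnegative, so one term alone bounds the left side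
from below. -/
lemma lin_step (hG : PosData G) (hU : IsRecSol G U) (q : Idx m) {p : ℕ} (hp : 1 ≤ p) {k : ℕ}
    (hk : 1 ≤ k) (l : ℕ) :
    cFun G q p * ((k : ℝ) ^ q.1.1 * (l.descFactorial q.1.2 : ℝ) * U k l) ≤
      charFun G k (l + p) * U k (l + p) := by
  rw [hU.2 k hk]
  have h1 := source_nonneg hG k (l + p)
  have h2 := nonlin_nonneg hG hU k (l + p)
  have h3 : cFun G q p * ((k : ℝ) ^ q.1.1 * (l.descFactorial q.1.2 : ℝ) * U k l) ≤
      linPart G U k (l + p) := by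
    have hnn : ∀ q h, 0 ≤ cFun G q (h + 1) * ((k : ℝ) ^ q.1.1 *
        ((l + p - (h + 1)).descFactorial q.1.2 : ℝ) * U k (l + p - (h + 1))) := fun q h =>
      mul_nonneg (hG.c_nonneg q h) (mul_nonneg (by positivity) (hU.nonneg hG _ _))
    have e1 := Finset.single_le_sum (f := fun q : Idx m => ∑ h ∈ Finset.range (l + p),
      cFun G q (h + 1) * ((k : ℝ) ^ q.1.1 *
        ((l + p - (h + 1)).descFactorial q.1.2 : ℝ) * U k (l + p - (h + 1))))
      (fun q _ => Finset.sum_nonneg fun h _ => hnn q h) (Finset.mem_univ q)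
    have e2 := Finset.single_le_sum (f := fun h => cFun G q (h + 1) * ((k : ℝ) ^ q.1.1 *
        ((l + p - (h + 1)).descFactorial q.1.2 : ℝ) * U k (l + p - (h + 1))))
      (fun h _ => hnn q h) (Finset.mem_range.2 (show p - 1 < l + p by omega))
    have e3 := e2.trans e1
    simp only [Nat.sub_add_cancel hp, Nat.add_sub_cancel] at e3
    exact e3
  linarith

lemma mul_monCoeff_le (hG : PosData G) (hU : IsRecSol G U) {d : Var m →₀ ℕ}
    (hd : 2 ≤ tzDegree d) {k : ℕ} (hk : 1 ≤ k) (l : ℕ) :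
    G d * monCoeff (zCoeff U) d k l ≤ charFun G k l * U k l := by
  rw [hU.2 k hk]
  have h1 := source_nonneg hG k l
  have h2 := linPart_nonneg hG hU k l
  have h3 : G d * monCoeff (zCoeff U) d k l ≤ nonlin G (zCoeff U) k l := by
    by_cases hbox : d ∈ box m (k + l)
    · refine Finset.single_le_sum (f := fun d => G d * monCoeff (zCoeff U) d k l)
        (fun e he => ?_) (Finset.mem_filter.2 ⟨hbox, hd⟩)
      have hd' := (Finset.mem_filter.1 he).2
      exact mul_nonneg (hG.nonneg e hd') (monCoeff_zCoeff_nonneg hG hU hd' k l)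
    · rw [monCoeff_eq_zero_of_notMem_box (zCoeff_zero hU.1) hbox, mul_zero]
      exact nonlin_nonneg hG hU k l
  linarith

lemma card_factor (d : Var m →₀ ℕ) : Fintype.card (Factor d) = ∑ q, d (Var.z q) := by
  simp [Factor]

/-- A monomial of `R₂` that contains `z_q` propagates lower bounds, the other factors being
evaluated on the coefficient of `t` of the solution. -/
lemma mono_step (hG : PosData G) (hU : IsRecSol G U) {d : Var m →₀ ℕ} (hd : 2 ≤ tzDegree d)
    (hGd : 0 < G d) {q : Idx m} (hq : d (Var.z q) ≠ 0) :
    ∃ c : ℝ, 0 < c ∧ ∀ k l : ℕ, 1 ≤ k → c * zCoeff U q k l ≤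
      charFun G (k + (tzDegree d - 1)) (l + d Var.x) *
        U (k + (tzDegree d - 1)) (l + d Var.x) := by
  classical
  let r₀ : Factor d := ⟨q, ⟨0, Nat.pos_of_ne_zero hq⟩⟩
  have hone : ∀ q : Idx m, 0 < zCoeff U q 1 0 := by
    intro q
    have := pos_one hG hU (idx_snd_le q)
    have h2 : 0 < (0 + q.1.2).descFactorial q.1.2 := by
      rw [zero_add, Nat.descFactorial_self]; exact Nat.factorial_pos _
    simp only [zCoeff, zero_add, Nat.cast_one, one_pow, one_mul] at h2 ⊢
    positivity
  refine ⟨G d * ∏ r ∈ Finset.univ.erase r₀, zCoeff U r.1 1 0,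
    mul_pos hGd (Finset.prod_pos fun r _ => hone r.1), fun k l hk => ?_⟩
  refine le_trans ?_ (mul_monCoeff_le hG hU hd (by omega) _)
  rw [mul_assoc]
  refine mul_le_mul_of_nonneg_left ?_ hGd.le
  rw [monCoeff_eq_sum]
  -- One occurrence of z_q carries t^k x^l, and every other factor carries t.
  let f : Factor d →₀ (Fin 2 →₀ ℕ) := Finsupp.equivFunOnFinite.symm fun r =>
    if r = r₀ then txExp k l else txExp 1 0
  have hf : ∀ r, f r = if r = r₀ then txExp k l else txExp 1 0 := fun r => rfl
  have hf0 : ∀ r ∈ Finset.univ.erase r₀, f r = txExp 1 0 := fun r hr => by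
    rw [hf, if_neg (Finset.ne_of_mem_erase hr)]
  have hf1 : f r₀ = txExp k l := by rw [hf, if_pos rfl]
  have hmem : f ∈ splits d (k + (tzDegree d - 1)) (l + d Var.x) := by
    rw [mem_splits]
    have hcard := card_factor d
    constructor
    · rw [← Finset.add_sum_erase _ _ (Finset.mem_univ r₀), hf1,
        Finset.sum_congr rfl (fun r hr => by rw [hf0 r hr])]
      simp only [txExp_zero, Finset.sum_const, Finset.card_erase_of_mem (Finset.mem_univ r₀),
        smul_eq_mul, mul_one, Finset.card_univ, hcard]
      have : 1 ≤ ∑ q, d (Var.z q) := by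
        rw [← hcard]; exact Fintype.card_pos_iff.2 ⟨r₀⟩
      unfold tzDegree at hd ⊢
      omega
    · rw [← Finset.add_sum_erase _ _ (Finset.mem_univ r₀), hf1,
        Finset.sum_congr rfl (fun r hr => by rw [hf0 r hr])]
      simp only [txExp_one, Finset.sum_const_zero]
      omega
  refine le_trans (le_of_eq ?_) (Finset.single_le_sum (f := fun f : Factor d →₀ (Fin 2 →₀ ℕ) =>
    ∏ r, zCoeff U r.1 (f r 0) (f r 1)) (fun g _ => Finset.prod_nonneg fun r _ =>
      zCoeff_nonneg (hU.nonneg hG _) _ _) hmem)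
  have hp : ∏ r ∈ Finset.univ.erase r₀, zCoeff U r.1 (f r 0) (f r 1) =
      ∏ r ∈ Finset.univ.erase r₀, zCoeff U r.1 1 0 :=
    Finset.prod_congr rfl fun r hr => by rw [hf0 r hr, txExp_zero, txExp_one]
  rw [← Finset.mul_prod_erase _ _ (Finset.mem_univ r₀), hp, hf1, txExp_zero, txExp_one, mul_comm]

lemma add_one_pow_le_descFactorial {l α i : ℕ} (h : α + i ≤ l) :
    ((i : ℝ) + 1) ^ α ≤ (l.descFactorial α : ℝ) := by
  have h1 : (i + 1) ^ α ≤ l.descFactorial α :=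
    (Nat.pow_le_pow_left (by omega) α).trans (Nat.pow_sub_le_descFactorial l α)
  exact_mod_cast h1

/-- Taking logarithms turns a chain of steps into a sum. The number i is a lower bound for l - α;
running through 0, 1, 2, … along a chain, it makes the factors (i + 1)^α build up factorials. -/
lemma log_step {c k L U₀ U₁ : ℝ} {j α l i : ℕ} (hc : 0 < c) (hk : 0 < k) (hL : 0 < L)
    (hU : 0 < U₀) (hl : α + i ≤ l) (h : c * (k ^ j * (l.descFactorial α : ℝ) * U₀) ≤ L * U₁) :
    0 < U₁ ∧ Real.log c + j * Real.log k + α * Real.log (i + 1) + Real.log U₀ ≤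
      Real.log L + Real.log U₁ := by
  have h1 := add_one_pow_le_descFactorial hl
  have h0 : (0 : ℝ) < ((i : ℝ) + 1) ^ α := by positivity
  have h2 : c * (k ^ j * ((i : ℝ) + 1) ^ α * U₀) ≤ L * U₁ := le_trans (by gcongr) h
  have h3 : 0 < c * (k ^ j * ((i : ℝ) + 1) ^ α * U₀) := by positivity
  have h4 : 0 < U₁ := pos_of_mul_pos_right (h3.trans_le h2) hL.le
  refine ⟨h4, ?_⟩
  have h5 := Real.log_le_log h3 h2
  rw [Real.log_mul hL.ne' h4.ne', Real.log_mul hc.ne' (by positivity),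
    Real.log_mul (by positivity) hU.ne', Real.log_mul (by positivity) h0.ne', Real.log_pow,
    Real.log_pow] at h5
  linarith

lemma log_lin_step (hG : PosData G) (hU : IsRecSol G U) {q : Idx m} {p : ℕ} (hp : 1 ≤ p)
    (hc : 0 < cFun G q p) {k l i : ℕ} (hk : 1 ≤ k) (hl : q.1.2 + i ≤ l) (hpos : 0 < U k l) :
    0 < U k (l + p) ∧ Real.log (cFun G q p) + q.1.1 * Real.log k + q.1.2 * Real.log (i + 1) +
      Real.log (U k l) ≤ Real.log (charFun G k (l + p)) + Real.log (U k (l + p)) :=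
  log_step hc (by exact_mod_cast hk) (charFun_pos hG hk _) hpos hl (lin_step hG hU q hp hk l)

lemma log_mono_step (hG : PosData G) (hU : IsRecSol G U) {d : Var m →₀ ℕ} (hd : 2 ≤ tzDegree d)
    (hGd : 0 < G d) {q : Idx m} (hq : d (Var.z q) ≠ 0) :
    ∃ c : ℝ, ∀ k l i : ℕ, 1 ≤ k → q.1.2 + i ≤ l → 0 < U k l →
      0 < U (k + (tzDegree d - 1)) (l - q.1.2 + d Var.x) ∧
      c + q.1.1 * Real.log k + q.1.2 * Real.log (i + 1) + Real.log (U k l) ≤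
        Real.log (charFun G (k + (tzDegree d - 1)) (l - q.1.2 + d Var.x)) +
        Real.log (U (k + (tzDegree d - 1)) (l - q.1.2 + d Var.x)) := by
  obtain ⟨c, hc, h⟩ := mono_step hG hU hd hGd hq
  refine ⟨Real.log c, fun k l i hk hl hpos => ?_⟩
  have := h k (l - q.1.2) hk
  rw [zCoeff, Nat.sub_add_cancel (by omega)] at this
  exact log_step hc (by exact_mod_cast hk) (charFun_pos hG (by omega) _) hpos hl this

end Steps

/-- On the scale k = O(n^w), l = O(n) each k^j l^α is O(n^(wj+α)), so the growth of L is governed by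
the functional wX + Y on Λ₀. -/
lemma log_charFun_le (hG : PosData G) {w h : ℝ} (hm : w * m ≤ h)
    (hq : ∀ q : Idx m, cFun G q 0 ≠ 0 → w * q.1.1 + q.1.2 ≤ h) {B : ℝ} (hB : 1 ≤ B) :
    ∃ C : ℝ, ∀ n k l : ℕ, 1 ≤ n → 1 ≤ k → (k : ℝ) ≤ B * (n : ℝ) ^ w → (l : ℝ) ≤ B * n →
      Real.log (charFun G k l) ≤ C + h * Real.log n := by
  set S : ℝ := 1 + ∑ q : Idx m, -cFun G q 0 with hS
  have hc0 : ∀ q : Idx m, 0 ≤ -cFun G q 0 := fun q => neg_nonneg.2 (hG.c_nonpos q)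
  have hS1 : 1 ≤ S := by
    have : 0 ≤ ∑ q : Idx m, -cFun G q 0 := Finset.sum_nonneg fun q _ => hc0 q
    linarith
  refine ⟨Real.log (S * B ^ m), fun n k l hn hk hkn hln => ?_⟩
  have hn1 : (1 : ℝ) ≤ n := by exact_mod_cast hn
  have hn0 : (0 : ℝ) < n := by linarith
  have key : ∀ j α : ℕ, j + α ≤ m → w * j + α ≤ h →
      (k : ℝ) ^ j * (l : ℝ) ^ α ≤ B ^ m * (n : ℝ) ^ h := by
    intro j α hjα hle
    calc (k : ℝ) ^ j * (l : ℝ) ^ α ≤ (B * (n : ℝ) ^ w) ^ j * (B * n) ^ α := by gcongr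
      _ = B ^ (j + α) * (n : ℝ) ^ (w * j + α) := by
          rw [mul_pow, mul_pow, Real.rpow_add hn0, Real.rpow_mul hn0.le, Real.rpow_natCast,
            Real.rpow_natCast, pow_add]
          ring
      _ ≤ B ^ m * (n : ℝ) ^ h := by
          have h1 := pow_le_pow_right₀ hB hjα
          have h2 := Real.rpow_le_rpow_of_exponent_le hn1 hle
          gcongr
  have hmain : charFun G k l ≤ S * B ^ m * (n : ℝ) ^ h := by
    rw [charFun_eq, hS, mul_assoc, add_mul, one_mul, Finset.sum_mul]
    refine add_le_add ?_ (Finset.sum_le_sum fun q _ => ?_)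
    · simpa using key m 0 le_rfl (by simpa using hm)
    · by_cases hc : cFun G q 0 = 0
      · simp [hc]
      · rw [mul_assoc]
        refine mul_le_mul_of_nonneg_left (le_trans ?_ (key _ _ (idx_add_le q) (hq q hc))) (hc0 q)
        gcongr
        exact_mod_cast Nat.descFactorial_le_pow l q.1.2
  have := Real.log_le_log (charFun_pos hG hk l) hmain
  rwa [Real.log_mul (by positivity) (by positivity), Real.log_rpow hn0] at this

end TotChar
end

/-! ### Growth in x along the Newton polygon -/

noncomputable section
namespace TotChar

variable {m : ℕ} {G : (Var m →₀ ℕ) → ℝ} {U : ℕ → ℕ → ℝ}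

lemma log_natCast_nonneg (n : ℕ) : 0 ≤ Real.log n := Real.log_natCast_nonneg n

lemma log_charFun_le_crude (hG : PosData G) {B : ℝ} (hB : 1 ≤ B) :
    ∃ C : ℝ, ∀ n k l : ℕ, 1 ≤ n → 1 ≤ k → (k : ℝ) ≤ B * n → (l : ℝ) ≤ B * n →
      Real.log (charFun G k l) ≤ C + m * Real.log n := by
  obtain ⟨C, hC⟩ := log_charFun_le hG (w := 1) (h := m) (by simp)
    (fun q _ => by rw [one_mul]; exact_mod_cast idx_add_le q) hB
  exact ⟨C, fun n k l hn hk hkn hln => hC n k l hn hk (by rwa [Real.rpow_one]) hln⟩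

/-- Points with a prescribed power of `t` at which the solution is not too small. -/
lemma exists_start (hG : PosData G) (hU : IsRecSol G U) {q : Idx m} {p : ℕ} (hp : 1 ≤ p)
    (hc : 0 < cFun G q p) {d : Var m →₀ ℕ} (hd : 2 ≤ tzDegree d) (hGd : 0 < G d) {q' : Idx m}
    (hq' : d (Var.z q') ≠ 0) :
    ∃ C : ℝ, 1 ≤ C ∧ ∀ n K : ℕ, 1 ≤ n → K ≤ n → ∃ k l : ℕ, K + 1 ≤ k ∧ (k : ℝ) ≤ C * (K + 1) ∧
      m ≤ l ∧ (l : ℝ) ≤ C * (K + 1) ∧ 0 < U k l ∧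
      -(C * (K + 1) * (1 + Real.log n)) ≤ Real.log (U k l) := by
  obtain ⟨c, hmono⟩ := log_mono_step hG hU hd hGd hq'
  set L := tzDegree d - 1 with hL
  have hL1 : 1 ≤ L := by omega
  set β := d Var.x with hβ
  set B : ℕ := 1 + L + m + p * m + p + β with hB
  obtain ⟨C₁, hC₁⟩ := log_charFun_le_crude hG (B := B) (by exact_mod_cast (by omega : 1 ≤ B))
  set D : ℝ := |C₁| + |c| + |Real.log (cFun G q p)| + m with hD
  have hD0 : 0 ≤ D := by positivity
  have hloss : ∀ n : ℕ, C₁ + m * Real.log n - c ≤ D * (1 + Real.log n) ∧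
      C₁ + m * Real.log n - Real.log (cFun G q p) ≤ D * (1 + Real.log n) := by
    intro n
    have h0 := log_natCast_nonneg n
    have h1 := le_abs_self C₁
    have h2 := neg_abs_le c
    have h3 := neg_abs_le (Real.log (cFun G q p))
    have h4 : 0 ≤ (|C₁| + |c| + |Real.log (cFun G q p)|) * Real.log n := by positivity
    have h5 := abs_nonneg c
    have h6 := abs_nonneg (Real.log (cFun G q p))
    have h7 : (0 : ℝ) ≤ m := Nat.cast_nonneg m
    have h8 : D * (1 + Real.log n) = D + (|C₁| + |c| + |Real.log (cFun G q p)|) * Real.log n +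
      m * Real.log n := by rw [hD]; ring
    constructor <;> linarith
  have hpos := pos_one hG hU (le_refl m)
  refine ⟨B + (m + 1) * D + |Real.log (U 1 m)|, ?_, fun n K hn hK => ?_⟩
  · have : (1 : ℝ) ≤ B := by exact_mod_cast (by omega : 1 ≤ B)
    have h1 := abs_nonneg (Real.log (U 1 m))
    have : 0 ≤ ((m : ℝ) + 1) * D := by positivity
    linarith
  set Λ := 1 + Real.log n with hΛ
  have hΛ1 : 1 ≤ Λ := by have := log_natCast_nonneg n; linarith
  -- First the power of x is raised at k = 1, since each of the K monomial steps to follow may use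
  -- up to m powers of x.
  have hlin : ∀ e ≤ m * K, 0 < U 1 (m + p * e) ∧
      Real.log (U 1 m) - e * (D * Λ) ≤ Real.log (U 1 (m + p * e)) := by
    intro e
    induction e with
    | zero => simpa using hpos
    | succ e ih =>
      intro he
      obtain ⟨h1, h2⟩ := ih (by omega)
      obtain ⟨h3, h4⟩ := log_lin_step hG hU hp hc (i := 0) le_rfl
        (by have := idx_snd_le q; omega) h1
      rw [add_assoc m, ← mul_add_one p e] at h3 h4
      refine ⟨h3, ?_⟩
      have hb : m + p * (e + 1) ≤ B * n := by
        have e1 : p * (e + 1) ≤ p * (m * n) :=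
          Nat.mul_le_mul_left _ (he.trans (Nat.mul_le_mul_left _ hK))
        have e2 : (m + p * m) * n ≤ B * n := Nat.mul_le_mul_right _ (by omega)
        have e3 : m ≤ m * n := Nat.le_mul_of_pos_right _ hn
        calc m + p * (e + 1) ≤ m * n + p * (m * n) := by omega
          _ = (m + p * m) * n := by ring
          _ ≤ _ := e2
      have h5 := hC₁ n 1 (m + p * (e + 1)) hn le_rfl
        (by exact_mod_cast Nat.mul_pos (by omega : 0 < B) hn) (by exact_mod_cast hb)
      have h6 := (hloss n).2
      simp only [Nat.cast_one, Real.log_one, mul_zero, Nat.cast_zero, zero_add, add_zero] at h4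
      push_cast
      linarith
  -- Each monomial step adds L to the order in t; the reserve (K - e) m of powers of x suffices for
  -- the steps that remain.
  have hmon : ∀ e ≤ K, ∃ l, m + (K - e) * m ≤ l ∧ l ≤ m + p * (m * K) + e * β ∧
      0 < U (1 + e * L) l ∧
      Real.log (U 1 m) - ((m * K : ℕ) + e) * (D * Λ) ≤ Real.log (U (1 + e * L) l) := by
    intro e
    induction e with
    | zero =>
      intro _
      obtain ⟨h1, h2⟩ := hlin (m * K) le_rfl
      refine ⟨m + p * (m * K), ?_, by omega, by simpa using h1, by simpa using h2⟩
      have : 1 * (m * K) ≤ p * (m * K) := Nat.mul_le_mul_right _ hp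
      rw [Nat.sub_zero, mul_comm K m]
      omega
    | succ e ih =>
      intro he
      obtain ⟨l, hl1, hl2, h1, h2⟩ := ih (by omega)
      have hq2 := idx_snd_le q'
      have hKe : (K - e) * m = (K - (e + 1)) * m + m := by
        rw [← add_one_mul]; congr 1; omega
      obtain ⟨h3, h4⟩ := hmono (1 + e * L) l 0 (by omega) (by omega) h1
      have hk : 1 + e * L + L = 1 + (e + 1) * L := by ring
      rw [hk] at h3 h4
      have hl3 : l - q'.1.2 + β ≤ m + p * (m * K) + (e + 1) * β := by
        rw [add_one_mul]; omega
      refine ⟨l - q'.1.2 + β, by omega, hl3, h3, ?_⟩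
      have hb1 : 1 + (e + 1) * L ≤ B * n := by
        have e1 : (e + 1) * L ≤ n * L := Nat.mul_le_mul_right _ (by omega)
        have e2 : (1 + L) * n ≤ B * n := Nat.mul_le_mul_right _ (by omega)
        calc 1 + (e + 1) * L ≤ n + n * L := by omega
          _ = (1 + L) * n := by ring
          _ ≤ _ := e2
      have hb2 : l - q'.1.2 + β ≤ B * n := by
        have e1 : (e + 1) * β ≤ n * β := Nat.mul_le_mul_right _ (by omega)
        have e2 : (m + p * m + β) * n ≤ B * n := Nat.mul_le_mul_right _ (by omega)
        have e3 : m ≤ m * n := Nat.le_mul_of_pos_right _ hn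
        have e4 : p * (m * K) ≤ p * (m * n) :=
          Nat.mul_le_mul_left _ (Nat.mul_le_mul_left _ hK)
        calc l - q'.1.2 + β ≤ m * n + p * (m * n) + n * β := by omega
          _ = (m + p * m + β) * n := by ring
          _ ≤ _ := e2
      have h5 := hC₁ n _ _ hn (by omega : 1 ≤ 1 + (e + 1) * L) (by exact_mod_cast hb1)
        (by exact_mod_cast hb2)
      have h6 := (hloss n).1
      have h7 : 0 ≤ (q'.1.1 : ℝ) * Real.log ((1 + e * L : ℕ) : ℝ) :=
        mul_nonneg (Nat.cast_nonneg _) (log_natCast_nonneg _)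
      simp only [Nat.cast_zero, zero_add, Real.log_one, mul_zero, add_zero] at h4
      push_cast at h2 ⊢
      linarith
  obtain ⟨l, hl1, hl2, h1, h2⟩ := hmon K le_rfl
  have hBC : ∀ a : ℕ, a ≤ B * (K + 1) →
      (a : ℝ) ≤ (B + (m + 1) * D + |Real.log (U 1 m)|) * (K + 1) := by
    intro a ha
    have h3 : (a : ℝ) ≤ B * (K + 1) := by exact_mod_cast ha
    refine h3.trans (mul_le_mul_of_nonneg_right ?_ (by positivity))
    have h1 := abs_nonneg (Real.log (U 1 m))
    have : 0 ≤ ((m : ℝ) + 1) * D := by positivity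
    linarith
  refine ⟨1 + K * L, l, ?_, hBC _ ?_, by omega, hBC _ ?_, h1, ?_⟩
  · have := Nat.mul_le_mul_left K hL1; omega
  · have e2 : (1 + L) * (K + 1) ≤ B * (K + 1) := Nat.mul_le_mul_right _ (by omega)
    have e3 : (1 + L) * (K + 1) = 1 + K * L + K + L := by ring
    omega
  · have e2 : (m + p * m + β) * (K + 1) ≤ B * (K + 1) := Nat.mul_le_mul_right _ (by omega)
    have e3 : (m + p * m + β) * (K + 1) = m + p * (m * K) + K * β + (m * K + p * m + β) := by ring
    omega
  · refine le_trans ?_ h2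
    have h3 := neg_abs_le (Real.log (U 1 m))
    have h4 : |Real.log (U 1 m)| * 1 ≤ |Real.log (U 1 m)| * ((K + 1) * Λ) := by
      refine mul_le_mul_of_nonneg_left ?_ (abs_nonneg _)
      exact one_le_mul_of_one_le_of_one_le (by linarith [(Nat.cast_nonneg K : (0 : ℝ) ≤ K)]) hΛ1
    have h5 : 0 ≤ (m + 1) * (D * Λ) := by positivity
    have h6 : 0 ≤ (B : ℝ) * (K + 1) * Λ := by positivity
    push_cast
    nlinarith

lemma mul_log_sub_le_log_factorial (n : ℕ) : n * Real.log n - n ≤ Real.log n ! := by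
  rcases Nat.eq_zero_or_pos n with rfl | hn
  · simp
  have h := Real.pow_div_factorial_le_exp (n : ℝ) (Nat.cast_nonneg n) n
  have hn0 : (0 : ℝ) < n := by exact_mod_cast hn
  have hf : (0 : ℝ) < n ! := by exact_mod_cast Nat.factorial_pos n
  have := Real.log_le_log (by positivity) h
  rw [Real.log_exp, Real.log_div (by positivity) hf.ne', Real.log_pow] at this
  linarith

lemma log_factorial_le_mul_log (n : ℕ) : Real.log n ! ≤ n * Real.log n := by
  rw [← Real.log_pow]
  exact Real.log_le_log (by exact_mod_cast Nat.factorial_pos n)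
    (by exact_mod_cast Nat.factorial_le_pow n)

lemma log_factorial_succ (n : ℕ) : Real.log (n + 1)! = Real.log (n + 1) + Real.log n ! := by
  rw [Nat.factorial_succ, Nat.cast_mul, Real.log_mul (by positivity)
    (by exact_mod_cast (Nat.factorial_pos n).ne')]
  push_cast
  ring

/-- Since w < 1, the cost n^w log n of reaching order n^w in t is O(n), negligible against n log n.
-/
lemma rpow_mul_log_le {w : ℝ} (hw : w < 1) {n : ℕ} (hn : 1 ≤ n) :
    (n : ℝ) ^ w * Real.log n ≤ (1 - w)⁻¹ * n := by
  have hn0 : (0 : ℝ) < n := by exact_mod_cast hn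
  have h := Real.log_le_rpow_div hn0.le (sub_pos.2 hw)
  calc (n : ℝ) ^ w * Real.log n ≤ (n : ℝ) ^ w * ((n : ℝ) ^ (1 - w) / (1 - w)) := by gcongr
    _ = ((n : ℝ) ^ w * (n : ℝ) ^ (1 - w)) * (1 - w)⁻¹ := by ring
    _ = _ := by rw [← Real.rpow_add hn0]; simp [mul_comm]

lemma rpow_le_self {w : ℝ} (hw : w < 1) {n : ℕ} (hn : 1 ≤ n) : (n : ℝ) ^ w ≤ n := by
  have := Real.rpow_le_rpow_of_exponent_le (x := n) (by exact_mod_cast hn) hw.le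
  rwa [Real.rpow_one] at this

/-- The perturbation C n^w changes the bound for log a! by O(n) only, again because w < 1. -/
lemma log_factorial_le {w b C : ℝ} (hw : w < 1) (hb : 0 ≤ b) (hC : 0 ≤ C) :
    ∃ C' : ℝ, ∀ n a : ℕ, 1 ≤ n → (a : ℝ) ≤ b * n + C * (n : ℝ) ^ w →
      Real.log a ! ≤ b * (n * Real.log n) + C' * n := by
  refine ⟨(b + C) * Real.log (b + C + 1) + C * (1 - w)⁻¹, fun n a hn ha => ?_⟩
  have hn0 : (0 : ℝ) < n := by exact_mod_cast hn
  have hlogC : 0 ≤ Real.log (b + C + 1) := Real.log_nonneg (by linarith)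
  have hlogn := log_natCast_nonneg n
  have h1 := rpow_le_self hw hn
  have h2 := rpow_mul_log_le hw hn
  have h3 : (a : ℝ) ≤ (b + C) * n := by nlinarith
  rcases Nat.eq_zero_or_pos a with rfl | ha0
  · have : 0 < 1 - w := by linarith
    simp only [Nat.factorial_zero, Nat.cast_one, Real.log_one]
    positivity
  have h4 : Real.log a ≤ Real.log (b + C + 1) + Real.log n := by
    rw [← Real.log_mul (by positivity) hn0.ne']
    exact Real.log_le_log (by exact_mod_cast ha0) (by nlinarith)
  calc Real.log a ! ≤ a * Real.log a := log_factorial_le_mul_log a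
    _ ≤ a * (Real.log (b + C + 1) + Real.log n) := by gcongr
    _ = a * Real.log (b + C + 1) + a * Real.log n := by ring
    _ ≤ ((b + C) * n) * Real.log (b + C + 1) + (b * n + C * (n : ℝ) ^ w) * Real.log n := by
        gcongr
    _ = (b + C) * n * Real.log (b + C + 1) + b * (n * Real.log n) +
        C * ((n : ℝ) ^ w * Real.log n) := by ring
    _ ≤ (b + C) * n * Real.log (b + C + 1) + b * (n * Real.log n) + C * ((1 - w)⁻¹ * n) := by
        gcongr
    _ = _ := by ring

lemma not_forall_mul_log_le {θ C : ℝ} (hθ : 0 < θ) (n₀ : ℕ) :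
    ¬ ∀ n : ℕ, n₀ ≤ n → 1 ≤ n → θ * (n * Real.log n) ≤ C * n := by
  intro h
  have ht : Filter.Tendsto (fun n : ℕ => Real.log n) Filter.atTop Filter.atTop :=
    Real.tendsto_log_atTop.comp tendsto_natCast_atTop_atTop
  obtain ⟨n, hn, hn1⟩ := ((ht.eventually_gt_atTop (C / θ)).and
    (Filter.eventually_ge_atTop (max n₀ 1))).exists
  have hn0 : (0 : ℝ) < n := by exact_mod_cast (le_max_right _ _).trans hn1
  have := h n ((le_max_left _ _).trans hn1) ((le_max_right _ _).trans hn1)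
  rw [div_lt_iff₀ hθ] at hn
  nlinarith

/-- The growth in `x` caused by a term of `Λ₁` below a slope of the Newton polygon. -/
lemma exists_growth (hG : PosData G) (hU : IsRecSol G U) {q : Idx m} {p : ℕ} (hp : 1 ≤ p)
    (hc : 0 < cFun G q p) {d : Var m →₀ ℕ} (hd : 2 ≤ tzDegree d) (hGd : 0 < G d) {q' : Idx m}
    (hq' : d (Var.z q') ≠ 0) {w y : ℝ} (hw0 : 0 ≤ w) (hw : w < 1)
    (hm : w * m ≤ w * q.1.1 + q.1.2 - y)
    (hq : ∀ r : Idx m, cFun G r 0 ≠ 0 → w * r.1.1 + r.1.2 ≤ w * q.1.1 + q.1.2 - y) :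
    ∃ C : ℝ, 0 ≤ C ∧ ∀ n : ℕ, 1 ≤ n → ∃ k l : ℕ, 1 ≤ k ∧ (k : ℝ) ≤ C * (n : ℝ) ^ w ∧ m ≤ l ∧
      p * n ≤ l ∧ (l : ℝ) ≤ p * n + C * (n : ℝ) ^ w ∧ 0 < U k l ∧
      y * (n * Real.log n) ≤ C * n + Real.log (U k l) := by
  obtain ⟨C₀, hC₀, hstart⟩ := exists_start hG hU hp hc hd hGd hq'
  obtain ⟨C₁, hC₁⟩ := log_charFun_le hG hm hq (B := 2 * C₀ + p)
    (by have : (0 : ℝ) ≤ p := Nat.cast_nonneg p; linarith)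
  set c := Real.log (cFun G q p) with hcdef
  refine ⟨2 * C₀ * (1 + (1 - w)⁻¹) + |C₁ - c| + q.1.2, ?_, fun n hn => ?_⟩
  · have : 0 < 1 - w := by linarith
    positivity
  set C := 2 * C₀ * (1 + (1 - w)⁻¹) + |C₁ - c| + q.1.2 with hC
  have hw' : 0 < (1 - w)⁻¹ := inv_pos.2 (by linarith)
  have hCC : 2 * C₀ ≤ C := by
    have h1 := abs_nonneg (C₁ - c)
    have h2 : (0 : ℝ) ≤ q.1.2 := Nat.cast_nonneg _
    have h3 : 0 ≤ 2 * C₀ * (1 - w)⁻¹ := by positivity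
    rw [hC]; linarith
  have hn1 : (1 : ℝ) ≤ n := by exact_mod_cast hn
  have hn0 : (0 : ℝ) < n := by linarith
  set E := (n : ℝ) ^ w with hE
  have hE1 : 1 ≤ E := Real.one_le_rpow hn1 hw0
  have hEn : E ≤ n := rpow_le_self hw hn
  have hElog := rpow_mul_log_le hw hn
  have hlogn := log_natCast_nonneg n
  have hKE : (⌊E⌋₊ : ℝ) ≤ E := Nat.floor_le (by linarith)
  -- The starting order k lies between E = n^w and a constant multiple of it, and stays fixed from
  -- here on.
  obtain ⟨k, l, hk1, hk2, hl1, hl2, hpos, hlow⟩ := hstart n ⌊E⌋₊ hn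
    (by exact_mod_cast hKE.trans hEn)
  have hK2 : C₀ * ((⌊E⌋₊ : ℝ) + 1) ≤ 2 * C₀ * E := by nlinarith
  have hkE : E ≤ k := by
    have h1 := (Nat.lt_floor_add_one E).le
    have h2 : ((⌊E⌋₊ : ℝ) + 1) ≤ k := by exact_mod_cast hk1
    linarith
  have hlogk : w * Real.log n ≤ Real.log k := by
    rw [← Real.log_rpow hn0]
    exact Real.log_le_log (by linarith) hkE
  -- Each step gains k^j (i+1)^α against L = O(n^(wj+α-y)). As k ≥ n^w, the net gain is at least a
  -- constant times (i+1)^α n^(y-α).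
  have hpath : ∀ i ≤ n, 0 < U k (l + p * i) ∧
      Real.log (U k l) + i * (c - C₁ - (q.1.2 - y) * Real.log n) + q.1.2 * Real.log i ! ≤
        Real.log (U k (l + p * i)) := by
    intro i
    induction i with
    | zero => simpa using hpos
    | succ i ih =>
      intro hi
      obtain ⟨h1, h2⟩ := ih (by omega)
      obtain ⟨h3, h4⟩ := log_lin_step hG hU hp hc (k := k) (i := i) (by omega)
        (by have := idx_snd_le q; have := Nat.mul_le_mul_right i hp; omega) h1
      rw [add_assoc l, ← mul_add_one p i] at h3 h4
      refine ⟨h3, ?_⟩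
      have h5 := hC₁ n k (l + p * (i + 1)) hn (by omega)
        (by
          refine (hk2.trans hK2).trans ?_
          have : (0 : ℝ) ≤ p := Nat.cast_nonneg p
          nlinarith)
        (by
          have h6 : ((i : ℝ) + 1) ≤ n := by exact_mod_cast hi
          have : (0 : ℝ) ≤ p := Nat.cast_nonneg p
          push_cast
          nlinarith)
      have h6 : (q.1.1 : ℝ) * (w * Real.log n) ≤ q.1.1 * Real.log k := by gcongr
      rw [log_factorial_succ]
      push_cast
      linarith
  obtain ⟨h1, h2⟩ := hpath n le_rfl
  refine ⟨k, l + p * n, by omega, ?_, by omega, by omega, ?_, h1, ?_⟩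
  · exact (hk2.trans hK2).trans (by gcongr)
  · push_cast
    have := (hl2.trans hK2).trans (mul_le_mul_of_nonneg_right hCC (by linarith : 0 ≤ E))
    linarith
  -- By Stirling, (n!)^α n^((y-α)n) equals n^(yn) up to a geometric factor; the cost of the start is
  -- O(n) as well.
  · have h3 := mul_log_sub_le_log_factorial n
    have h4 : (q.1.2 : ℝ) * (n * Real.log n - n) ≤ q.1.2 * Real.log n ! := by gcongr
    have h5 : C₀ * ((⌊E⌋₊ : ℝ) + 1) * (1 + Real.log n) ≤ 2 * C₀ * E * (1 + Real.log n) := by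
      gcongr
    have h6 : 2 * C₀ * (E * Real.log n) ≤ 2 * C₀ * ((1 - w)⁻¹ * n) := by gcongr
    have h7 : 2 * C₀ * E ≤ 2 * C₀ * n := by gcongr
    have h8 : (n : ℝ) * (C₁ - c) ≤ n * |C₁ - c| := by gcongr; exact le_abs_self _
    rw [hC]
    linarith

end TotChar
end

/-! ### Transfer of growth from x to t, and necessity of the indices -/

noncomputable section
namespace TotChar

variable {m : ℕ} {G : (Var m →₀ ℕ) → ℝ} {U : ℕ → ℕ → ℝ} {F : (Var m → ℂ) → ℂ}

/-- The monomial is applied K times. The e-th application gains at least e^j from t∂_t, because the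
order in t has grown, and (K-e+1)^α from ∂_x, because enough powers of x are left. This gives
K!^(j+α) in total, against a loss of n^m up to a constant at each step. -/
lemma exists_descent (hG : PosData G) (hU : IsRecSol G U) {d : Var m →₀ ℕ} (hd : 2 ≤ tzDegree d)
    (hGd : 0 < G d) {q : Idx m} (hq : d (Var.z q) ≠ 0) {δ : ℕ} (hδ : 1 ≤ δ)
    (hβ : d Var.x + δ = q.1.2) {B : ℝ} (hB : 1 ≤ B) :
    ∃ C : ℝ, 0 ≤ C ∧ ∀ n k l K : ℕ, 1 ≤ n → 1 ≤ k → K * δ + m ≤ l →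
      ((k + K * (tzDegree d - 1) : ℕ) : ℝ) ≤ B * n → (l : ℝ) ≤ B * n → 0 < U k l →
      0 < U (k + K * (tzDegree d - 1)) (l - K * δ) ∧
      Real.log (U k l) - K * (C + m * Real.log n) + ((q.1.1 : ℝ) + q.1.2) * Real.log K ! ≤
        Real.log (U (k + K * (tzDegree d - 1)) (l - K * δ)) := by
  obtain ⟨c, hmono⟩ := log_mono_step hG hU hd hGd hq
  obtain ⟨C₁, hC₁⟩ := log_charFun_le_crude hG hB
  generalize hL : tzDegree d - 1 = L at hmono ⊢
  have hL1 : 1 ≤ L := by omega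
  refine ⟨|C₁ - c|, abs_nonneg _, fun n k l K hn hk hKl hkB hlB hpos => ?_⟩
  have hα := idx_snd_le q
  have hloss := le_abs_self (C₁ - c)
  have hpath : ∀ e ≤ K, 0 < U (k + e * L) (l - e * δ) ∧
      Real.log (U k l) - e * (|C₁ - c| + m * Real.log n) + q.1.1 * Real.log e ! +
        q.1.2 * (Real.log K ! - Real.log (K - e)!) ≤ Real.log (U (k + e * L) (l - e * δ)) := by
    intro e
    induction e with
    | zero => simpa using hpos
    | succ e ih =>
      intro he
      obtain ⟨h1, h2⟩ := ih (by omega)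
      obtain ⟨i, hi0⟩ : ∃ i, K = e + 1 + i := ⟨K - (e + 1), by omega⟩
      have hmul : K * δ = e * δ + δ + i * δ := by rw [hi0]; ring
      have hi : i ≤ i * δ := Nat.le_mul_of_pos_right _ hδ
      obtain ⟨h3, h4⟩ := hmono (k + e * L) (l - e * δ) i (by omega) (by omega) h1
      have hk' : k + e * L + L = k + (e + 1) * L := by ring
      have hl' : l - e * δ - q.1.2 + d Var.x = l - (e + 1) * δ := by
        rw [add_one_mul]; omega
      rw [hk', hl'] at h3 h4
      refine ⟨h3, ?_⟩
      have h5 := hC₁ n (k + (e + 1) * L) (l - (e + 1) * δ) hn (by omega)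
        (le_trans (by exact_mod_cast Nat.add_le_add_left (Nat.mul_le_mul_right L he) k) hkB)
        (le_trans (by exact_mod_cast Nat.sub_le _ _) hlB)
      have h6 : (q.1.1 : ℝ) * Real.log (e + 1) ≤ q.1.1 * Real.log ((k + e * L : ℕ) : ℝ) := by
        have h7 : e + 1 ≤ k + e * L := by
          have := Nat.le_mul_of_pos_right e hL1; omega
        have h8 : ((e : ℝ) + 1) ≤ ((k + e * L : ℕ) : ℝ) := by exact_mod_cast h7
        gcongr
      have e1 : K - e = i + 1 := by omega
      have e2 : K - (e + 1) = i := by omega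
      rw [e1, log_factorial_succ i] at h2
      rw [e2, log_factorial_succ e, Nat.cast_add_one]
      linarith
  obtain ⟨h1, h2⟩ := hpath K le_rfl
  refine ⟨h1, ?_⟩
  rw [Nat.sub_self, Nat.factorial_zero, Nat.cast_one, Real.log_one, sub_zero] at h2
  linarith

/-- A monomial of `R₂` that lowers the power of `x` turns growth in `x` into growth in `t`. -/
lemma exists_growth_t (hG : PosData G) (hU : IsRecSol G U) {d : Var m →₀ ℕ} (hd : 2 ≤ tzDegree d)
    (hGd : 0 < G d) {q : Idx m} (hq : d (Var.z q) ≠ 0) {δ p : ℕ} (hδ : 1 ≤ δ)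
    (hβ : d Var.x + δ = q.1.2) (hp : 1 ≤ p) {w y C : ℝ} (hw : w < 1) (hC : 0 ≤ C)
    (hgrow : ∀ n : ℕ, 1 ≤ n → ∃ k l : ℕ, 1 ≤ k ∧ (k : ℝ) ≤ C * (n : ℝ) ^ w ∧ m ≤ l ∧
      p * n ≤ l ∧ (l : ℝ) ≤ p * n + C * (n : ℝ) ^ w ∧ 0 < U k l ∧
      y * (n * Real.log n) ≤ C * n + Real.log (U k l)) :
    ∃ C' : ℝ, 0 ≤ C' ∧ ∃ n₀ : ℕ, ∀ n : ℕ, n₀ ≤ n → 1 ≤ n → ∃ k l : ℕ,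
      (k : ℝ) ≤ p / δ * ((tzDegree d : ℝ) - 1) * n + C' * (n : ℝ) ^ w ∧ l ≤ 2 * m ∧ 0 < U k l ∧
      (y - p / δ * (m - q.1.1 - q.1.2)) * (n * Real.log n) ≤ C' * n + Real.log (U k l) := by
  have hLc : (tzDegree d : ℝ) - 1 = ((tzDegree d - 1 : ℕ) : ℝ) := by
    rw [Nat.cast_sub (by omega)]; simp
  have hJm : (q.1.1 : ℝ) + q.1.2 ≤ m := by exact_mod_cast idx_add_le q
  have hJ0 : (0 : ℝ) ≤ (q.1.1 : ℝ) + q.1.2 := by positivity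
  have hδm : δ ≤ m := by have := idx_snd_le q; omega
  have hδ1 : (1 : ℝ) ≤ δ := by exact_mod_cast hδ
  have hδ0 : (0 : ℝ) < δ := by linarith
  obtain ⟨C₁, hC₁, hdesc⟩ := exists_descent hG hU hd hGd hq hδ hβ
    (B := C + (p + C) * ((tzDegree d - 1 : ℕ) : ℝ) + (p + C) + 1)
    (by rw [le_add_iff_nonneg_left]; positivity)
  rw [hLc]
  generalize tzDegree d - 1 = L at hdesc ⊢
  have hJ : ∀ ρ : ℝ, ρ * (m - q.1.1 - q.1.2) = ρ * (m - ((q.1.1 : ℝ) + q.1.2)) := fun ρ => by ring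
  rw [hJ]
  generalize (q.1.1 : ℝ) + q.1.2 = J at hJm hJ0 hdesc ⊢
  obtain ⟨I, hI, hmJ⟩ : ∃ I : ℝ, 0 ≤ I ∧ (m : ℝ) = J + I := ⟨m - J, by linarith, by ring⟩
  rw [hmJ, add_sub_cancel_left]
  simp only [hmJ] at hdesc
  have hlogδ : 0 ≤ Real.log (2 * δ) := Real.log_nonneg (by linarith)
  have hw' : 0 < (1 - w)⁻¹ := inv_pos.2 (by linarith)
  refine ⟨C + C * L + (p + C) * (C₁ + J * (Real.log (2 * δ) + 1)) + C * I * (1 - w)⁻¹,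
    by positivity, 4 * m, fun n hn hn1 => ?_⟩
  obtain ⟨k, l, hk1, hkn, hml, hpl, hln, hpos, hlow⟩ := hgrow n hn1
  have hn1' : (1 : ℝ) ≤ n := by exact_mod_cast hn1
  have hn0 : (0 : ℝ) < n := by linarith
  have hE0 : 0 < (n : ℝ) ^ w := by positivity
  have hEn := rpow_le_self hw hn1
  have hElog := rpow_mul_log_le hw hn1
  have hlogn := log_natCast_nonneg n
  generalize (n : ℝ) ^ w = E at hkn hln hE0 hEn hElog ⊢
  -- The descent runs as long as the power of x stays at least m; thus K is about p n / δ, and the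
  -- final power is below m + δ ≤ 2m.
  obtain ⟨K, hKl, hKl'⟩ : ∃ K : ℕ, K * δ + m ≤ l ∧ l < K * δ + m + δ := by
    refine ⟨(l - m) / δ, ?_, ?_⟩
    · have := Nat.div_mul_le_self (l - m) δ
      omega
    · have := Nat.lt_mul_div_succ (l - m) (by omega : 0 < δ)
      rw [mul_add_one, mul_comm δ] at this
      omega
  have hCE : C * E ≤ C * n := by gcongr
  have hKδ : (K : ℝ) * δ ≤ p * n + C * E := by
    have h : ((K * δ : ℕ) : ℝ) ≤ l := by exact_mod_cast (by omega : K * δ ≤ l)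
    push_cast at h
    linarith
  have hK1 : (K : ℝ) ≤ p / δ * n + C * E := by
    have h1 : (K : ℝ) ≤ (p * n + C * E) / δ := by rwa [le_div_iff₀ hδ0]
    have h2 : C * E / δ ≤ C * E := div_le_self (by positivity) hδ1
    calc (K : ℝ) ≤ p / δ * n + C * E / δ := by rw [add_div] at h1; convert h1 using 2; ring
      _ ≤ _ := by linarith
  have hKB : (K : ℝ) ≤ (p + C) * n := by
    have h : (K : ℝ) ≤ K * δ := le_mul_of_one_le_right (Nat.cast_nonneg K) hδ1
    linarith
  -- n ≥ 4m is needed here. With K of the order of n, the gain J log K! matches J K log n up to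
  -- O(n), so that only m - J powers of n are lost per step.
  have hKlow : (n : ℝ) ≤ 2 * δ * K := by
    have h1 : n ≤ p * n := Nat.le_mul_of_pos_left _ hp
    have h2 : n ≤ 2 * (K * δ) := by omega
    have h3 : (n : ℝ) ≤ ((2 * (K * δ) : ℕ) : ℝ) := by exact_mod_cast h2
    push_cast at h3
    linarith
  have hK0 : (0 : ℝ) < K := by
    by_contra! h
    have : 2 * (δ : ℝ) * K ≤ 0 := mul_nonpos_of_nonneg_of_nonpos (by positivity) h
    linarith
  have hlogK : Real.log n ≤ Real.log (2 * δ) + Real.log K := by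
    rw [← Real.log_mul (by positivity) hK0.ne']
    exact Real.log_le_log hn0 hKlow
  have hKL : (K : ℝ) * L ≤ (p + C) * n * L := by gcongr
  obtain ⟨h1, h2⟩ := hdesc n k l K hn1 hk1 hKl
    (by
      have : 0 ≤ ((p : ℝ) + C + 1) * n := by positivity
      push_cast
      linarith)
    (by
      have : 0 ≤ (C + (p + C) * L + 1) * n := by positivity
      linarith) hpos
  refine ⟨k + K * L, l - K * δ, ?_, by omega, h1, ?_⟩
  · have h3 : (K : ℝ) * L ≤ (p / δ * n + C * E) * L := by gcongr
    have h4 : 0 ≤ ((p + C) * (C₁ + J * (Real.log (2 * δ) + 1)) + C * I * (1 - w)⁻¹) * E := by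
      positivity
    push_cast
    linarith
  · have h3 := mul_log_sub_le_log_factorial K
    have h4 : J * (K * Real.log K - K) ≤ J * Real.log K ! := by gcongr
    have h5 : J * K * Real.log n ≤ J * K * (Real.log (2 * δ) + Real.log K) := by gcongr
    have h7 : (K : ℝ) * (C₁ + J * (Real.log (2 * δ) + 1)) ≤
        (p + C) * n * (C₁ + J * (Real.log (2 * δ) + 1)) := by gcongr
    have h8 : I * Real.log n * K ≤ I * Real.log n * (p / δ * n + C * E) := by gcongr
    have h9 : C * I * (E * Real.log n) ≤ C * I * ((1 - w)⁻¹ * n) := by gcongr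
    have h10 : 0 ≤ C * L * n := by positivity
    generalize (p : ℝ) / δ = ρ at h8 ⊢
    generalize (1 - w)⁻¹ = v at h9 ⊢
    linarith

lemma cFun_zeroOrder_pos (hG : PosData G)
    (hF : ∀ d, MvPowerSeries.coeff d (taylor F) = (G d : ℂ)) {q : Idx m} (hq : q ∈ Lam1 F) :
    0 < cFun G q (zeroOrder F q) := by
  have h := coeff_zeroOrder_ne_zero hq
  obtain ⟨p, hp⟩ := Nat.exists_eq_add_of_le' (zeroOrder_pos hq)
  rw [coeff_cCoeff, hF, hp] at h
  rw [hp]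
  exact lt_of_le_of_ne (hG.c_nonneg q p) (Ne.symm (by exact_mod_cast h))

lemma pos_of_coeff_ne_zero (hG : PosData G)
    (hF : ∀ d, MvPowerSeries.coeff d (taylor F) = (G d : ℂ)) {d : Var m →₀ ℕ}
    (hd : 2 ≤ tzDegree d) (h : MvPowerSeries.coeff d (taylor F) ≠ 0) : 0 < G d := by
  rw [hF] at h
  exact lt_of_le_of_ne (hG.nonneg d hd) (Ne.symm (by exact_mod_cast h))

/-- Growth in `x` at any rate below the irregularity. -/
lemma exists_growth_of_lt_irregularity (hG : PosData G)
    (hF : ∀ d, MvPowerSeries.coeff d (taylor F) = (G d : ℂ)) (hU : IsRecSol G U)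
    {d : Var m →₀ ℕ} (hd : 2 ≤ tzDegree d) (hGd : 0 < G d) {q' : Idx m}
    (hq' : d (Var.z q') ≠ 0) {σ : ℝ} (hσ : 1 ≤ σ) (h : σ < irregularity F) :
    ∃ (p : ℕ) (w y C : ℝ), 1 ≤ p ∧ w < 1 ∧ p * (σ - 1) < y ∧ 0 ≤ C ∧
      ∀ n : ℕ, 1 ≤ n → ∃ k l : ℕ, 1 ≤ k ∧ (k : ℝ) ≤ C * (n : ℝ) ^ w ∧ m ≤ l ∧
      p * n ≤ l ∧ (l : ℝ) ≤ p * n + C * (n : ℝ) ^ w ∧ 0 < U k l ∧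
      y * (n * Real.log n) ≤ C * n + Real.log (U k l) := by
  obtain ⟨q, hq, hlt⟩ := exists_of_lt_irregularity hσ h
  obtain ⟨y, hy1, hy2⟩ := exists_between hlt
  have hy0 : 0 < y := lt_of_le_of_lt (mul_nonneg (Nat.cast_nonneg _) (by linarith)) hy1
  obtain ⟨w, hw0, hw1, hw⟩ := exists_slope hy0 hy2
  obtain ⟨C, hC, hgrow⟩ := exists_growth hG hU (zeroOrder_pos hq) (cFun_zeroOrder_pos hG hF hq)
    hd hGd hq' hw0 hw1 (by simpa using hw (m, 0) (Or.inl rfl))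
    (fun r hr => hw r.1 (Or.inr ⟨r, (mem_Lam0_iff hF r).2 hr, rfl⟩))
  exact ⟨zeroOrder F q, w, y, C, zeroOrder_pos hq, hw1, hy1, hC, hgrow⟩

section Bound

variable {A s σ : ℝ}

/-- At k = O(n^w), l = pn + O(n^w) the Gevrey bound is (σ-1) p n log n + O(n), while the growth in x
reaches y n log n with y > p (σ-1). -/
lemma irregularity_le_of_bound (hG : PosData G)
    (hF : ∀ d, MvPowerSeries.coeff d (taylor F) = (G d : ℂ)) (hU : IsRecSol G U)
    {d : Var m →₀ ℕ} (hd : 2 ≤ tzDegree d) (hGd : 0 < G d) {q' : Idx m}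
    (hq' : d (Var.z q') ≠ 0) (hs : 1 ≤ s) (hσ : 1 ≤ σ) (hA : 0 ≤ A)
    (hub : ∀ k l, 0 < U k l → Real.log (U k l) ≤
      A * (k + l + 1) + (s - 1) * Real.log k ! + (σ - 1) * Real.log l !) :
    irregularity F ≤ σ := by
  by_contra! hlt
  obtain ⟨p, w, y, C, hp, hw, hy, hC, hgrow⟩ :=
    exists_growth_of_lt_irregularity hG hF hU hd hGd hq' hσ hlt
  obtain ⟨D₁, hD₁⟩ := log_factorial_le (b := 0) hw le_rfl hC
  obtain ⟨D₂, hD₂⟩ := log_factorial_le (b := p) hw (Nat.cast_nonneg p) hC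
  refine not_forall_mul_log_le (sub_pos.2 hy)
    (C := C + A * (2 * C + p + 1) + (s - 1) * D₁ + (σ - 1) * D₂) 0 fun n _ hn => ?_
  obtain ⟨k, l, hk1, hkn, hml, hpl, hln, hpos, hlow⟩ := hgrow n hn
  have hn1 : (1 : ℝ) ≤ n := by exact_mod_cast hn
  have hEn := rpow_le_self hw hn
  have h1 := hub k l hpos
  have h2 : (s - 1) * Real.log k ! ≤ (s - 1) * (D₁ * n) := by
    have := hD₁ n k hn (by linarith)
    rw [zero_mul, zero_add] at this
    exact mul_le_mul_of_nonneg_left this (by linarith)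
  have h3 : (σ - 1) * Real.log l ! ≤ (σ - 1) * (p * (n * Real.log n) + D₂ * n) :=
    mul_le_mul_of_nonneg_left (hD₂ n l hn hln) (by linarith)
  have h4 : A * ((k : ℝ) + l + 1) ≤ A * ((2 * C + p + 1) * n) := by
    refine mul_le_mul_of_nonneg_left ?_ hA
    nlinarith
  linarith

/-- The chain ends at l ≤ 2m, where the factor l!^(σ-1) is bounded; the growth there can only be
accounted for by s. -/
lemma gevreyIndex_le_of_bound (hG : PosData G)
    (hF : ∀ d, MvPowerSeries.coeff d (taylor F) = (G d : ℂ)) (hU : IsRecSol G U)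
    (hs : 1 ≤ s) (hσ : 1 ≤ σ) (hA : 0 ≤ A)
    (hub : ∀ k l, 0 < U k l → Real.log (U k l) ≤
      A * (k + l + 1) + (s - 1) * Real.log k ! + (σ - 1) * Real.log l !) :
    gevreyIndex F ≤ s := by
  by_contra! hlt
  obtain ⟨d, q, hd, hne, hq, hineq⟩ := exists_of_lt_gevreyIndex hs hlt
  have hGd := pos_of_coeff_ne_zero hG hF hd hne
  have hL : (1 : ℝ) ≤ (tzDegree d : ℝ) - 1 := by
    have : (2 : ℝ) ≤ tzDegree d := by exact_mod_cast hd
    linarith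
  have hJm : (q.1.1 : ℝ) + q.1.2 ≤ m := by exact_mod_cast idx_add_le q
  have hirr := one_le_irregularity F
  have hsL : 0 ≤ (s - 1) * ((tzDegree d : ℝ) - 1) := mul_nonneg (by linarith) (by linarith)
  -- For β ≥ α the numerator would not be positive, because σ₀ ≥ 1 and j + α ≤ m.
  have hlt' : d Var.x < q.1.2 := by
    by_contra! hge
    have h1 : (q.1.2 : ℝ) ≤ d Var.x := by exact_mod_cast hge
    nlinarith
  obtain ⟨δ, hδ⟩ := Nat.exists_eq_add_of_le hlt'.le
  have hδ1 : 1 ≤ δ := by omega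
  have hδ0 : (0 : ℝ) < δ := by exact_mod_cast hδ1
  have hδc : (q.1.2 : ℝ) = d Var.x + δ := by exact_mod_cast hδ
  -- The violated inequality rearranges to 1 + T / δ < σ₀, so growth in x is available with some y >
  -- p T / δ. The descent loses (p / δ)(m - j - α) of it, and what remains exceeds (s-1)(p /
  -- δ)(degree-1), the rate permitted at the final order in t.
  set T : ℝ := (s - 1) * ((tzDegree d : ℝ) - 1) + (m - q.1.1 - q.1.2) with hT
  have hT0 : 0 ≤ T := by rw [hT]; linarith
  obtain ⟨p, w, y, C, hp, hw, hy, hC, hgrow⟩ :=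
    exists_growth_of_lt_irregularity hG hF hU hd hGd hq (σ := 1 + T / δ)
      (by have := div_nonneg hT0 hδ0.le; linarith)
      (by
        rw [← lt_sub_iff_add_lt', div_lt_iff₀ hδ0, hT]
        rw [hδc] at hineq ⊢
        linarith)
  obtain ⟨C', hC', n₀, hgrow'⟩ := exists_growth_t hG hU hd hGd hq hδ1 hδ.symm hp hw hC hgrow
  have hpδ : (0 : ℝ) ≤ p / δ := by positivity
  obtain ⟨D, hD⟩ := log_factorial_le (b := p / δ * ((tzDegree d : ℝ) - 1)) hw
    (mul_nonneg hpδ (by linarith)) hC'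
  have hθ : 0 < y - p / δ * T := by
    have : (p : ℝ) * (1 + T / δ - 1) = p / δ * T := by ring
    rw [this] at hy
    linarith
  have hf0 : 0 ≤ Real.log (2 * m)! := log_natCast_nonneg _
  refine not_forall_mul_log_le hθ (C := C' + A * (p / δ * ((tzDegree d : ℝ) - 1) + C' + 2 * m + 1)
    + (s - 1) * D + (σ - 1) * Real.log (2 * m)!) n₀ fun n hn0 hn => ?_
  obtain ⟨k, l, hkn, hl, hpos, hlow⟩ := hgrow' n hn0 hn
  have hn1 : (1 : ℝ) ≤ n := by exact_mod_cast hn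
  have hEn := rpow_le_self hw hn
  have h1 := hub k l hpos
  have h2 : (s - 1) * Real.log k ! ≤
      (s - 1) * (p / δ * ((tzDegree d : ℝ) - 1) * (n * Real.log n) + D * n) :=
    mul_le_mul_of_nonneg_left (hD n k hn hkn) (by linarith)
  have h3 : (σ - 1) * Real.log l ! ≤ (σ - 1) * (Real.log (2 * m)! * n) := by
    refine mul_le_mul_of_nonneg_left (le_trans ?_ (le_mul_of_one_le_right hf0 hn1)) (by linarith)
    exact Real.log_le_log (by exact_mod_cast Nat.factorial_pos l)
      (by exact_mod_cast Nat.factorial_le hl)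
  have h4 : A * ((k : ℝ) + l + 1) ≤
      A * ((p / δ * ((tzDegree d : ℝ) - 1) + C' + 2 * m + 1) * n) := by
    refine mul_le_mul_of_nonneg_left ?_ hA
    have hl' : (l : ℝ) ≤ 2 * m := by exact_mod_cast hl
    have : (0 : ℝ) ≤ m := Nat.cast_nonneg m
    nlinarith
  rw [hT]
  linarith

end Bound

end TotChar
end

/-! ### Gevrey classes, passage to complex coefficients, and conclusion -/

noncomputable section
namespace TotChar

variable {m : ℕ} {G : (Var m →₀ ℕ) → ℝ} {U : ℕ → ℕ → ℝ} {F : (Var m → ℂ) → ℂ}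

lemma gevreyWeight_pos (s σ : ℝ) (k l : ℕ) :
    0 < (k ! : ℝ) ^ (s - 1) * (l ! : ℝ) ^ (σ - 1) := by
  have h1 : (0 : ℝ) < k ! := by exact_mod_cast Nat.factorial_pos k
  have h2 : (0 : ℝ) < l ! := by exact_mod_cast Nat.factorial_pos l
  positivity

lemma inGevrey_of_bound {u : MvPowerSeries (Fin 2) ℂ} {D s₀ σ₀ s σ : ℝ} (hD : 1 ≤ D)
    (h : ∀ k l, ‖coeffTX u k l‖ ≤
      D ^ (k + l + 1) * ((k ! : ℝ) ^ (s₀ - 1) * (l ! : ℝ) ^ (σ₀ - 1)))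
    (hs : s₀ ≤ s) (hσ : σ₀ ≤ σ) : InGevrey s σ u := by
  have hD0 : 0 < D := by linarith
  have hball : ∀ᶠ w : ℂ × ℂ in 𝓝 0, ‖w‖ < (2 * D)⁻¹ := by
    have : Metric.ball (0 : ℂ × ℂ) (2 * D)⁻¹ ∈ 𝓝 0 := Metric.ball_mem_nhds _ (by positivity)
    filter_upwards [this] with w hw
    simpa using hw
  filter_upwards [hball] with w hw
  have hgeo : Summable fun n : ℕ × ℕ => D * (((1 / 2 : ℝ)) ^ n.1 * (1 / 2 : ℝ) ^ n.2) :=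
    (Summable.mul_of_nonneg summable_geometric_two summable_geometric_two
      (fun n => by positivity) (fun n => by positivity)).mul_left D
  refine Summable.of_norm_bounded hgeo fun n => ?_
  obtain ⟨k, l⟩ := n
  have hW := gevreyWeight_pos s σ k l
  have hw1 : ‖w.1‖ ≤ (2 * D)⁻¹ := (norm_fst_le w).trans hw.le
  have hw2 : ‖w.2‖ ≤ (2 * D)⁻¹ := (norm_snd_le w).trans hw.le
  have hmono : (k ! : ℝ) ^ (s₀ - 1) * (l ! : ℝ) ^ (σ₀ - 1) ≤
      (k ! : ℝ) ^ (s - 1) * (l ! : ℝ) ^ (σ - 1) := by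
    have h1 : (1 : ℝ) ≤ k ! := by exact_mod_cast Nat.factorial_pos k
    have h2 : (1 : ℝ) ≤ l ! := by exact_mod_cast Nat.factorial_pos l
    gcongr
  rw [norm_mul, norm_mul, norm_pow, norm_pow, norm_div, Complex.norm_real, Real.norm_eq_abs,
    abs_of_pos hW]
  have hquot : ‖coeffTX u k l‖ / ((k ! : ℝ) ^ (s - 1) * (l ! : ℝ) ^ (σ - 1)) ≤
      D ^ (k + l + 1) := by
    rw [div_le_iff₀ hW]
    exact (h k l).trans (by gcongr)
  calc ‖coeffTX u k l‖ / ((k ! : ℝ) ^ (s - 1) * (l ! : ℝ) ^ (σ - 1)) * ‖w.1‖ ^ k * ‖w.2‖ ^ l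
      ≤ D ^ (k + l + 1) * ((2 * D)⁻¹) ^ k * ((2 * D)⁻¹) ^ l := by gcongr
    _ = D * ((D * (2 * D)⁻¹) ^ k * (D * (2 * D)⁻¹) ^ l) := by
        rw [mul_pow, mul_pow, pow_add, pow_add]; ring
    _ = D * ((1 / 2) ^ k * (1 / 2) ^ l) := by
        rw [show D * (2 * D)⁻¹ = 1 / 2 by field_simp]

/-- The terms of the convergent series at one point with positive real coordinates are bounded;
taking logarithms gives a bound linear in k + l beside the factorials. -/
lemma InGevrey.exists_log_le {u : MvPowerSeries (Fin 2) ℂ} {s σ : ℝ} (h : InGevrey s σ u)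
    (hu : ∀ k l, coeffTX u k l = (U k l : ℂ)) :
    ∃ A : ℝ, 0 ≤ A ∧ ∀ k l, 0 < U k l → Real.log (U k l) ≤
      A * (k + l + 1) + (s - 1) * Real.log k ! + (σ - 1) * Real.log l ! := by
  obtain ⟨ε, hε, hball⟩ := Metric.eventually_nhds_iff.1 h
  have hsum := hball (y := ((ε / 2 : ℝ), (ε / 2 : ℝ))) (by
    rw [dist_zero_right, Prod.norm_def, Complex.norm_real, Real.norm_eq_abs, max_self,
      abs_of_pos (by linarith)]
    linarith)
  have hn := hsum.norm
  obtain ⟨M, hM, hle⟩ : ∃ M : ℝ, 0 ≤ M ∧ ∀ k l,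
      |U k l| / ((k ! : ℝ) ^ (s - 1) * (l ! : ℝ) ^ (σ - 1)) * (ε / 2) ^ k * (ε / 2) ^ l ≤ M := by
    refine ⟨_, tsum_nonneg (g := fun n : ℕ × ℕ => ‖coeffTX u n.1 n.2 /
      (((n.1 ! : ℝ) ^ (s - 1) * (n.2 ! : ℝ) ^ (σ - 1) : ℝ) : ℂ) *
      ((ε / 2 : ℝ) : ℂ) ^ n.1 * ((ε / 2 : ℝ) : ℂ) ^ n.2‖) fun n => norm_nonneg _, fun k l => (le_of_eq ?_).trans
      (hn.le_tsum (k, l) fun n _ => norm_nonneg _)⟩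
    rw [norm_mul, norm_mul, norm_pow, norm_pow, norm_div, hu, Complex.norm_real,
      Complex.norm_real, Complex.norm_real, Real.norm_eq_abs, Real.norm_eq_abs, Real.norm_eq_abs,
      abs_of_pos (gevreyWeight_pos s σ k l), abs_of_pos (by linarith : 0 < ε / 2)]
  refine ⟨Real.log (M + 1) + |Real.log (ε / 2)|,
    add_nonneg (Real.log_nonneg (by linarith)) (abs_nonneg _), fun k l hpos => ?_⟩
  have hk : (0 : ℝ) < k ! := by exact_mod_cast Nat.factorial_pos k
  have hl : (0 : ℝ) < l ! := by exact_mod_cast Nat.factorial_pos l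
  have hε2 : 0 < ε / 2 := by linarith
  have h1 := (hle k l).trans (by linarith : M ≤ M + 1)
  rw [abs_of_pos hpos] at h1
  have h2 := Real.log_le_log (by positivity) h1
  rw [Real.log_mul (by positivity) (by positivity), Real.log_mul (by positivity) (by positivity),
    Real.log_div hpos.ne' (by positivity), Real.log_mul (by positivity) (by positivity),
    Real.log_rpow hk, Real.log_rpow hl, Real.log_pow, Real.log_pow] at h2
  have h3 := neg_abs_le (Real.log (ε / 2))
  have h4 : ((k : ℝ) + l) * -|Real.log (ε / 2)| ≤ (k + l) * Real.log (ε / 2) := by gcongr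
  have h5 : 0 ≤ Real.log (M + 1) * (k + l) :=
    mul_nonneg (Real.log_nonneg (by linarith)) (by positivity)
  have h6 := abs_nonneg (Real.log (ε / 2))
  linarith

lemma prod_range_sub_eq_descFactorial (l α : ℕ) :
    ∏ n ∈ Finset.range α, ((l : ℂ) - n) = (l.descFactorial α : ℂ) := by
  induction α with
  | zero => simp
  | succ α ih =>
    rw [Finset.prod_range_succ, ih, Nat.descFactorial_succ, Nat.cast_mul, mul_comm]
    rcases le_or_gt α l with h | h
    · rw [Nat.cast_sub h]
    · rw [Nat.descFactorial_of_lt h]; simp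

lemma charPoly_eq (hF : ∀ d, MvPowerSeries.coeff d (taylor F) = (G d : ℂ)) (k l : ℕ) :
    charPoly F k l = ((charFun G k l : ℝ) : ℂ) := by
  unfold charPoly charFun
  push_cast
  congr 1
  refine Finset.sum_congr rfl fun q _ => ?_
  rw [prod_range_sub_eq_descFactorial, ← PowerSeries.coeff_zero_eq_constantCoeff_apply,
    coeff_cCoeff, hF]
  rfl

lemma IsRecSol.ofReal (hU : IsRecSol G U) :
    IsRecSol (fun d => (G d : ℂ)) fun k l => (U k l : ℂ) := by
  refine ⟨fun l => by simp [hU.1], fun k hk l => ?_⟩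
  have h := congrArg Complex.ofRealHom (hU.2 k hk l)
  rw [map_add, map_add, map_mul, nonlin_map] at h
  have h1 : Complex.ofRealHom (charFun G k l) = charFun (fun d => (G d : ℂ)) k l := by
    simp [charFun, cFun]
  have h2 : Complex.ofRealHom (linPart G U k l) =
      linPart (fun d => (G d : ℂ)) (fun k l => (U k l : ℂ)) k l := by
    simp [linPart, cFun]
  have h3 : (fun (q : Idx m) k l => Complex.ofRealHom (zCoeff U q k l)) =
      zCoeff fun k l => (U k l : ℂ) := by
    funext q k l
    simp [zCoeff]
  have h4 : Complex.ofRealHom (if k = 1 then aFun G l else 0) =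
      if k = 1 then aFun (fun d => (G d : ℂ)) l else 0 := by
    split_ifs <;> simp [aFun]
  rw [h1, h2, h3, h4] at h
  exact h

end TotChar
end

theorem theorem2p7 (m : ℕ) (hm : 1 ≤ m) (F : (TotChar.Var m → ℂ) → ℂ)
    (r : TotChar.Var m → ℝ) (hr : ∀ v, 0 < r v)
    -- A1), A2), A3)
    (hA1 : AnalyticOnNhd ℂ F (TotChar.polydisk r))
    (hA2 : ∀ p ∈ TotChar.polydisk r, p TotChar.Var.t = 0 →
      (∀ q, p (TotChar.Var.z q) = 0) → F p = 0)
    (hA3 : ∀ q : TotChar.Idx m, 0 < q.1.2 → PowerSeries.X ^ q.1.2 ∣ TotChar.bCoeff F q)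
    -- c1), c2), c3), c4)
    (hc1 : (∀ μ ≤ m, 0 < (μ ! : ℂ) * PowerSeries.coeff μ (TotChar.aCoeff F)) ∧
      TotChar.MajZero (TotChar.aCoeff F))
    (hc2 : ∀ q : TotChar.Idx m, PowerSeries.constantCoeff (TotChar.cCoeff F q) ≤ 0)
    (hc3 : ∀ q : TotChar.Idx m, TotChar.MajZero
      (TotChar.cCoeff F q - PowerSeries.C (PowerSeries.constantCoeff (TotChar.cCoeff F q))))
    (hc4 : ∀ (i : ℕ) (ν : TotChar.Idx m →₀ ℕ), 2 ≤ i + ∑ q, ν q →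
      TotChar.MajZero (TotChar.tzCoeff F i ν)) :
    TotChar.NonResonant F ∧
    (∃! u : MvPowerSeries (Fin 2) ℂ, TotChar.IsFormalSolution F u) ∧
    ∀ u : MvPowerSeries (Fin 2) ℂ, TotChar.IsFormalSolution F u →
      ∀ s σ : ℝ, 1 ≤ s → 1 ≤ σ →
        (TotChar.gevreyIndex F ≤ s ∧ TotChar.irregularity F ≤ σ → TotChar.InGevrey s σ u) ∧
        -- the converse is claimed for equations whose part `R₂` depends on `z`
        ((∃ q : TotChar.Idx m,
            MvPowerSeries.pderiv ℂ (TotChar.Var.z q) (TotChar.R2 F) ≠ 0) →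
          (TotChar.InGevrey s σ u ↔
            TotChar.gevreyIndex F ≤ s ∧ TotChar.irregularity F ≤ σ)) := by
  obtain ⟨hG, hF⟩ := TotChar.posData_reTaylor hr hA1 hA2 hA3 hc1 hc2 hc3 hc4
  obtain ⟨U, hU, -⟩ := TotChar.existsUnique_isRecSol (G := TotChar.reTaylor F)
    fun k hk l => (TotChar.charFun_pos hG hk l).ne'
  have hchar : ∀ k l : ℕ, TotChar.charFun (fun d => MvPowerSeries.coeff d (TotChar.taylor F)) k l =
      ((TotChar.charFun (TotChar.reTaylor F) k l : ℝ) : ℂ) := by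
    intro k l
    simp [TotChar.charFun, TotChar.cFun, hF]
  obtain ⟨V, hV, hVu⟩ := TotChar.existsUnique_isRecSol
    (G := fun d => MvPowerSeries.coeff d (TotChar.taylor F)) fun k hk l => by
      rw [hchar]; exact_mod_cast (TotChar.charFun_pos hG hk l).ne'
  have hiff := TotChar.isFormalSolution_iff (F := F) (fun h => by rw [hF, hG.zero]; simp)
    (fun q h hh => by rw [hF, hG.bzero q h hh]; simp)
  -- By uniqueness the complex solution is the nonnegative real one.
  have hUV : (fun k l => (U k l : ℂ)) = V := by
    refine hVu _ ?_
    rw [show (fun d => MvPowerSeries.coeff d (TotChar.taylor F)) =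
      fun d => (TotChar.reTaylor F d : ℂ) from funext hF]
    exact hU.ofReal
  have hsol : ∀ u, TotChar.IsFormalSolution F u → ∀ k l, TotChar.coeffTX u k l = (U k l : ℂ) := by
    intro u hu k l
    rw [hVu _ ((hiff u).1 hu), ← hUV]
  refine ⟨fun k l hk => ?_, ⟨TotChar.ser V, ?_, fun u hu => ?_⟩, fun u hu s σ hs hσ => ?_⟩
  · rw [TotChar.charPoly_eq hF]
    exact_mod_cast (TotChar.charFun_pos hG hk l).ne'
  · refine (hiff _).2 ?_
    rwa [TotChar.coeffTX_ser]
  · rw [← TotChar.ser_coeffTX u, hVu _ ((hiff u).1 hu)]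
  have hupper : TotChar.gevreyIndex F ≤ s ∧ TotChar.irregularity F ≤ σ →
      TotChar.InGevrey s σ u := by
    rintro ⟨h1, h2⟩
    obtain ⟨D, hD, hbound⟩ := TotChar.exists_gevrey_bound hG hF hU
    refine TotChar.inGevrey_of_bound hD (fun k l => ?_) h1 h2
    rw [hsol u hu, Complex.norm_real, Real.norm_eq_abs, abs_of_nonneg (hU.nonneg hG k l)]
    exact hbound k l
  refine ⟨hupper, fun ⟨q, hq⟩ => ⟨fun h => ?_, hupper⟩⟩
  obtain ⟨A, hA, hub⟩ := h.exists_log_le (hsol u hu)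
  obtain ⟨d, hd, hne, hdq⟩ := TotChar.exists_of_pderiv_ne_zero hq
  exact ⟨TotChar.gevreyIndex_le_of_bound hG hF hU hs hσ hA hub,
    TotChar.irregularity_le_of_bound hG hF hU hd (TotChar.pos_of_coeff_ne_zero hG hF hd hne) hdq
      hs hσ hA hub⟩
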